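/- Let $\alpha$ be a quadratic irrational. Its continued fraction is eventually periodic; write $\alpha=[a_0;a_1,\dots,a_s,\overline{a_{s+1},\dots,a_{s+p}}]$ with $s\ge 0$, $p\ge 1$. Let $p_k/q_k=[a_0;a_1,\dots,a_k]$ be its convergents in lowest terms, and let $\delta_k=(-1)^k(q_k\alpha-p_k)$. There are (uniquely determined) constants $\eta>1$ and $C_r,E_r>0$, $D_r\in\mathbb{R}$ $(1\le r\le p)$ such that for all integers $m\ge 0$ and $1\le r\le p$ \[ q_{s+mp+r}=C_r\eta^m+D_r(-1)^{mp}\eta^{-m},\qquad \delta_{s+mp+r}=E_r\eta^{-m}. \] For $1\le r\le p$ let $\alpha_r=[0;\overline{a_{s+r+p},\dots,a_{s+r+2},a_{s+r+1}}]$ and \[ G_r(\alpha,x)=2\pi|x+C_rE_r|\prod_{n=1}^{\infty}\left|\left(1-C_rE_r\frac{\{n\alpha_r\}-\frac12}{n}\right)^2-\frac{\left(x+\frac{C_rE_r}{2}\right)^2}{n^2}\right|,\qquad x\in\mathbb{R}, \] where $\{\cdot\}$ is the fractional part and the infinite product is the limit of the partial products over $1\le n\le N$ as $N\to\infty$. For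 $k\ge 1$ let $[k]\in\{1,\dots,p\}$ be the index with $[k]\equiv k-s\pmod p$, and let \[ P_{q_k}(\alpha,x)=\prod_{n=1}^{q_k}\left|2\sin\left(\pi\left(n\alpha+(-1)^k\frac{x}{q_k}\right)\right)\right| . \] Then for every $1\le r\le p$ the infinite product defining $G_r(\alpha,\cdot)$ converges locally uniformly on $\mathbb{R}$ (its partial products converge locally uniformly and, on each compact set, the product of all but finitely many of its factors converges uniformly to a zero-free limit). The function $G_r(\alpha,\cdot)$ is continuous on $\mathbb{R}$, the set $\{x\in\mathbb{R}: G_r(\alpha,x)\ne 0\}$ is open, and $G_r(\alpha,\cdot)$ is continuously differentiable on it. For any compact interval $I\subset\mathbb{R}$ and any integer $k\ge 1$, \[ P_{q_k}(\alpha,x)=\left(1+O\left(q_k^{-1/2}\log^{3/4}q_k\right)\right)G_{[k]}(\alpha,x)+O\left(q_k^{-2}\right),\qquad x\in I, \] with implied constants depending only on $I$ and $\alpha$ (together with the chosen $s$ and $p$, which may be taken to be the minimal ones, determined by $\alpha$). In particular, for every $1\le r\le p$, $P_{q_{s+mp+r}}(\alpha,\cdot)\to G_r(\alpha,\cdot)$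 locally uniformly on $\mathbb{R}$ as $m\to\infty$. -/

import Mathlib

open Filter Topology

noncomputable section

namespace SudlerLimit

/-- `α` is a quadratic irrational: an irrational root of a quadratic polynomial over `ℤ`. -/
def IsQuadraticIrrational (α : ℝ) : Prop :=
  Irrational α ∧ ∃ a b c : ℤ, a ≠ 0 ∧ (a : ℝ) * α ^ 2 + b * α + c = 0

/-- The `k`-th partial quotient `a_k` of `α = [a₀; a₁, a₂, …]`
(with value `0` once the expansion has terminated, which never happens for irrational `α`). -/
def partialQuotient (α : ℝ) (k : ℕ) : ℤ :=
  ((GenContFract.IntFractPair.stream α k).map GenContFract.IntFractPair.b).getD 0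

/-- `p_k`, the numerator of the `k`-th convergent `p_k / q_k = [a₀; a₁, …, a_k]`. -/
def convNum (α : ℝ) (k : ℕ) : ℤ := (α.convergent k).num

/-- `q_k`, the denominator of the `k`-th convergent `p_k / q_k = [a₀; a₁, …, a_k]`. -/
def convDen (α : ℝ) (k : ℕ) : ℕ := (α.convergent k).den

/-- `δ_k = (-1)^k (q_k α - p_k)`. -/
def convErr (α : ℝ) (k : ℕ) : ℝ := (-1) ^ k * (convDen α k * α - convNum α k)

/-- `α = [a₀; a₁, …, a_s, overline(a_{s+1}, …, a_{s+p})]`. -/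
def HasPeriod (α : ℝ) (s p : ℕ) : Prop :=
  0 < p ∧ ∀ k, s < k → partialQuotient α (k + p) = partialQuotient α k

/-- `β = [0; overline(a_{s+r+p}, …, a_{s+r+2}, a_{s+r+1})]`, where the `a_k` are the partial
quotients of `α`. -/
def IsReversedPeriod (α : ℝ) (s p r : ℕ) (β : ℝ) : Prop :=
  partialQuotient β 0 = 0 ∧
    ∀ j : ℕ, partialQuotient β (j + 1) = partialQuotient α (s + r + p - j % p)

/-- The index `[k] ∈ {1, …, p}` with `[k] ≡ k - s` modulo `p` (also for `k ≤ s`). -/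
def periodIndex (s p k : ℕ) : ℕ := (((k : ℤ) - s - 1) % (p : ℤ) + 1).toNat

/-- The perturbed Sudler product `P_{q_k}(α, x)`. -/
def perturbedSudler (α : ℝ) (k : ℕ) (x : ℝ) : ℝ :=
  ∏ n ∈ Finset.Icc 1 (convDen α k),
    |2 * Real.sin (Real.pi * (n * α + (-1) ^ k * x / convDen α k))|

/-- The `n`-th factor (`n ≥ 1`) of the infinite product in the definition of the limit function;
`B` stands for `C_r E_r` and `β` for `α_r`. -/
def limitFactor (B β : ℝ) (n : ℕ) (x : ℝ) : ℝ :=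
  |(1 - B * ((Int.fract (n * β) - 1 / 2) / n)) ^ 2 - (x + B / 2) ^ 2 / (n : ℝ) ^ 2|

/-- The infinite product `∏_{n=1}^∞`, as the limit of the partial products `∏_{n=1}^N`
(the product need not converge unconditionally). -/
def limitProd (B β x : ℝ) : ℝ :=
  limUnder atTop fun N : ℕ => ∏ n ∈ Finset.Icc 1 N, limitFactor B β n x

/-- The limit function `G`, with `B = C_r E_r` and `β = α_r`. -/
def limitFun (B β x : ℝ) : ℝ := 2 * Real.pi * |x + B| * limitProd B β x

/-- The infinite product `∏_{n=1}^∞ f n` converges locally uniformly on `ℝ` to `F`: its partial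
products converge to `F` locally uniformly and, as is customary for infinite products, on every
compact set the product of all but finitely many factors converges uniformly to a
zero-free limit. -/
def ProdConvergesLocallyUniformly (f : ℕ → ℝ → ℝ) (F : ℝ → ℝ) : Prop :=
  TendstoLocallyUniformly (fun (N : ℕ) (x : ℝ) => ∏ n ∈ Finset.Icc 1 N, f n x) F atTop ∧
  ∀ K : Set ℝ, IsCompact K → ∃ (N₀ : ℕ) (g : ℝ → ℝ), (∀ x ∈ K, g x ≠ 0) ∧
    TendstoUniformlyOn (fun (N : ℕ) (x : ℝ) => ∏ n ∈ Finset.Ioc N₀ N, f n x) g atTop K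

end SudlerLimit

end

/-!
Write `q = q_k`, `p = p_k`, `q' = q_{k-1}` and `B' = q_k δ_k`, so that `α = p / q ± B' / q²`.

*Reduction to a product of sines over nodes.* Pairing the factors `n` and `q - n` of the perturbed
Sudler product turns them into differences of squares of sines. In the order `j ≡ ± n p (mod q)`,
and with `γ = q' / q`, where `q'` is up to sign the inverse of `p` modulo `q`, the product becomes
the exact expression of `prod_abs_two_sin_eq`: a factor `2 |sin (π (x + B') / q)| q` from `n = q`,
for each `j < q / 2` the quotient of `sin² (π (j - B' ({jγ} - 1/2)) / q) - sin² (π (x + B'/2) / q)`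
by `sin² (π j / q)`, and for even `q` a cosine from `n = q / 2`. Replacing each sine by its argument
gives the factors of the limit function.

*The limits of the parameters.* Over a period the errors `δ_k` are divided by a constant `η`, and
`q_k`, up to a multiple of `q_k α - p_k`, is multiplied by `η` (`exists_period_constants`). Hence
along a residue class `B'` tends to `B = C_r E_r`, and `γ` to the ratio `β` of consecutive dominant
parts, both with an error `O(q⁻²)`. The recurrence of the dominant parts shows that the partial
quotients of `β` are those of `α` read backwards (`isReversedPeriod_dominantRatio`), and its
approximation by the fractions `q_{k-1} / q_k` shows that `β` is badly approximable.

*The part independent of `x`.* Each factor splits into a square independent of `x`, close to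
`(1 - B ({jβ} - 1/2) / j)²`, and a factor `1 - O(j⁻²)`. The product of the former converges only
conditionally, and is controlled by summation by parts: the sums of `{jγ} - 1/2` over `j ≤ N ≤ q`
are `O(√N)` (`abs_sum_fract_le_sqrt`), which suffices for the relative error `O(q^{-1/2})` of
`exists_abs_sum_log_sin_sub_limit_le`. This is better than the rate claimed.

*The part depending on `x`.* The product of the factors `1 - O(j⁻²)` converges to an entire function
(`exists_contDiff_product`), which yields the regularity of the limit function. For `x` bounded, the
factors beyond a fixed `J` have a product at least `1/2`, and are compared multiplicatively. The
finitely many others, and the factor from `n = q`, may vanish: they are responsible for the additive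
error, and each of them is approximated up to `O(q⁻²)`. The two kinds of errors are combined in
`exists_sudler_estimate`.
-/

open Filter Topology

namespace SudlerLimit

/-! ### Continued fractions of irrational numbers -/

/-- The complete quotients `x_k = [a_k; a_{k+1}, …]` of the continued fraction of `ξ`. -/
noncomputable def completeQuot (ξ : ℝ) : ℕ → ℝ
  | 0 => ξ
  | n + 1 => (Int.fract (completeQuot ξ n))⁻¹

theorem completeQuot_add (ξ : ℝ) (m n : ℕ) :
    completeQuot ξ (m + n) = completeQuot (completeQuot ξ m) n := by
  induction n with
  | zero => rfl
  | succ n ih => rw [← add_assoc, completeQuot, ih, completeQuot]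

theorem irrational_fract {ξ : ℝ} (h : Irrational ξ) : Irrational (Int.fract ξ) := by
  rw [Int.fract]; exact h.sub_intCast _

theorem irrational_completeQuot {ξ : ℝ} (h : Irrational ξ) (n : ℕ) :
    Irrational (completeQuot ξ n) := by
  induction n with
  | zero => exact h
  | succ n ih => exact (irrational_fract ih).inv

theorem fract_completeQuot_pos {ξ : ℝ} (h : Irrational ξ) (n : ℕ) :
    0 < Int.fract (completeQuot ξ n) :=
  lt_of_le_of_ne (Int.fract_nonneg _) (irrational_fract (irrational_completeQuot h n)).ne_zero.symm

theorem one_lt_completeQuot_succ {ξ : ℝ} (h : Irrational ξ) (n : ℕ) :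
    1 < completeQuot ξ (n + 1) := by
  rw [completeQuot]
  exact (one_lt_inv₀ (fract_completeQuot_pos h n)).2 (Int.fract_lt_one _)

theorem stream_eq_some {ξ : ℝ} (h : Irrational ξ) (n : ℕ) :
    GenContFract.IntFractPair.stream ξ n =
      some (GenContFract.IntFractPair.of (completeQuot ξ n)) := by
  induction n with
  | zero => rfl
  | succ n ih =>
    rw [GenContFract.IntFractPair.stream_succ_of_some ih (fract_completeQuot_pos h n).ne']
    rfl

theorem partialQuotient_eq_floor {ξ : ℝ} (h : Irrational ξ) (n : ℕ) :
    partialQuotient ξ n = ⌊completeQuot ξ n⌋ := by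
  simp [partialQuotient, stream_eq_some h, GenContFract.IntFractPair.of]

theorem one_le_partialQuotient {ξ : ℝ} (h : Irrational ξ) (n : ℕ) :
    1 ≤ partialQuotient ξ (n + 1) := by
  rw [partialQuotient_eq_floor h, Int.le_floor]
  exact_mod_cast (one_lt_completeQuot_succ h n).le

theorem completeQuot_eq_add_inv {ξ : ℝ} (h : Irrational ξ) (n : ℕ) :
    completeQuot ξ n = partialQuotient ξ n + (completeQuot ξ (n + 1))⁻¹ := by
  rw [completeQuot, inv_inv, partialQuotient_eq_floor h, Int.floor_add_fract]

/-- The continuants in the numerators of the convergents of `[a₀; a₁, a₂, …]`. -/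
def contNum (a : ℕ → ℤ) : ℕ → ℤ
  | 0 => a 0
  | 1 => a 1 * a 0 + 1
  | n + 2 => a (n + 2) * contNum a (n + 1) + contNum a n

/-- The continuants in the denominators of the convergents of `[a₀; a₁, a₂, …]`. -/
def contDen (a : ℕ → ℤ) : ℕ → ℤ
  | 0 => 1
  | 1 => a 1
  | n + 2 => a (n + 2) * contDen a (n + 1) + contDen a n

theorem contDen_succ_eq (a : ℕ → ℤ) (n : ℕ) :
    contDen a (n + 1) = contNum (fun k => a (k + 1)) n := by
  induction n using Nat.twoStepInduction with
  | zero => rfl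
  | one => simp [contDen, contNum]
  | more n ih1 ih2 => rw [contDen, contNum, ih1, ih2]

/-- Continuants satisfy a recurrence at both ends; this one, at the front, matches the recursive
definition of `Real.convergent`. -/
theorem contNum_succ_eq (a : ℕ → ℤ) (n : ℕ) :
    contNum a (n + 1) =
      a 0 * contNum (fun k => a (k + 1)) n + contDen (fun k => a (k + 1)) n := by
  induction n using Nat.twoStepInduction with
  | zero => simp [contDen, contNum]; ring
  | one => simp [contDen, contNum]; ring
  | more n ih1 ih2 =>
    change a (n + 3) * contNum a (n + 1 + 1) + contNum a (n + 1) =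
      a 0 * (a (n + 3) * contNum _ (n + 1) + contNum _ n) +
        (a (n + 3) * contDen _ (n + 1) + contDen _ n)
    rw [ih1, ih2]
    ring

theorem contNum_mul_contDen_sub (a : ℕ → ℤ) (n : ℕ) :
    contNum a (n + 1) * contDen a n - contNum a n * contDen a (n + 1) = (-1) ^ n := by
  induction n with
  | zero => simp [contNum, contDen]; ring
  | succ n ih => rw [contNum, contDen, pow_succ, ← ih]; ring

theorem contDen_pos {a : ℕ → ℤ} (ha : ∀ n, 1 ≤ a (n + 1)) (n : ℕ) : 1 ≤ contDen a n := by
  induction n using Nat.twoStepInduction with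
  | zero => exact le_rfl
  | one => exact ha 0
  | more n ih1 ih2 => rw [contDen]; nlinarith [ha (n + 1)]

/-- The fractions of continuants are in lowest terms, so that they have the numerators and
denominators of the convergents. -/
theorem isCoprime_contNum_contDen (a : ℕ → ℤ) (n : ℕ) :
    IsCoprime (contNum a n) (contDen a n) := by
  have h := contNum_mul_contDen_sub a n
  refine ⟨-(-1) ^ n * contDen a (n + 1), (-1) ^ n * contNum a (n + 1), ?_⟩
  have h2 : ((-1 : ℤ) ^ n) * (-1) ^ n = 1 := by rw [← mul_pow]; simp
  linear_combination (-1) ^ n * h + h2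

theorem convergent_eq_div {ξ : ℝ} (h : Irrational ξ) (n : ℕ) :
    ξ.convergent n =
      (contNum (partialQuotient ξ) n : ℚ) / (contDen (partialQuotient ξ) n : ℚ) := by
  induction n generalizing ξ with
  | zero => simp [contNum, contDen, partialQuotient_eq_floor h, completeQuot]
  | succ n ih =>
    have h1 : Irrational (Int.fract ξ)⁻¹ := (irrational_fract h).inv
    have hs : (fun k => partialQuotient ξ (k + 1)) = partialQuotient (Int.fract ξ)⁻¹ := by
      funext k
      rw [partialQuotient_eq_floor h, partialQuotient_eq_floor h1, add_comm, completeQuot_add]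
      rfl
    have hp := contDen_pos (one_le_partialQuotient h) (n + 1)
    have hf : partialQuotient ξ 0 = ⌊ξ⌋ := partialQuotient_eq_floor h 0
    rw [contDen_succ_eq] at hp
    rw [Real.convergent_succ, ih h1, contNum_succ_eq, contDen_succ_eq, hs, hf, inv_div]
    rw [hs] at hp
    have hp' : (contNum (partialQuotient (Int.fract ξ)⁻¹) n : ℚ) ≠ 0 := by
      exact_mod_cast (by omega : contNum (partialQuotient (Int.fract ξ)⁻¹) n ≠ 0)
    push_cast
    rw [add_div, mul_div_cancel_right₀ _ hp']

theorem convNum_eq {ξ : ℝ} (h : Irrational ξ) (n : ℕ) :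
    convNum ξ n = contNum (partialQuotient ξ) n := by
  have hp := contDen_pos (one_le_partialQuotient h) n
  rw [convNum, convergent_eq_div h]
  exact Rat.num_div_eq_of_coprime (by omega)
    (Int.isCoprime_iff_nat_coprime.1 (isCoprime_contNum_contDen _ n))

theorem convDen_eq {ξ : ℝ} (h : Irrational ξ) (n : ℕ) :
    (convDen ξ n : ℤ) = contDen (partialQuotient ξ) n := by
  have hp := contDen_pos (one_le_partialQuotient h) n
  rw [convDen, convergent_eq_div h]
  exact Rat.den_div_eq_of_coprime (by omega)
    (Int.isCoprime_iff_nat_coprime.1 (isCoprime_contNum_contDen _ n))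

section Convergents

variable {ξ : ℝ}

theorem convDen_zero (h : Irrational ξ) : convDen ξ 0 = 1 := by
  have := convDen_eq h 0
  rw [contDen] at this
  exact_mod_cast this

theorem convDen_pos (ξ : ℝ) (n : ℕ) : 0 < convDen ξ n := Rat.den_pos _

theorem convDen_rec (h : Irrational ξ) (n : ℕ) :
    (convDen ξ (n + 2) : ℤ) = partialQuotient ξ (n + 2) * convDen ξ (n + 1) + convDen ξ n := by
  rw [convDen_eq h, convDen_eq h, convDen_eq h, contDen]

theorem convNum_rec (h : Irrational ξ) (n : ℕ) :
    convNum ξ (n + 2) = partialQuotient ξ (n + 2) * convNum ξ (n + 1) + convNum ξ n := by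
  rw [convNum_eq h, convNum_eq h, convNum_eq h, contNum]

theorem convNum_mul_convDen_sub (h : Irrational ξ) (n : ℕ) :
    convNum ξ (n + 1) * convDen ξ n - convNum ξ n * convDen ξ (n + 1) = (-1) ^ n := by
  rw [convDen_eq h, convDen_eq h, convNum_eq h, convNum_eq h, contNum_mul_contDen_sub]

theorem convDen_le_succ (h : Irrational ξ) (n : ℕ) : convDen ξ n ≤ convDen ξ (n + 1) := by
  cases n with
  | zero => rw [convDen_zero h]; exact convDen_pos ξ _
  | succ n =>
    have h1 := convDen_rec h n
    have h2 := one_le_partialQuotient h (n + 1)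
    have h3 := convDen_pos ξ (n + 1)
    zify
    rw [h1]
    nlinarith

theorem le_convDen (h : Irrational ξ) (n : ℕ) : n ≤ convDen ξ n := by
  induction n using Nat.twoStepInduction with
  | zero => exact Nat.zero_le _
  | one => exact convDen_pos ξ 1
  | more n ih1 ih2 =>
    have h1 := convDen_rec h n
    have h2 := one_le_partialQuotient h (n + 1)
    have h3 := convDen_pos ξ n
    zify at *
    rw [h1]
    nlinarith

theorem tendsto_convDen (h : Irrational ξ) : Tendsto (fun k => convDen ξ k) atTop atTop :=
  tendsto_atTop_mono (le_convDen h) tendsto_id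

theorem convErr_rec (h : Irrational ξ) (n : ℕ) :
    convErr ξ (n + 2) = convErr ξ n - partialQuotient ξ (n + 2) * convErr ξ (n + 1) := by
  have hq : (convDen ξ (n + 2) : ℝ) =
      partialQuotient ξ (n + 2) * convDen ξ (n + 1) + convDen ξ n := by
    exact_mod_cast convDen_rec h n
  have hp : (convNum ξ (n + 2) : ℝ) =
      partialQuotient ξ (n + 2) * convNum ξ (n + 1) + convNum ξ n := by
    exact_mod_cast convNum_rec h n
  rw [convErr, convErr, convErr, hq, hp]
  ring

/-- The error of a convergent is governed by the next complete quotient. -/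
theorem convErr_eq_mul (h : Irrational ξ) (n : ℕ) :
    convErr ξ n = convErr ξ (n + 1) * completeQuot ξ (n + 2) := by
  have hx : ∀ n, 0 < completeQuot ξ (n + 1) := fun n =>
    zero_lt_one.trans (one_lt_completeQuot_succ h n)
  induction n with
  | zero =>
    have h0 : convNum ξ 0 = partialQuotient ξ 0 := convNum_eq h 0
    have h1 : convNum ξ 1 = partialQuotient ξ 1 * partialQuotient ξ 0 + 1 := convNum_eq h 1
    have h2 : (convDen ξ 1 : ℤ) = partialQuotient ξ 1 := convDen_eq h 1
    have h2' : (convDen ξ 1 : ℝ) = partialQuotient ξ 1 := by exact_mod_cast h2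
    have e0 := completeQuot_eq_add_inv h 0
    have e1 := completeQuot_eq_add_inv h 1
    have x1 := hx 0
    have x2 := hx 1
    rw [convErr, convErr, h0, h1, h2', convDen_zero h]
    simp only [completeQuot] at e0
    simp only [zero_add, pow_zero, pow_one, Nat.cast_one, one_mul]
    push_cast
    have e0' : (ξ - partialQuotient ξ 0) * completeQuot ξ 1 = 1 := by
      have : ξ - partialQuotient ξ 0 = (completeQuot ξ 1)⁻¹ := by
        simp only [completeQuot]; linarith
      rw [this]; exact inv_mul_cancel₀ x1.ne'
    have e1' : (completeQuot ξ 1 - partialQuotient ξ 1) * completeQuot ξ 2 = 1 := by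
      have : completeQuot ξ 1 - partialQuotient ξ 1 = (completeQuot ξ 2)⁻¹ := by linarith
      rw [this]; exact inv_mul_cancel₀ x2.ne'
    linear_combination (-(ξ - partialQuotient ξ 0)) * e1' + completeQuot ξ 2 * e0'
  | succ n ih =>
    have e1 := completeQuot_eq_add_inv h (n + 2)
    have x2 := hx (n + 2)
    have x1 := hx (n + 1)
    have e1' : (completeQuot ξ (n + 2) - partialQuotient ξ (n + 2)) * completeQuot ξ (n + 3) = 1 := by
      have : completeQuot ξ (n + 2) - partialQuotient ξ (n + 2) = (completeQuot ξ (n + 3))⁻¹ := by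
        linarith
      rw [this]; exact inv_mul_cancel₀ x2.ne'
    rw [convErr_rec h n, ih]
    linear_combination (-convErr ξ (n + 1)) * e1'

theorem convErr_pos (h : Irrational ξ) (n : ℕ) : 0 < convErr ξ n := by
  induction n with
  | zero =>
    have h0 : convNum ξ 0 = ⌊ξ⌋ := (convNum_eq h 0).trans (partialQuotient_eq_floor h 0)
    have := fract_completeQuot_pos h 0
    rw [completeQuot, Int.fract] at this
    rw [convErr, h0, convDen_zero h]
    simpa using this
  | succ n ih =>
    rw [convErr_eq_mul h] at ih
    exact pos_of_mul_pos_left ih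
      (zero_lt_one.trans (one_lt_completeQuot_succ h (n + 1))).le

theorem convErr_succ_lt (h : Irrational ξ) (n : ℕ) : convErr ξ (n + 1) < convErr ξ n := by
  rw [convErr_eq_mul h n]
  nlinarith [convErr_pos h (n + 1), one_lt_completeQuot_succ h (n + 1)]

/-- The determinant identity in terms of the errors: `q_{n+1} δ_n + q_n δ_{n+1} = 1`. -/
theorem convDen_mul_convErr_add (h : Irrational ξ) (n : ℕ) :
    convDen ξ (n + 1) * convErr ξ n + convDen ξ n * convErr ξ (n + 1) = 1 := by
  have := congrArg (Int.cast : ℤ → ℝ) (convNum_mul_convDen_sub h n)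
  push_cast at this
  have h2 : ((-1 : ℝ) ^ n) * (-1) ^ n = 1 := by rw [← mul_pow]; simp
  rw [convErr, convErr, pow_succ]
  linear_combination (-1) ^ n * this + h2

theorem convDen_mul_convErr_lt (h : Irrational ξ) (n : ℕ) : convDen ξ n * convErr ξ n < 1 := by
  have h1 := convDen_mul_convErr_add h n
  have h2 : (convDen ξ n : ℝ) ≤ convDen ξ (n + 1) := by exact_mod_cast convDen_le_succ h n
  have h3 : (0 : ℝ) < convDen ξ n := by exact_mod_cast convDen_pos ξ n
  have h4 := convErr_pos h n
  have h5 := convErr_pos h (n + 1)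
  nlinarith

theorem abs_convDen_mul_sub (ξ : ℝ) (n : ℕ) (h : Irrational ξ) :
    |convDen ξ n * ξ - convNum ξ n| = convErr ξ n := by
  have h1 := convErr_pos h n
  rw [← abs_of_pos h1, convErr, abs_mul, abs_pow, abs_neg, abs_one, one_pow, one_mul]

/-- A real number is determined by its partial quotients. -/
theorem eq_of_partialQuotient_eq {ξ ζ : ℝ} (h : Irrational ξ) (h' : Irrational ζ)
    (e : ∀ n, partialQuotient ξ n = partialQuotient ζ n) : ξ = ζ := by
  have e' : partialQuotient ξ = partialQuotient ζ := funext e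
  by_contra hne
  have hpos : 0 < |ξ - ζ| := abs_pos.2 (sub_ne_zero.2 hne)
  obtain ⟨N, hN⟩ := exists_nat_gt (2 / |ξ - ζ|)
  have hq : (convDen ξ N : ℝ) = convDen ζ N := by
    have := (convDen_eq h N).trans (e' ▸ (convDen_eq h' N).symm)
    exact_mod_cast this
  have hp : (convNum ξ N : ℝ) = convNum ζ N := by
    have := (convNum_eq h N).trans (e' ▸ (convNum_eq h' N).symm)
    exact_mod_cast this
  have hqN : (N : ℝ) ≤ convDen ξ N := by exact_mod_cast le_convDen h N
  have hb : ∀ {x : ℝ}, Irrational x → convErr x N < 1 := fun {x} hx => by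
    have h1 := convDen_mul_convErr_lt hx N
    have h2 : (1 : ℝ) ≤ convDen x N := by exact_mod_cast convDen_pos x N
    nlinarith [convErr_pos hx N]
  have h1 := abs_convDen_mul_sub ξ N h
  have h2 := abs_convDen_mul_sub ζ N h'
  have h3 : convDen ξ N * |ξ - ζ| < 2 := by
    rw [← abs_of_pos (show (0 : ℝ) < convDen ξ N by exact_mod_cast convDen_pos ξ N), ← abs_mul]
    calc |convDen ξ N * (ξ - ζ)|
        = |(convDen ξ N * ξ - convNum ξ N) - (convDen ζ N * ζ - convNum ζ N)| := by
          rw [← hq, ← hp]; congr 1; ring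
      _ ≤ _ := abs_sub _ _
      _ < 2 := by rw [h1, h2]; linarith [hb h, hb h']
  rw [div_lt_iff₀ hpos] at hN
  nlinarith

end Convergents

/-! ### Lagrange's theorem and the constants of the period -/

theorem partialQuotient_completeQuot {ξ : ℝ} (h : Irrational ξ) (m n : ℕ) :
    partialQuotient (completeQuot ξ m) n = partialQuotient ξ (m + n) := by
  rw [partialQuotient_eq_floor h, partialQuotient_eq_floor (irrational_completeQuot h m),
    completeQuot_add]

theorem signed_err_eq {ξ : ℝ} (n : ℕ) :
    convDen ξ n * ξ - convNum ξ n = (-1) ^ n * convErr ξ n := by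
  have h2 : ((-1 : ℝ) ^ n) * (-1) ^ n = 1 := by rw [← mul_pow]; simp
  rw [convErr]
  linear_combination (-(convDen ξ n * ξ - convNum ξ n)) * h2

theorem finite_setOf_quadratic_root {A : ℝ} (B C : ℝ) (hA : A ≠ 0) :
    {x : ℝ | A * x ^ 2 + B * x + C = 0}.Finite := by
  have hp : (Polynomial.C A * Polynomial.X ^ 2 + Polynomial.C B * Polynomial.X +
      Polynomial.C C) ≠ 0 := by
    intro h0
    have := congrArg (fun f => Polynomial.coeff f 2) h0
    simp at this
    exact hA this
  refine (Polynomial.finite_setOfPred_isRoot hp).subset fun x hx => ?_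
  simpa [Polynomial.IsRoot] using hx

/-- **Lagrange's theorem**: the complete quotients are roots of integral quadratic polynomials with
bounded coefficients, so two of them coincide. -/
theorem exists_hasPeriod {α : ℝ} (hα : IsQuadraticIrrational α) : ∃ s p : ℕ, HasPeriod α s p := by
  obtain ⟨h, a, b, c, ha, hroot⟩ := hα
  obtain ⟨M, hM⟩ := exists_nat_ge (2 * |2 * (a : ℝ) * α + b| + 2 * |(a : ℝ)|)
  let T : Set (ℤ × ℤ × ℤ) := (Set.Icc (-(M : ℤ)) M) ×ˢ (Set.Icc (-(M : ℤ)) M) ×ˢ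
    (Set.Icc (-(M : ℤ)) M)
  have hT : T.Finite := (Set.finite_Icc _ _).prod ((Set.finite_Icc _ _).prod (Set.finite_Icc _ _))
  let S : Set ℝ := ⋃ t ∈ {t ∈ T | t.1 ≠ 0}, {x : ℝ | (t.1 : ℝ) * x ^ 2 + t.2.1 * x + t.2.2 = 0}
  have hS : S.Finite := (hT.sep _).biUnion fun t ht =>
    finite_setOf_quadratic_root _ _ (by exact_mod_cast ht.2)
  have hmem : ∀ k, completeQuot α (k + 2) ∈ S := by
    intro k
    set x := completeQuot α (k + 2)
    set P := convNum α (k + 1)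
    set P' := convNum α k
    set Q := (convDen α (k + 1) : ℤ) with hQ
    set Q' := (convDen α k : ℤ) with hQ'
    set e := (Q : ℝ) * α - P with he
    set e' := (Q' : ℝ) * α - P' with he'
    have hcQ : (Q : ℝ) = convDen α (k + 1) := by simp [hQ]
    have hcQ' : (Q' : ℝ) = convDen α k := by simp [hQ']
    have e1 : |e| = convErr α (k + 1) := by
      rw [he, hcQ]; exact abs_convDen_mul_sub α (k + 1) h
    have e2 : |e'| = convErr α k := by
      rw [he', hcQ']; exact abs_convDen_mul_sub α k h
    have hex : e' = - (x * e) := by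
      rw [he, he', hcQ, hcQ', signed_err_eq, signed_err_eq, convErr_eq_mul h k, pow_succ]
      ring
    have hQ1 : (1 : ℝ) ≤ Q := by rw [hcQ]; exact_mod_cast convDen_pos α (k + 1)
    have hQ1' : (1 : ℝ) ≤ Q' := by rw [hcQ']; exact_mod_cast convDen_pos α k
    have hQQ : (Q' : ℝ) ≤ Q := by rw [hcQ, hcQ']; exact_mod_cast convDen_le_succ h k
    have hsum : Q * |e'| + Q' * |e| = 1 := by
      rw [e1, e2, hcQ, hcQ']; exact convDen_mul_convErr_add h k
    have hQe : Q * |e| ≤ 1 := by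
      rw [e1, hcQ]; exact (convDen_mul_convErr_lt h (k + 1)).le
    have hQe' : Q' * |e'| ≤ 1 := by
      rw [e2, hcQ']; exact (convDen_mul_convErr_lt h k).le
    have n1 := abs_nonneg e
    have n2 := abs_nonneg e'
    have hE : |e| ≤ 1 := by nlinarith
    have hE' : |e'| ≤ 1 := by nlinarith
    have hP : (P : ℝ) = Q * α - e := by rw [he]; ring
    have hP' : (P' : ℝ) = Q' * α - e' := by rw [he']; ring
    -- as `α` is a root, substituting `P = Q α - e` in the quadratic form removes the terms of
    -- degree two in `Q`, and what remains is bounded because `Q * e` is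
    have key : ∀ u v w : ℝ, |u| ≤ 2 → |v| ≤ 2 → w = -(2 * a * α + b) * u + a * v → |w| ≤ M := by
      intro u v w hu hv hw
      rw [hw]
      refine (abs_add_le _ _).trans (le_trans ?_ hM)
      rw [abs_mul, abs_mul, abs_neg]
      nlinarith [abs_nonneg (2 * (a : ℝ) * α + b), abs_nonneg (a : ℝ)]
    have hA : |((a * P ^ 2 + b * P * Q + c * Q ^ 2 : ℤ) : ℝ)| ≤ M := by
      refine key (Q * e) (e ^ 2) _ ?_ ?_ ?_
      · rw [abs_mul, abs_of_pos (by linarith : (0 : ℝ) < Q)]; linarith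
      · rw [abs_pow]; nlinarith
      · push_cast; rw [hP]; linear_combination (Q : ℝ) ^ 2 * hroot
    have hC : |((a * P' ^ 2 + b * P' * Q' + c * Q' ^ 2 : ℤ) : ℝ)| ≤ M := by
      refine key (Q' * e') (e' ^ 2) _ ?_ ?_ ?_
      · rw [abs_mul, abs_of_pos (by linarith : (0 : ℝ) < Q')]; linarith
      · rw [abs_pow]; nlinarith
      · push_cast; rw [hP']; linear_combination (Q' : ℝ) ^ 2 * hroot
    have hB : |((2 * a * P * P' + b * (P * Q' + P' * Q) + 2 * c * Q * Q' : ℤ) : ℝ)| ≤ M := by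
      refine key (Q * e' + Q' * e) (2 * e * e') _ ?_ ?_ ?_
      · refine (abs_add_le _ _).trans ?_
        rw [abs_mul, abs_mul, abs_of_pos (by linarith : (0 : ℝ) < Q),
          abs_of_pos (by linarith : (0 : ℝ) < Q')]
        linarith
      · rw [abs_mul, abs_mul, abs_two]; nlinarith
      · push_cast; rw [hP, hP']; linear_combination 2 * (Q : ℝ) * Q' * hroot
    have hA0 : a * P ^ 2 + b * P * Q + c * Q ^ 2 ≠ 0 := by
      intro h0
      have h0' : (a : ℝ) * P ^ 2 + b * P * Q + c * Q ^ 2 = 0 := by exact_mod_cast h0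
      have hne : e ≠ 0 := by
        intro h00
        have := convErr_pos h (k + 1)
        rw [← e1, h00, abs_zero] at this
        exact lt_irrefl _ this
      have h1 : e * (a * (Q * α + P) + b * Q) = 0 := by
        rw [he]; linear_combination (Q : ℝ) ^ 2 * hroot - h0'
      have h2 : (a * (Q * α + P) + b * Q) = 0 := (mul_eq_zero.1 h1).resolve_left hne
      refine h.ne_rat (-(a * P + b * Q) / (a * Q)) ?_
      have ha' : (a : ℝ) ≠ 0 := by exact_mod_cast ha
      have hQ0 : (Q : ℝ) ≠ 0 := by linarith
      push_cast
      field_simp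
      linear_combination h2
    have hIcc : ∀ z : ℤ, |(z : ℝ)| ≤ M → z ∈ Set.Icc (-(M : ℤ)) M := by
      intro z hz
      have : |z| ≤ (M : ℤ) := by exact_mod_cast hz
      exact abs_le.1 this
    refine Set.mem_biUnion (x := (a * P ^ 2 + b * P * Q + c * Q ^ 2,
      2 * a * P * P' + b * (P * Q' + P' * Q) + 2 * c * Q * Q',
      a * P' ^ 2 + b * P' * Q' + c * Q' ^ 2)) ⟨⟨hIcc _ hA, hIcc _ hB, hIcc _ hC⟩, hA0⟩ ?_
    have hx : (P : ℝ) * x + P' = (Q * x + Q') * α := by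
      rw [hP, hP', hex]; ring
    simp only [Set.mem_ofPred_eq]
    push_cast
    linear_combination (Q * x + Q') ^ 2 * hroot +
      (a * (P * x + P' + (Q * x + Q') * α) + b * (Q * x + Q')) * hx
  obtain ⟨i, j, hij, he⟩ := hS.exists_lt_map_eq_of_forall_mem hmem
  refine ⟨i + 2, j - i, by omega, fun k hk => ?_⟩
  obtain ⟨n, rfl⟩ := Nat.exists_eq_add_of_lt hk
  rw [show i + 2 + n + 1 + (j - i) = (j + 2) + (n + 1) by omega, add_assoc (i + 2),
    ← partialQuotient_completeQuot h, ← partialQuotient_completeQuot h, he]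

theorem HasPeriod.completeQuot_add {α : ℝ} {s p : ℕ} (h : Irrational α) (hp : HasPeriod α s p)
    {k : ℕ} (hk : s < k) : completeQuot α (k + p) = completeQuot α k := by
  refine eq_of_partialQuotient_eq (irrational_completeQuot h _) (irrational_completeQuot h _)
    fun n => ?_
  rw [partialQuotient_completeQuot h, partialQuotient_completeQuot h, ← hp.2 (k + n) (by omega)]
  congr 1
  omega

/-- The dominant part of `q_k` with respect to the shift by a period: the component of the solution
`q_k` of the recurrence along the eigenvector of eigenvalue `η`; the other component is a multiple
`c` of `q_k α - p_k`. The definition makes sense for any `c`; the right one is provided by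
`exists_period_constants`. -/
noncomputable def dominantPart (α c : ℝ) (k : ℕ) : ℝ :=
  convDen α k - c * ((-1) ^ k * convErr α k)

theorem dominantPart_rec {α : ℝ} (h : Irrational α) (c : ℝ) (k : ℕ) :
    dominantPart α c (k + 2) =
      partialQuotient α (k + 2) * dominantPart α c (k + 1) + dominantPart α c k := by
  have hq : (convDen α (k + 2) : ℝ) =
      partialQuotient α (k + 2) * convDen α (k + 1) + convDen α k := by
    exact_mod_cast convDen_rec h k
  rw [dominantPart, dominantPart, dominantPart, hq, convErr_rec h]
  ring

/-- The errors are divided by a constant `η` over a period, since the ratio of consecutive errors is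
a complete quotient. The defect `q_{k+p} - η q_k` is then a constant multiple of `q_k α - p_k`, and
subtracting a multiple of `q_k α - p_k` from `q_k` removes it. -/
theorem exists_period_constants {α : ℝ} {s p : ℕ} (h : Irrational α) (hp : HasPeriod α s p) :
    ∃ η c : ℝ, 1 < η ∧ (∀ k, s ≤ k → convErr α k = η * convErr α (k + p)) ∧
      ∀ k, s ≤ k → dominantPart α c (k + p) = η * dominantPart α c k := by
  have hpp := hp.1
  have hpos := convErr_pos h
  have hanti : StrictAnti (convErr α) := strictAnti_nat_of_succ_lt (convErr_succ_lt h)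
  set η := convErr α s / convErr α (s + p) with hη
  have hη1 : 1 < η := (one_lt_div (hpos _)).2 (hanti (by omega))
  have hE : ∀ k, s ≤ k → convErr α k = η * convErr α (k + p) := by
    intro k hk
    induction k, hk using Nat.le_induction with
    | base => rw [hη, div_mul_cancel₀ _ (hpos _).ne']
    | succ k hk ih =>
      rw [convErr_eq_mul h k, convErr_eq_mul h (k + p),
        show k + p + 2 = (k + 2) + p by omega, hp.completeQuot_add h (by omega : s < k + 2),
        ← mul_assoc] at ih
      rw [show k + 1 + p = k + p + 1 by omega]
      exact mul_right_cancel₀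
        (zero_lt_one.trans (one_lt_completeQuot_succ h (k + 1))).ne' ih
  let e : ℕ → ℝ := fun k => (-1) ^ k * convErr α k
  have he0 : ∀ k, e k ≠ 0 := fun k => mul_ne_zero (pow_ne_zero _ (by norm_num)) (hpos k).ne'
  -- constancy of the ratio of `q_{k+p} - η q_k` to `q_k α - p_k`, by comparison of Wronskians
  have hd : ∀ k, s ≤ k → ((convDen α (k + p) - η * convDen α k) / e k : ℝ) =
      (convDen α (s + p) - η * convDen α s) / e s := by
    intro k hk
    induction k, hk using Nat.le_induction with
    | base => rfl
    | succ k hk ih =>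
      rw [← ih, div_eq_div_iff (he0 _) (he0 _)]
      have w1 := convDen_mul_convErr_add h k
      have w2 := convDen_mul_convErr_add h (k + p)
      have E1 := hE k hk
      have E2 := hE (k + 1) (by omega)
      rw [show k + 1 + p = k + p + 1 by omega] at *
      simp only [e, pow_succ]
      linear_combination (-1) ^ k * convDen α (k + p + 1) * E1 +
        (-1) ^ k * convDen α (k + p) * E2 + (-1) ^ k * η * w2 - (-1) ^ k * η * w1
  set c₀ := (convDen α (s + p) - η * convDen α s) / e s with hc₀
  have hden : (-1 : ℝ) ^ p * η⁻¹ - η ≠ 0 := by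
    have h1 : η⁻¹ < 1 := inv_lt_one_of_one_lt₀ hη1
    have h0 : 0 < η⁻¹ := inv_pos.2 (by linarith)
    rcases neg_one_pow_eq_or ℝ p with h2 | h2 <;> rw [h2] <;> intro h3 <;> linarith
  refine ⟨η, c₀ / ((-1) ^ p * η⁻¹ - η), hη1, hE, fun k hk => ?_⟩
  have h1 := hd k hk
  rw [div_eq_iff (he0 k)] at h1
  have h2 : c₀ / ((-1 : ℝ) ^ p * η⁻¹ - η) * ((-1) ^ p * η⁻¹ - η) = c₀ := div_mul_cancel₀ _ hden
  have h3 : convErr α (k + p) = η⁻¹ * convErr α k := by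
    rw [hE k hk, inv_mul_cancel_left₀ (by linarith)]
  rw [dominantPart, dominantPart, h3, pow_add]
  simp only [e] at h1
  linear_combination h1 - ((-1) ^ k * convErr α k) * h2

/-! ### Ratios of consecutive denominators -/

/-- `β` is badly approximable, with constant `c`: `‖j β‖ ≥ c / j` for every `j ≥ 1`, where `‖·‖` is
the distance to the nearest integer. -/
def IsBadlyApproximable (c β : ℝ) : Prop :=
  0 < c ∧ ∀ (j : ℕ) (m : ℤ), 0 < j → c / j ≤ |j * β - m|

theorem IsBadlyApproximable.irrational {c β : ℝ} (h : IsBadlyApproximable c β) :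
    Irrational β := by
  rintro ⟨x, rfl⟩
  have h1 := h.2 x.den x.num x.den_pos
  have h0 : (0 : ℝ) < x.den := by exact_mod_cast x.den_pos
  have h2 : (x.den : ℝ) * (x : ℝ) - x.num = 0 := by
    have : (x.den : ℚ) * x = x.num := Rat.den_mul_eq_num x
    rw [sub_eq_zero]; exact_mod_cast this
  rw [h2, abs_zero] at h1
  exact absurd h1 (not_le.2 (div_pos h.1 h0))

/-- A real number with a sequence of fractions approximating it to order two, whose denominators
grow at most geometrically, is badly approximable: a good approximation `m / j` would be too close
to the first of these fractions whose denominator is large compared with `j`. -/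
theorem exists_isBadlyApproximable {β κ R : ℝ} {u v : ℕ → ℕ} (hκ : 0 ≤ κ)
    (hv : ∀ n, 0 < v n) (hcop : ∀ n, Nat.Coprime (u n) (v n)) (hlim : Tendsto v atTop atTop)
    (hR : ∀ n, (v (n + 1) : ℝ) ≤ R * v n) (happ : ∀ n, |(u n : ℝ) / v n - β| ≤ κ / (v n : ℝ) ^ 2) :
    ∃ c, IsBadlyApproximable c β := by
  have hv' : ∀ n, (1 : ℝ) ≤ v n := fun n => by exact_mod_cast hv n
  have hR0 : 0 ≤ R := by
    have := hR 0
    by_contra hneg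
    nlinarith [hv' 0, hv' 1]
  set K : ℝ := v 0 + R * (2 * κ + 1) with hK
  have hK0 : 0 < K := by have := hv' 0; positivity
  refine ⟨1 / (2 * K), by positivity, fun j m hj => ?_⟩
  have hj1 : (1 : ℝ) ≤ j := by exact_mod_cast hj
  have hex : ∃ n, (2 * κ + 1) * j < v n := by
    obtain ⟨N, hN⟩ := exists_nat_gt ((2 * κ + 1) * j)
    obtain ⟨n, hn⟩ := (hlim.eventually_ge_atTop N).exists
    exact ⟨n, hN.trans_le (by exact_mod_cast hn)⟩
  classical
  set n := Nat.find hex with hn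
  have hn1 : (2 * κ + 1) * j < v n := Nat.find_spec hex
  have hn2 : (v n : ℝ) ≤ K * j := by
    have hK1 : 0 ≤ R * (2 * κ + 1) := by positivity
    rcases Nat.eq_zero_or_pos n with h0 | h0
    · rw [h0]; nlinarith [hv' 0]
    · have h1 : ¬ (2 * κ + 1) * j < v (n - 1) := Nat.find_min hex (by omega)
      have h2 := hR (n - 1)
      rw [Nat.sub_add_cancel h0] at h2
      push Not at h1
      nlinarith [hv' 0]
  have hvn := hv' n
  have hne : (j : ℤ) * u n - m * v n ≠ 0 := by
    intro h0
    have h1 : (v n : ℤ) ∣ j * u n := ⟨m, by linarith⟩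
    have h2 : v n ∣ j := (hcop n).symm.dvd_of_dvd_mul_right (by exact_mod_cast h1)
    have h3 : (v n : ℝ) ≤ j := by exact_mod_cast Nat.le_of_dvd hj h2
    nlinarith
  have h1 : (1 : ℝ) ≤ |(j : ℝ) * u n - m * v n| := by
    exact_mod_cast Int.one_le_abs hne
  have h2 : 1 / (v n : ℝ) ≤ |j * ((u n : ℝ) / v n) - m| := by
    rw [show (j : ℝ) * ((u n : ℝ) / v n) - m = (j * u n - m * v n) / v n by field_simp, abs_div,
      abs_of_pos (by linarith : (0 : ℝ) < v n)]
    gcongr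
  have h3 : |j * ((u n : ℝ) / v n) - m| ≤ |j * β - m| + j * (κ / (v n : ℝ) ^ 2) := by
    have : j * ((u n : ℝ) / v n) - m = (j * β - m) + j * ((u n : ℝ) / v n - β) := by ring
    rw [this]
    refine (abs_add_le _ _).trans ?_
    rw [abs_mul (j : ℝ), Nat.abs_cast]
    gcongr
    exact happ n
  have h4 : j * (κ / (v n : ℝ) ^ 2) ≤ 1 / (2 * v n) := by
    rw [← mul_div_assoc, div_le_div_iff₀ (by positivity) (by positivity)]
    nlinarith
  have h5 : 1 / (2 * K) / j ≤ 1 / (2 * (v n : ℝ)) := by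
    rw [div_div]
    apply one_div_le_one_div_of_le <;> nlinarith
  have h6 : 1 / (v n : ℝ) = 1 / (2 * (v n : ℝ)) + 1 / (2 * (v n : ℝ)) := by field_simp; norm_num
  linarith

section Period

variable {α η c : ℝ} {s p : ℕ}

theorem convErr_lt_one (h : Irrational α) (k : ℕ) : convErr α k < 1 := by
  have h1 := convDen_mul_convErr_lt h k
  have h2 : (1 : ℝ) ≤ convDen α k := by exact_mod_cast convDen_pos α k
  nlinarith [convErr_pos h k]

theorem convErr_lt_inv (h : Irrational α) (k : ℕ) : convErr α k < 1 / convDen α k := by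
  have h2 : (0 : ℝ) < convDen α k := by exact_mod_cast convDen_pos α k
  rw [lt_div_iff₀ h2, mul_comm]
  exact convDen_mul_convErr_lt h k

theorem coprime_convDen (h : Irrational α) (k : ℕ) :
    Nat.Coprime (convDen α k) (convDen α (k + 1)) := by
  rw [← Nat.isCoprime_iff_coprime]
  have h1 := convNum_mul_convDen_sub h k
  have h2 : ((-1 : ℤ) ^ k) * (-1) ^ k = 1 := by rw [← mul_pow]; simp
  refine ⟨(-1) ^ k * convNum α (k + 1), -(-1) ^ k * convNum α k, ?_⟩
  linear_combination (-1) ^ k * h1 + h2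

theorem abs_convDen_sub_dominantPart_le (h : Irrational α) (c : ℝ) (k : ℕ) :
    |convDen α k - dominantPart α c k| ≤ |c| * convErr α k := by
  rw [dominantPart, sub_sub_cancel, abs_mul, abs_mul, abs_pow, abs_neg, abs_one, one_pow, one_mul,
    abs_of_pos (convErr_pos h k)]

theorem iterate_period {f : ℕ → ℝ} {η : ℝ} (hf : ∀ k, s ≤ k → f (k + p) = η * f k) (k m : ℕ)
    (hk : s ≤ k) : f (k + m * p) = η ^ m * f k := by
  induction m with
  | zero => simp
  | succ m ih =>
    rw [show k + (m + 1) * p = k + m * p + p by ring, hf _ (by omega), ih, pow_succ]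
    ring

/-- A non-positive dominant part would remain non-positive along the period, whereas it differs from
`q_k`, which tends to infinity, by a bounded amount. -/
theorem dominantPart_pos (h : Irrational α) (hp : 0 < p) (hη : 1 < η)
    (hdom : ∀ k, s ≤ k → dominantPart α c (k + p) = η * dominantPart α c k)
    {k : ℕ} (hk : s ≤ k) : 0 < dominantPart α c k := by
  by_contra hneg
  push Not at hneg
  obtain ⟨m, hm⟩ := exists_nat_gt |c|
  have h1 := iterate_period hdom k m hk
  have h2 : η ^ m * dominantPart α c k ≤ 0 :=
    mul_nonpos_of_nonneg_of_nonpos (by positivity) hneg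
  have h3 := (abs_le.1 (abs_convDen_sub_dominantPart_le h c (k + m * p))).2
  have h4 : (m : ℝ) ≤ convDen α (k + m * p) := by
    have := le_convDen h (k + m * p)
    exact_mod_cast (show m ≤ convDen α (k + m * p) by nlinarith)
  nlinarith [convErr_lt_one h (k + m * p), abs_nonneg c]

/-- The ratio of consecutive dominant parts, which is the limit of `q_k / q_{k+1}` along a residue
class. -/
noncomputable def dominantRatio (α c : ℝ) (k : ℕ) : ℝ :=
  dominantPart α c k / dominantPart α c (k + 1)

theorem exists_dominantPart_ge (h : Irrational α) (hp : 0 < p) (hη : 1 < η)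
    (hdom : ∀ k, s ≤ k → dominantPart α c (k + p) = η * dominantPart α c k)
    {k : ℕ} (hk : s ≤ k) : ∃ κ, 0 < κ ∧ ∀ m,
      convDen α (k + m * p) ≤ κ * dominantPart α c (k + m * p) := by
  have hpos := dominantPart_pos h hp hη hdom hk
  refine ⟨1 + |c| / dominantPart α c k, by positivity, fun m => ?_⟩
  have h1 := iterate_period hdom k m hk
  have h3 := (abs_le.1 (abs_convDen_sub_dominantPart_le h c (k + m * p))).2
  have h4 : |c| * convErr α (k + m * p) ≤ |c| :=
    mul_le_of_le_one_right (abs_nonneg c) (convErr_lt_one h _).le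
  have h5 : |c| ≤ |c| / dominantPart α c k * dominantPart α c (k + m * p) := by
    rw [h1, div_mul_eq_mul_div, le_div_iff₀ hpos]
    have : 1 ≤ η ^ m := one_le_pow₀ hη.le
    nlinarith [mul_nonneg (abs_nonneg c) hpos.le]
  linarith

/-- The convergence of `q_k / q_{k+1}` to the ratio of dominant parts is of order `q_{k+1}⁻²`,
since the determinant of the two pairs is bounded. -/
theorem exists_abs_div_sub_dominantRatio_le (h : Irrational α) (hp : 0 < p) (hη : 1 < η)
    (hdom : ∀ k, s ≤ k → dominantPart α c (k + p) = η * dominantPart α c k)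
    {k : ℕ} (hk : s ≤ k) : ∃ κ, 0 ≤ κ ∧ ∀ m,
      |(convDen α (k + m * p) : ℝ) / convDen α (k + 1 + m * p) - dominantRatio α c k| ≤
        κ / (convDen α (k + 1 + m * p) : ℝ) ^ 2 := by
  obtain ⟨κ, hκ, hle⟩ := exists_dominantPart_ge h hp hη hdom (show s ≤ k + 1 by omega)
  refine ⟨|c| * κ, by positivity, fun m => ?_⟩
  have hr : dominantRatio α c k = dominantPart α c (k + m * p) /
      dominantPart α c (k + 1 + m * p) := by
    rw [iterate_period hdom k m hk, iterate_period hdom (k + 1) m (by omega), dominantRatio,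
      mul_div_mul_left _ _ (by positivity)]
  have hD := dominantPart_pos h hp hη hdom (show s ≤ k + 1 + m * p by omega)
  have hq : (0 : ℝ) < convDen α (k + 1 + m * p) := by exact_mod_cast convDen_pos α _
  have hw := convDen_mul_convErr_add h (k + m * p)
  have hleq := hle m
  rw [show k + m * p + 1 = k + 1 + m * p by omega] at hw
  rw [hr, div_sub_div _ _ hq.ne' hD.ne', abs_div, abs_of_pos (mul_pos hq hD)]
  have hnum : convDen α (k + m * p) * dominantPart α c (k + 1 + m * p) -
      convDen α (k + 1 + m * p) * dominantPart α c (k + m * p) = c * (-1) ^ (k + m * p) := by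
    rw [dominantPart, dominantPart, show k + 1 + m * p = k + m * p + 1 by omega, pow_succ]
    rw [show k + 1 + m * p = k + m * p + 1 by omega] at hw
    linear_combination c * (-1) ^ (k + m * p) * hw
  rw [hnum, abs_mul, abs_pow, abs_neg, abs_one, one_pow, mul_one,
    div_le_div_iff₀ (mul_pos hq hD) (by positivity)]
  have := mul_le_mul_of_nonneg_left hleq (mul_nonneg (abs_nonneg c) hq.le)
  linarith

theorem dominantRatio_pos (h : Irrational α) (hp : 0 < p) (hη : 1 < η)
    (hdom : ∀ k, s ≤ k → dominantPart α c (k + p) = η * dominantPart α c k)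
    {k : ℕ} (hk : s ≤ k) : 0 < dominantRatio α c k :=
  div_pos (dominantPart_pos h hp hη hdom hk) (dominantPart_pos h hp hη hdom (by omega))

theorem dominantRatio_add (hη : 1 < η)
    (hdom : ∀ k, s ≤ k → dominantPart α c (k + p) = η * dominantPart α c k)
    {k : ℕ} (hk : s ≤ k) (m : ℕ) : dominantRatio α c (k + m * p) = dominantRatio α c k := by
  rw [dominantRatio, show k + m * p + 1 = k + 1 + m * p by omega, iterate_period hdom k m hk,
    iterate_period hdom (k + 1) m (by omega), dominantRatio,
    mul_div_mul_left _ _ (by positivity)]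

theorem exists_isBadlyApproximable_dominantRatio (h : Irrational α) (hp : 0 < p) (hη : 1 < η)
    (hdom : ∀ k, s ≤ k → dominantPart α c (k + p) = η * dominantPart α c k)
    {k : ℕ} (hk : s ≤ k) : ∃ c', IsBadlyApproximable c' (dominantRatio α c k) := by
  obtain ⟨κ, hκ, happ⟩ := exists_abs_div_sub_dominantRatio_le h hp hη hdom hk
  refine exists_isBadlyApproximable (u := fun m => convDen α (k + m * p))
    (v := fun m => convDen α (k + 1 + m * p)) (R := η + (η + 1) * |c|) hκ
    (fun n => convDen_pos α _) (fun n => ?_) ?_ (fun n => ?_) happ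
  · have := coprime_convDen h (k + n * p)
    rwa [show k + n * p + 1 = k + 1 + n * p by omega] at this
  · refine tendsto_atTop_mono (fun m => ?_) tendsto_id
    have := le_convDen h (k + 1 + m * p)
    simp only [id]
    nlinarith
  · rw [show k + 1 + (n + 1) * p = (k + 1 + n * p) + p by ring]
    set l := k + 1 + n * p
    have h1 := hdom l (by omega)
    have h2 := (abs_le.1 (abs_convDen_sub_dominantPart_le h c (l + p))).2
    have h3 := (abs_le.1 (abs_convDen_sub_dominantPart_le h c l)).1
    have h4 : ∀ i, |c| * convErr α i ≤ |c| := fun i =>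
      mul_le_of_le_one_right (abs_nonneg c) (convErr_lt_one h _).le
    have h5 : (1 : ℝ) ≤ convDen α l := by exact_mod_cast convDen_pos α l
    have h6 := h4 l
    have h7 := h4 (l + p)
    have h8 : η * dominantPart α c l ≤ η * (convDen α l + |c|) := by
      apply mul_le_mul_of_nonneg_left _ (by linarith); linarith
    nlinarith [mul_nonneg (abs_nonneg c) (by linarith : 0 ≤ η + 1)]

/-- The recurrence of the dominant parts reads off the partial quotients of `α` backwards. -/
theorem dominantRatio_inv (h : Irrational α) (hp : 0 < p) (hη : 1 < η)
    (hdom : ∀ k, s ≤ k → dominantPart α c (k + p) = η * dominantPart α c k)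
    {k : ℕ} (hk : s ≤ k) :
    (dominantRatio α c (k + 1))⁻¹ = partialQuotient α (k + 2) + dominantRatio α c k := by
  have h1 := dominantPart_pos h hp hη hdom (show s ≤ k + 1 by omega)
  rw [dominantRatio, dominantRatio, inv_div, dominantPart_rec h, add_div,
    mul_div_cancel_right₀ _ h1.ne']

theorem dominantRatio_lt_one (h : Irrational α) (hp : 0 < p) (hη : 1 < η)
    (hdom : ∀ k, s ≤ k → dominantPart α c (k + p) = η * dominantPart α c k)
    {k : ℕ} (hk : s ≤ k) : dominantRatio α c k < 1 := by
  rw [← dominantRatio_add hη hdom hk 1, show k + 1 * p = (k + p - 1) + 1 by omega]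
  have h1 := dominantRatio_inv h hp hη hdom (show s ≤ k + p - 1 by omega)
  have h2 := dominantRatio_pos h hp hη hdom (show s ≤ k + p - 1 by omega)
  have h3 : (1 : ℝ) ≤ partialQuotient α (k + p - 1 + 2) := by
    exact_mod_cast one_le_partialQuotient h (k + p - 1 + 1)
  rw [← inv_inv (dominantRatio α c (k + p - 1 + 1))]
  apply inv_lt_one_of_one_lt₀
  linarith

theorem completeQuot_dominantRatio (h : Irrational α) (hp : 0 < p) (hη : 1 < η)
    (hdom : ∀ k, s ≤ k → dominantPart α c (k + p) = η * dominantPart α c k)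
    (j : ℕ) {k : ℕ} (hk : s ≤ k) :
    completeQuot (dominantRatio α c (k + j)) (j + 1) = (dominantRatio α c k)⁻¹ := by
  have hfr : ∀ l, s ≤ l → Int.fract (dominantRatio α c l) = dominantRatio α c l := fun l hl =>
    Int.fract_eq_self.2 ⟨(dominantRatio_pos h hp hη hdom hl).le,
      dominantRatio_lt_one h hp hη hdom hl⟩
  induction j generalizing k with
  | zero => simp [completeQuot, hfr k hk]
  | succ j ih =>
    rw [completeQuot, show k + (j + 1) = (k + 1) + j by ring, ih (by omega),
      dominantRatio_inv h hp hη hdom hk, Int.fract_intCast_add, hfr k hk]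

theorem isReversedPeriod_dominantRatio (h : Irrational α) (hper : HasPeriod α s p) (hη : 1 < η)
    (hdom : ∀ k, s ≤ k → dominantPart α c (k + p) = η * dominantPart α c k)
    (r : ℕ) : IsReversedPeriod α s p (r + 1) (dominantRatio α c (s + r)) := by
  have hp := hper.1
  obtain ⟨c', hbad⟩ := exists_isBadlyApproximable_dominantRatio h hp hη hdom
    (show s ≤ s + r by omega)
  have hirr := hbad.irrational
  refine ⟨?_, fun j => ?_⟩
  · rw [partialQuotient_eq_floor hirr, completeQuot, Int.floor_eq_zero_iff]
    exact ⟨(dominantRatio_pos h hp hη hdom (by omega)).le,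
      dominantRatio_lt_one h hp hη hdom (by omega)⟩
  · rw [partialQuotient_eq_floor hirr, ← dominantRatio_add hη hdom (by omega) (j + 1)]
    have hjp : j ≤ j * p := Nat.le_mul_of_pos_right j hp
    obtain ⟨l, hl⟩ : ∃ l, s + r + (j + 1) * p = (l + 1) + j ∧ s ≤ l :=
      ⟨s + r + (j + 1) * p - j - 1, by
        have : (j + 1) * p = j * p + p := by ring
        omega, by
        have : (j + 1) * p = j * p + p := by ring
        omega⟩
    rw [hl.1, completeQuot_dominantRatio h hp hη hdom j (by omega),
      dominantRatio_inv h hp hη hdom hl.2, Int.floor_intCast_add,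
      Int.floor_eq_zero_iff.2 ⟨(dominantRatio_pos h hp hη hdom hl.2).le,
        dominantRatio_lt_one h hp hη hdom hl.2⟩, add_zero]
    have hmod : ∀ m k, s < k → partialQuotient α (k + m * p) = partialQuotient α k := by
      intro m k hk
      induction m with
      | zero => simp
      | succ m ih =>
        rw [show k + (m + 1) * p = k + m * p + p by ring, hper.2 _ (by omega), ih]
    have hlt := Nat.mod_lt j hp
    have hdm := Nat.mod_add_div j p
    have hdj : j / p ≤ j := Nat.div_le_self j p
    rw [← hmod (j - j / p) (s + (r + 1) + p - j % p) (by omega)]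
    congr 1
    have h1 : (j - j / p) * p + p * (j / p) = j * p := by
      rw [Nat.sub_mul, mul_comm p]
      exact Nat.sub_add_cancel (Nat.mul_le_mul_right p hdj)
    have : (j + 1) * p = j * p + p := by ring
    omega

end Period

/-! ### Sums of fractional parts -/

@[to_additive]
theorem prod_range_affine_of_periodic {M : Type*} [CommMonoid M] {q : ℕ} (hq : 0 < q) {u : ℤ}
    (hu : IsCoprime u q) (v : ℤ) {g : ℤ → M} (hg : Function.Periodic g q) :
    ∏ n ∈ Finset.range q, g (u * n + v) = ∏ n ∈ Finset.range q, g n := by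
  have hq' : (q : ℤ) ≠ 0 := by exact_mod_cast hq.ne'
  have hnn : ∀ x : ℤ, ((x % q).toNat : ℤ) = x % q := fun x =>
    Int.toNat_of_nonneg (Int.emod_nonneg _ hq')
  have hmaps : Set.MapsTo (fun n : ℕ => ((u * n + v) % q).toNat) (Finset.range q)
      (Finset.range q) := by
    intro n _
    have h1 := hnn (u * n + v)
    have h2 := Int.emod_lt_of_pos (u * n + v) (by omega : 0 < (q : ℤ))
    simp only [Finset.coe_range, Set.mem_Iio]
    omega
  have hinj : Set.InjOn (fun n : ℕ => ((u * n + v) % q).toNat) (Finset.range q) := by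
    intro m hm n hn hmn
    simp only [Finset.coe_range, Set.mem_Iio] at hm hn hmn
    have h1 : (u * m + v) % q = (u * n + v) % q :=
      (hnn _).symm.trans ((congrArg Nat.cast hmn).trans (hnn _))
    have h2 : (q : ℤ) ∣ u * (m - n) := by
      have h3 : (q : ℤ) ∣ (u * m + v) - (u * n + v) := Int.dvd_of_emod_eq_zero
        (Int.emod_eq_emod_iff_emod_sub_eq_zero.1 h1)
      convert h3 using 1
      ring
    have h3 : (q : ℤ) ∣ m - n := hu.symm.dvd_of_dvd_mul_left h2
    have h4 := Int.eq_zero_of_abs_lt_dvd h3 (by rw [abs_lt]; constructor <;> omega)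
    omega
  refine Finset.prod_nbij (fun n : ℕ => ((u * n + v) % q).toNat) hmaps hinj
    (Finset.surjOn_of_injOn_of_card_le _ hmaps hinj le_rfl) fun n _ => ?_
  rw [hnn, Int.emod_def, mul_comm (q : ℤ), ← smul_eq_mul (_ / _), hg.sub_zsmul_eq]

/-- A complete residue system is equidistributed with bounded error, uniformly in the shift. -/
theorem abs_sum_fract_rational_le {q : ℕ} (hq : 0 < q) {a : ℤ} (ha : IsCoprime a q) (t : ℝ) :
    |∑ n ∈ Finset.range q, (Int.fract (n * ((a : ℝ) / q) + t) - 1 / 2)| ≤ 1 / 2 := by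
  have hq' : (0 : ℝ) < q := by exact_mod_cast hq
  set τ := Int.fract (q * t) with hτ
  have hτ0 : 0 ≤ τ := Int.fract_nonneg _
  have hτ1 : τ < 1 := Int.fract_lt_one _
  let g : ℤ → ℝ := fun n => Int.fract ((n + τ) / q) - 1 / 2
  have hg : Function.Periodic g q := by
    intro n
    simp only [g]
    rw [show (((n + q : ℤ) : ℝ) + τ) / q = (n + τ) / q + 1 by push_cast; field_simp; ring,
      Int.fract_add_one]
  have h1 : ∀ n ∈ Finset.range q, Int.fract (n * ((a : ℝ) / q) + t) - 1 / 2 =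
      g (a * n + ⌊q * t⌋) := by
    intro n _
    simp only [g]
    congr 2
    have : (⌊q * t⌋ : ℝ) + τ = q * t := Int.floor_add_fract _
    push_cast
    field_simp
    linarith
  have h2 : ∀ n ∈ Finset.range q, g n = (n : ℝ) / q + (τ / q - 1 / 2) := by
    intro n hn
    have hn' : (n : ℝ) + 1 ≤ q := by exact_mod_cast Finset.mem_range.1 hn
    simp only [g, Int.cast_natCast]
    rw [Int.fract_eq_self.2 ⟨by positivity, by rw [div_lt_one hq']; linarith⟩]
    ring
  have h3 : ∑ n ∈ Finset.range q, (n : ℝ) = q * (q - 1) / 2 := by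
    rw [eq_div_iff two_ne_zero]
    have := Finset.sum_range_id_mul_two q
    have h4 : ((∑ n ∈ Finset.range q, n : ℕ) : ℝ) * 2 = q * ((q - 1 : ℕ) : ℝ) := by
      exact_mod_cast this
    rw [Nat.cast_sub hq] at h4
    push_cast at h4
    exact h4
  rw [Finset.sum_congr rfl h1, sum_range_affine_of_periodic hq ha _ hg, Finset.sum_congr rfl h2,
    Finset.sum_add_distrib, ← Finset.sum_div, h3, Finset.sum_const, Finset.card_range,
    nsmul_eq_mul]
  rw [show (q : ℝ) * (q - 1) / 2 / q + q * (τ / q - 1 / 2) = τ - 1 / 2 by field_simp; ring, abs_le]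
  constructor <;> linarith

/-- Replacing `a / q` by `γ` moves the points `n a / q + t`, `n < q`, by at most `κ / q`;
monotonicity of the floor function turns this into a bound for the sum. -/
theorem abs_sum_fract_le {q : ℕ} (hq : 0 < q) {a : ℤ} (ha : IsCoprime a q) {γ κ : ℝ}
    (hγ : |γ - (a : ℝ) / q| ≤ κ / (q : ℝ) ^ 2) (t : ℝ) :
    |∑ n ∈ Finset.range q, (Int.fract (n * γ + t) - 1 / 2)| ≤ 2 * κ + 1 / 2 := by
  have hq' : (0 : ℝ) < q := by exact_mod_cast hq
  have hpt : ∀ n ∈ Finset.range q, |n * γ - n * ((a : ℝ) / q)| ≤ κ / q := by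
    intro n hn
    have hn' : (n : ℝ) ≤ q := by exact_mod_cast (Finset.mem_range.1 hn).le
    rw [← mul_sub, abs_mul, Nat.abs_cast]
    calc (n : ℝ) * |γ - a / q| ≤ q * (κ / (q : ℝ) ^ 2) := by gcongr
      _ = κ / q := by field_simp
  have hconst : ∑ _n ∈ Finset.range q, (2 * (κ / q)) = 2 * κ := by
    rw [Finset.sum_const, Finset.card_range, nsmul_eq_mul]; field_simp
  have hup := abs_le.1 (abs_sum_fract_rational_le hq ha (t + κ / q))
  have hlo := abs_le.1 (abs_sum_fract_rational_le hq ha (t - κ / q))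
  rw [abs_le]
  constructor
  · have : ∑ n ∈ Finset.range q, (Int.fract (n * ((a : ℝ) / q) + (t + κ / q)) - 1 / 2) ≤
        ∑ n ∈ Finset.range q, ((Int.fract (n * γ + t) - 1 / 2) + 2 * (κ / q)) := by
      refine Finset.sum_le_sum fun n hn => ?_
      have h1 := abs_le.1 (hpt n hn)
      have h2 : (⌊n * γ + t⌋ : ℝ) ≤ ⌊n * ((a : ℝ) / q) + (t + κ / q)⌋ :=
        Int.cast_le.2 (Int.floor_le_floor (by linarith))
      rw [Int.fract, Int.fract]
      linarith
    rw [Finset.sum_add_distrib, hconst] at this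
    linarith
  · have : ∑ n ∈ Finset.range q, (Int.fract (n * γ + t) - 1 / 2) ≤
        ∑ n ∈ Finset.range q,
          ((Int.fract (n * ((a : ℝ) / q) + (t - κ / q)) - 1 / 2) + 2 * (κ / q)) := by
      refine Finset.sum_le_sum fun n hn => ?_
      have h1 := abs_le.1 (hpt n hn)
      have h2 : (⌊n * ((a : ℝ) / q) + (t - κ / q)⌋ : ℝ) ≤ ⌊n * γ + t⌋ :=
        Int.cast_le.2 (Int.floor_le_floor (by linarith))
      rw [Int.fract, Int.fract]
      linarith
    rw [Finset.sum_add_distrib, hconst] at this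
    linarith

theorem sum_fract_add (γ t : ℝ) (M N : ℕ) :
    ∑ n ∈ Finset.range (M + N), (Int.fract (n * γ + t) - 1 / 2) =
      ∑ n ∈ Finset.range M, (Int.fract (n * γ + t) - 1 / 2) +
      ∑ n ∈ Finset.range N, (Int.fract (n * γ + (M * γ + t)) - 1 / 2) := by
  rw [Finset.sum_range_add]
  congr 1
  refine Finset.sum_congr rfl fun n _ => ?_
  congr 2
  push_cast
  ring

/-- The sums `∑ ({nγ + t} - 1/2)` over `N ≤ Q` terms are `O(√N)` if `γ` is within `O(Q⁻²)` of a
badly approximable number. (They are in fact `O(log N)`.) By Dirichlet's theorem a bounded number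
of blocks of complete residue systems covers more than half of the range. -/
theorem abs_sum_fract_le_sqrt {c β κ : ℝ} (hβ : IsBadlyApproximable c β) (hκ : 0 ≤ κ) {γ : ℝ}
    {Q : ℕ} (hγ : |γ - β| ≤ κ / (Q : ℝ) ^ 2) {N : ℕ} (hN : N ≤ Q) (t : ℝ) :
    |∑ n ∈ Finset.range N, (Int.fract (n * γ + t) - 1 / 2)| ≤
      4 * (2 * κ + 3) / c * √(N : ℝ) := by
  have hc := hβ.1
  induction N using Nat.strong_induction_on generalizing t with
  | _ N ih =>
  rcases Nat.eq_zero_or_pos N with h0 | hNpos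
  · simp [h0]
  obtain ⟨r, hr1, hr2⟩ := Real.exists_rat_abs_sub_le_and_den_le β hNpos
  set q := r.den with hq
  have hqpos : 0 < q := r.den_pos
  have hq' : (1 : ℝ) ≤ q := by exact_mod_cast hqpos
  have hN1 : (1 : ℝ) ≤ N := by exact_mod_cast hNpos
  have hqN : (q : ℝ) ≤ N := by exact_mod_cast hr2
  have hNQ : (N : ℝ) ≤ Q := by exact_mod_cast hN
  have hr : (r : ℝ) = (r.num : ℝ) / q := by rw [hq]; exact Rat.cast_def r
  have hcop : IsCoprime r.num (q : ℤ) := Int.isCoprime_iff_nat_coprime.2 r.reduced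
  have hqlow : c * N ≤ q := by
    have h1 := hβ.2 q r.num hqpos
    have h2 : |q * β - r.num| = q * |β - r| := by
      rw [hr, ← abs_of_pos (by linarith : (0 : ℝ) < q), ← abs_mul,
        abs_of_pos (by linarith : (0 : ℝ) < q)]
      congr 1
      field_simp
    have h3 : (q : ℝ) * |β - r| ≤ 1 / (N + 1) := by
      refine (mul_le_mul_of_nonneg_left hr1 (by linarith)).trans (le_of_eq ?_)
      field_simp
    have h4 := h1.trans (h2.le.trans h3)
    rw [div_le_div_iff₀ (by linarith) (by linarith)] at h4
    nlinarith
  have happ : |γ - (r.num : ℝ) / q| ≤ (κ + 1) / (q : ℝ) ^ 2 := by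
    rw [← hr]
    have h1 : κ / (Q : ℝ) ^ 2 ≤ κ / (q : ℝ) ^ 2 := by
      apply div_le_div_of_nonneg_left hκ (by positivity)
      gcongr
      linarith
    have h2 : 1 / ((N + 1) * (q : ℝ)) ≤ 1 / (q : ℝ) ^ 2 := by
      apply one_div_le_one_div_of_le (by positivity)
      nlinarith
    calc |γ - r| = |(γ - β) + (β - r)| := by congr 1; ring
      _ ≤ _ := abs_add_le _ _
      _ ≤ κ / (q : ℝ) ^ 2 + 1 / (q : ℝ) ^ 2 := add_le_add (hγ.trans h1) (hr1.trans h2)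
      _ = _ := by ring
  have hblocks : ∀ (b : ℕ) (t : ℝ), |∑ n ∈ Finset.range (q * b), (Int.fract (n * γ + t) - 1 / 2)| ≤
      b * (2 * κ + 3) := by
    intro b
    induction b with
    | zero => simp
    | succ b ihb =>
      intro t
      rw [mul_add, mul_one, sum_fract_add]
      refine (abs_add_le _ _).trans ?_
      have h1 := ihb t
      have h2 := abs_sum_fract_le hqpos hcop happ ((q * b : ℕ) * γ + t)
      push_cast at *
      linarith
  have hdm := Nat.div_add_mod N q
  have hlt := Nat.mod_lt N hqpos
  have hb1 : 1 ≤ N / q := Nat.div_pos hr2 hqpos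
  have hmod2 : 2 * (N % q) ≤ N := by nlinarith
  have hb : ((N / q : ℕ) : ℝ) ≤ 1 / c := by
    rw [le_div_iff₀ hc]
    have h1 : (q : ℝ) * (N / q : ℕ) ≤ N := by exact_mod_cast (by omega : q * (N / q) ≤ N)
    have h3 : (0 : ℝ) ≤ (N / q : ℕ) := by positivity
    nlinarith
  have h1 := hblocks (N / q) t
  have h2 := ih (N % q) (by omega) (by omega) ((q * (N / q) : ℕ) * γ + t)
  have h3 : √((N % q : ℕ) : ℝ) ≤ 3 / 4 * √(N : ℝ) := by
    have h4 : ((N % q : ℕ) : ℝ) ≤ (3 / 4 * √(N : ℝ)) ^ 2 := by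
      rw [mul_pow, Real.sq_sqrt (by linarith)]
      have : 2 * ((N % q : ℕ) : ℝ) ≤ N := by exact_mod_cast hmod2
      linarith
    exact (Real.sqrt_le_sqrt h4).trans (Real.sqrt_sq (by positivity)).le
  have h5 : 1 ≤ √(N : ℝ) := by rw [Real.one_le_sqrt]; exact hN1
  have h6 : 0 < (2 * κ + 3) / c := by positivity
  rw [← hdm, sum_fract_add, hdm]
  refine (abs_add_le _ _).trans ?_
  calc _ ≤ ((N / q : ℕ) : ℝ) * (2 * κ + 3) + 4 * (2 * κ + 3) / c * √((N % q : ℕ) : ℝ) :=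
        add_le_add h1 h2
    _ ≤ 1 / c * (2 * κ + 3) + 4 * (2 * κ + 3) / c * (3 / 4 * √(N : ℝ)) := by gcongr
    _ = (2 * κ + 3) / c * (1 + 3 * √(N : ℝ)) := by ring
    _ ≤ (2 * κ + 3) / c * (4 * √(N : ℝ)) := by gcongr; linarith
    _ = _ := by ring

/-! ### Pairing the factors of a Sudler product -/

theorem prod_Ico_mul_of_periodic {q : ℕ} (hq : 0 < q) {u : ℤ}
    (hu : IsCoprime u q) {g : ℤ → ℝ} (hg : Function.Periodic g q) :
    ∏ n ∈ Finset.Ico 1 q, g (u * n) = ∏ n ∈ Finset.Ico 1 q, g n := by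
  let g' : ℤ → ℝ := fun n => if (q : ℤ) ∣ n then 1 else g n
  have hg' : Function.Periodic g' q := by
    intro n
    simp only [g', hg n, dvd_add_self_right]
  have hndvd : ∀ n ∈ Finset.Ico 1 q, ¬ (q : ℤ) ∣ n := by
    intro n hn hdvd
    rw [Finset.mem_Ico] at hn
    have := Int.le_of_dvd (by omega) hdvd
    omega
  have h0 : ∀ v : ℤ, ∏ n ∈ Finset.range q, g' (v * n) = ∏ n ∈ Finset.Ico 1 q, g' (v * n) := by
    intro v
    rw [Finset.range_eq_Ico, Finset.prod_eq_prod_Ico_succ_bot hq]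
    simp [g']
  have h1 := prod_range_affine_of_periodic hq hu 0 hg'
  have h2 := h0 u
  have h3 := h0 1
  simp only [add_zero, one_mul] at h1 h3
  rw [h2, h3] at h1
  rw [Finset.prod_congr rfl fun n hn => ?_, h1, Finset.prod_congr rfl fun n hn => ?_]
  · exact if_neg (hndvd n hn)
  · refine (if_neg fun hd => hndvd n hn (hu.symm.dvd_of_dvd_mul_left hd)).symm

theorem prod_Ico_eq_sq_of_symm {q : ℕ} (hq : 0 < q) {f : ℕ → ℝ}
    (hf : ∀ j, 0 < j → j < q → f (q - j) = f j) :
    ∏ j ∈ Finset.Ico 1 q, f j =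
      (∏ j ∈ Finset.Icc 1 ((q - 1) / 2), f j) ^ 2 * if Even q then f (q / 2) else 1 := by
  rcases Nat.even_or_odd' q with ⟨m, rfl | rfl⟩
  · have hm : 0 < m := by omega
    have h1 : Finset.Icc 1 ((2 * m - 1) / 2) = Finset.Ico 1 m := by
      ext j; simp only [Finset.mem_Icc, Finset.mem_Ico]; omega
    have h2 : ∏ j ∈ Finset.Ico (m + 1) (2 * m), f j = ∏ j ∈ Finset.Ico 1 m, f j := by
      have h3 := Finset.prod_Ico_reflect f 1 (show m ≤ 2 * m + 1 by omega)
      rw [show 2 * m + 1 - m = m + 1 by omega, Nat.add_sub_cancel] at h3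
      rw [← h3]
      refine Finset.prod_congr rfl fun j hj => ?_
      rw [Finset.mem_Ico] at hj
      exact hf j (by omega) (by omega)
    rw [if_pos (even_two_mul m), h1, ← Finset.prod_Ico_consecutive f (show 1 ≤ m by omega)
      (show m ≤ 2 * m by omega), Finset.prod_eq_prod_Ico_succ_bot (show m < 2 * m by omega), h2,
      show 2 * m / 2 = m by omega]
    ring
  · have h1 : Finset.Icc 1 ((2 * m + 1 - 1) / 2) = Finset.Ico 1 (m + 1) := by
      ext j; simp only [Finset.mem_Icc, Finset.mem_Ico]; omega
    have h2 : ∏ j ∈ Finset.Ico (m + 1) (2 * m + 1), f j = ∏ j ∈ Finset.Ico 1 (m + 1), f j := by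
      have h3 := Finset.prod_Ico_reflect f 1 (show m + 1 ≤ 2 * m + 1 + 1 by omega)
      rw [show 2 * m + 1 + 1 - (m + 1) = m + 1 by omega, Nat.add_sub_cancel] at h3
      rw [← h3]
      refine Finset.prod_congr rfl fun j hj => ?_
      rw [Finset.mem_Ico] at hj
      exact hf j (by omega) (by omega)
    rw [if_neg (by rw [Nat.not_even_iff_odd]; exact odd_two_mul_add_one m), h1,
      ← Finset.prod_Ico_consecutive f (show 1 ≤ m + 1 by omega)
      (show m + 1 ≤ 2 * m + 1 by omega), h2]
    ring

theorem prod_abs_two_sin_pi_mul_div {q : ℕ} (hq : 0 < q) :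
    ∏ j ∈ Finset.Ico 1 q, |2 * Real.sin (Real.pi * j / q)| = q := by
  obtain ⟨n, rfl⟩ : ∃ n, q = n + 1 := ⟨q - 1, by omega⟩
  have hμ := Complex.isPrimitiveRoot_exp (n + 1) (by omega)
  have h := congrArg norm hμ.prod_one_sub_pow_eq_order
  rw [norm_prod] at h
  rw [Finset.range_eq_Ico] at h
  rw [show Finset.Ico 1 (n + 1) = Finset.Ico (0 + 1) (n + 1) from rfl, ← Finset.prod_Ico_add']
  have h2 : ‖(n : ℂ) + 1‖ = ((n + 1 : ℕ) : ℝ) := by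
    rw [← Nat.cast_add_one, Complex.norm_natCast]
  rw [h2] at h
  refine (Finset.prod_congr rfl fun j _ => ?_).trans h
  rw [← Complex.exp_nat_mul, norm_sub_rev,
    show ((j + 1 : ℕ) : ℂ) * (2 * Real.pi * Complex.I / ((n + 1 : ℕ) : ℂ)) =
      Complex.I * ((2 * (Real.pi * ((j + 1 : ℕ) : ℝ) / ((n + 1 : ℕ) : ℝ)) : ℝ) : ℂ) by
        push_cast; ring,
    Complex.norm_exp_I_mul_ofReal_sub_one, Real.norm_eq_abs, mul_div_cancel_left₀ _ two_ne_zero]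

theorem sin_add_mul_sin_sub (A Y : ℝ) :
    Real.sin (A + Y) * Real.sin (A - Y) = Real.sin A ^ 2 - Real.sin Y ^ 2 := by
  rw [Real.sin_add, Real.sin_sub]
  linear_combination Real.sin A ^ 2 * Real.sin_sq_add_cos_sq Y -
    Real.sin Y ^ 2 * Real.sin_sq_add_cos_sq A

theorem sin_add_int_mul_pi_sq (x : ℝ) (n : ℤ) :
    Real.sin (x + n * Real.pi) ^ 2 = Real.sin x ^ 2 := by
  rw [Real.sin_add_int_mul_pi, mul_pow, ← zpow_natCast, ← zpow_mul, mul_comm n, zpow_mul]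
  simp

theorem sin_sign_mul_sq {σ : ℤ} (hσ : σ = 1 ∨ σ = -1) (x : ℝ) :
    Real.sin (σ * x) ^ 2 = Real.sin x ^ 2 := by
  rcases hσ with rfl | rfl <;> simp

/-- The angle replacing `π j / q` in the perturbed sine product: `π / q` times the displaced node
`j - B ({jγ} - 1/2)`. -/
noncomputable def perturbedAngle (q : ℕ) (B γ : ℝ) (j : ℕ) : ℝ :=
  Real.pi * (j - B * (Int.fract (j * γ) - 1 / 2)) / q

/-- The `j`-th factor of a perturbed Sudler product after pairing and reordering; the finite
counterpart of `limitFactor`. -/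
noncomputable def sineFactor (q : ℕ) (B γ x : ℝ) (j : ℕ) : ℝ :=
  |(Real.sin (perturbedAngle q B γ j) ^ 2 - Real.sin (Real.pi * (x + B / 2) / q) ^ 2) /
    Real.sin (Real.pi * j / q) ^ 2|

theorem fract_mul_div_ne_zero {q : ℕ} {q' : ℤ} (hu : IsCoprime q' q) {j : ℕ} (hj0 : 0 < j)
    (hj : j < q) : Int.fract ((j : ℝ) * ((q' : ℝ) / q)) ≠ 0 := by
  intro h0
  have hq0 : (q : ℝ) ≠ 0 := by exact_mod_cast (by omega : q ≠ 0)
  rw [Int.fract_eq_zero_iff] at h0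
  obtain ⟨z, hz⟩ := h0
  have h1 : (z : ℝ) * q = j * q' := by rw [hz]; field_simp
  have h2 : z * q = j * q' := by exact_mod_cast h1
  have h3 : (q : ℤ) ∣ j := hu.symm.dvd_of_dvd_mul_right ⟨z, by linarith⟩
  have := Int.le_of_dvd (by omega) h3
  omega

/-- For the rational `γ = q' / q` the angles are symmetric about `π / 2`. -/
theorem perturbedAngle_sub {q : ℕ} {q' : ℤ} (hu : IsCoprime q' q) (B : ℝ) {j : ℕ} (hj0 : 0 < j)
    (hj : j < q) :
    perturbedAngle q B ((q' : ℝ) / q) (q - j) =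
      Real.pi - perturbedAngle q B ((q' : ℝ) / q) j := by
  have hq0 : (q : ℝ) ≠ 0 := by exact_mod_cast (by omega : q ≠ 0)
  have h1 : Int.fract (((q - j : ℕ) : ℝ) * ((q' : ℝ) / q)) =
      1 - Int.fract ((j : ℝ) * ((q' : ℝ) / q)) := by
    rw [← Int.fract_neg (fract_mul_div_ne_zero hu hj0 hj), Nat.cast_sub hj.le,
      show ((q : ℝ) - j) * ((q' : ℝ) / q) = q' + -(j * ((q' : ℝ) / q)) by field_simp; ring,
      Int.fract_intCast_add]
  rw [perturbedAngle, perturbedAngle, h1, Nat.cast_sub hj.le]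
  field_simp
  ring

/-- Pairing the factors `n` and `q - n` of a perturbed Sudler product, and ordering the pairs by
`j ≡ ± n p (mod q)`. The squared product is treated first: there every pair occurs twice, and the
reordering is a bijection of the residues. -/
theorem prod_abs_two_sin_eq {q : ℕ} (hq : 0 < q) {p q' σ z : ℤ} (hσ : σ = 1 ∨ σ = -1)
    (hpq : p * q' = -σ + q * z) {α B : ℝ} (hα : q * α = p + σ * (B / q)) (x : ℝ) :
    ∏ n ∈ Finset.Icc 1 q, |2 * Real.sin (Real.pi * (n * α + σ * x / q))| =
      2 * |Real.sin (Real.pi * (x + B) / q)| * q *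
        (∏ j ∈ Finset.Icc 1 ((q - 1) / 2), sineFactor q B ((q' : ℝ) / q) x j) *
        if Even q then |Real.cos (Real.pi * (x + B / 2) / q)| else 1 := by
  have hq0 : (q : ℝ) ≠ 0 := by exact_mod_cast hq.ne'
  have hσ2 : σ * σ = 1 := by rcases hσ with rfl | rfl <;> rfl
  have hσ2' : (σ : ℝ) * σ = 1 := by exact_mod_cast hσ2
  have hu : IsCoprime q' (q : ℤ) := ⟨-σ * p, σ * z, by linear_combination (-σ) * hpq + hσ2⟩
  set γ : ℝ := (q' : ℝ) / q with hγ
  set Y : ℝ := Real.pi * (x + B / 2) / q with hY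
  have hα' : α = p / q + σ * B / q ^ 2 := by field_simp at hα ⊢; linarith
  let f : ℕ → ℝ := fun n => |2 * Real.sin (Real.pi * (n * α + σ * x / q))|
  let g : ℤ → ℝ := fun n => 4 * |Real.sin (Real.pi * (n * p + σ * B *
    (Int.fract ((n : ℝ) / q) - 1 / 2)) / q) ^ 2 - Real.sin Y ^ 2|
  have hlast : f q = 2 * |Real.sin (Real.pi * (x + B) / q)| := by
    have h1 : Real.pi * (q * α + σ * x / q) = σ * (Real.pi * (x + B) / q) + p * Real.pi := by
      rw [hα]; ring
    have h2 := sin_add_int_mul_pi_sq (σ * (Real.pi * (x + B) / q)) p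
    rw [sin_sign_mul_sq hσ, ← h1] at h2
    simp only [f]
    rw [abs_mul, abs_two, (sq_eq_sq_iff_abs_eq_abs _ _).1 h2]
  have hg : Function.Periodic g q := by
    intro n
    simp only [g]
    have h1 : ((n + q : ℤ) : ℝ) / q = n / q + 1 := by push_cast; field_simp
    rw [h1, Int.fract_add_one, show Real.pi * (((n + q : ℤ) : ℝ) * p +
      σ * B * (Int.fract ((n : ℝ) / q) - 1 / 2)) / q = Real.pi * (n * p +
      σ * B * (Int.fract ((n : ℝ) / q) - 1 / 2)) / q + p * Real.pi by push_cast; field_simp; ring,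
      sin_add_int_mul_pi_sq]
  have hpair : ∀ n ∈ Finset.Ico 1 q, f n * f (q - n) = g n := by
    intro n hn
    rw [Finset.mem_Ico] at hn
    have hn' : ((n : ℤ) : ℝ) / q < 1 := by
      rw [div_lt_one (by positivity)]; exact_mod_cast hn.2
    simp only [f, g]
    rw [Int.fract_eq_self.2 ⟨by positivity, hn'⟩]
    set A := Real.pi * (((n : ℤ) : ℝ) * p + σ * B * (((n : ℤ) : ℝ) / q - 1 / 2)) / q with hA
    have e1 : Real.pi * (n * α + σ * x / q) = A + σ * Y := by
      rw [hA, hα', hY]; push_cast; field_simp; ring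
    have e2 : Real.pi * (((q - n : ℕ) : ℝ) * α + σ * x / q) = -(A - σ * Y) + p * Real.pi := by
      rw [hA, hα', hY, Nat.cast_sub hn.2.le]; push_cast; field_simp; ring
    have e3 : |Real.sin (-(A - σ * Y) + p * Real.pi)| = |Real.sin (A - σ * Y)| := by
      rw [← sq_eq_sq_iff_abs_eq_abs, sin_add_int_mul_pi_sq, Real.sin_neg, neg_sq]
    rw [e1, e2, abs_mul, abs_mul, e3, ← sin_sign_mul_sq hσ Y, ← sin_add_mul_sin_sub, abs_mul, abs_two]
    ring
  have hreorder : ∀ j ∈ Finset.Ico 1 q, g (-q' * j) =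
      |2 * Real.sin (Real.pi * j / q)| ^ 2 * sineFactor q B γ x j := by
    intro j hj
    rw [Finset.mem_Ico] at hj
    have hs : Real.sin (Real.pi * j / q) ≠ 0 := by
      apply ne_of_gt
      apply Real.sin_pos_of_pos_of_lt_pi
      · have : (0 : ℝ) < j := by exact_mod_cast hj.1
        have := Real.pi_pos
        positivity
      · rw [div_lt_iff₀ (by positivity)]
        have : (j : ℝ) < q := by exact_mod_cast hj.2
        exact mul_lt_mul_of_pos_left this Real.pi_pos
    have e1 : ((-q' * j : ℤ) : ℝ) / q = -(j * γ) := by rw [hγ]; push_cast; ring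
    have e2 : Real.pi * (((-q' * j : ℤ) : ℝ) * p +
        σ * B * (Int.fract (((-q' * j : ℤ) : ℝ) / q) - 1 / 2)) / q =
        σ * perturbedAngle q B γ j + (-(j * z) : ℤ) * Real.pi := by
      rw [e1, Int.fract_neg (fract_mul_div_ne_zero hu hj.1 hj.2), perturbedAngle, ← hγ]
      generalize Int.fract ((j : ℝ) * γ) = F
      have hpq' : (p : ℝ) * q' = -σ + q * z := by exact_mod_cast hpq
      push_cast
      field_simp
      linear_combination (-2 * (j : ℝ)) * hpq'
    simp only [g]
    rw [e2, sin_add_int_mul_pi_sq, sin_sign_mul_sq hσ, sineFactor, abs_div, abs_mul, abs_two, mul_pow,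
      abs_pow (Real.sin (Real.pi * j / q)), ← hY]
    have hs' : |Real.sin (Real.pi * j / q)| ≠ 0 := abs_ne_zero.2 hs
    field_simp
    ring
  have hsq : (∏ n ∈ Finset.Ico 1 q, f n) ^ 2 =
      (q : ℝ) ^ 2 * ∏ j ∈ Finset.Ico 1 q, sineFactor q B γ x j := by
    have h1 : ∏ n ∈ Finset.Ico 1 q, f (q - n) = ∏ n ∈ Finset.Ico 1 q, f n := by
      have := Finset.prod_Ico_reflect f 1 (show q ≤ q + 1 by omega)
      rwa [Nat.add_sub_cancel, show q + 1 - q = 1 by omega] at this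
    have hu' : IsCoprime (-q') (q : ℤ) := hu.neg_left
    calc (∏ n ∈ Finset.Ico 1 q, f n) ^ 2
        = (∏ n ∈ Finset.Ico 1 q, f n) * ∏ n ∈ Finset.Ico 1 q, f (q - n) := by rw [h1, sq]
      _ = ∏ n ∈ Finset.Ico 1 q, g n := by
        rw [← Finset.prod_mul_distrib]; exact Finset.prod_congr rfl hpair
      _ = ∏ j ∈ Finset.Ico 1 q, g (-q' * j) := (prod_Ico_mul_of_periodic hq hu' hg).symm
      _ = ∏ j ∈ Finset.Ico 1 q,
          (|2 * Real.sin (Real.pi * j / q)| ^ 2 * sineFactor q B γ x j) :=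
        Finset.prod_congr rfl hreorder
      _ = _ := by
        rw [Finset.prod_mul_distrib, Finset.prod_pow, prod_abs_two_sin_pi_mul_div hq]
  have hsymm : ∀ j, 0 < j → j < q → sineFactor q B γ x (q - j) = sineFactor q B γ x j := by
    intro j hj0 hj
    rw [sineFactor, sineFactor, perturbedAngle_sub hu B hj0 hj, Real.sin_pi_sub,
      show Real.pi * ((q - j : ℕ) : ℝ) / q = Real.pi - Real.pi * j / q by
        rw [Nat.cast_sub hj.le]; field_simp, Real.sin_pi_sub]
  have hmid : (if Even q then sineFactor q B γ x (q / 2) else 1) =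
      (if Even q then |Real.cos (Real.pi * (x + B / 2) / q)| else 1) ^ 2 := by
    by_cases he : Even q
    · rw [if_pos he, if_pos he]
      obtain ⟨m, hm⟩ := he
      have hm0 : 0 < m := by omega
      have hm' : (m : ℝ) = q / 2 := by rw [hm]; push_cast; ring
      have hdiv : q / 2 = m := by omega
      have h1 : perturbedAngle q B γ m = Real.pi / 2 := by
        have := perturbedAngle_sub hu B hm0 (by omega : m < q)
        rw [show q - m = m by omega] at this
        linarith
      rw [hdiv, sineFactor, h1, show Real.pi * (m : ℝ) / q = Real.pi / 2 by rw [hm']; field_simp,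
        Real.sin_pi_div_two, ← hY, sq_abs, Real.cos_sq', one_pow, div_one, abs_of_nonneg]
      have := Real.sin_sq_le_one Y
      linarith
    · rw [if_neg he, if_neg he, one_pow]
  have hfin : ∏ n ∈ Finset.Ico 1 q, f n =
      q * (∏ j ∈ Finset.Icc 1 ((q - 1) / 2), sineFactor q B γ x j) *
        if Even q then |Real.cos (Real.pi * (x + B / 2) / q)| else 1 := by
    rw [← sq_eq_sq₀, hsq, prod_Ico_eq_sq_of_symm hq hsymm, hmid]
    · ring
    · exact Finset.prod_nonneg fun n _ => abs_nonneg _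
    · refine mul_nonneg (mul_nonneg (by positivity)
        (Finset.prod_nonneg fun n _ => abs_nonneg _)) ?_
      split_ifs
      · exact abs_nonneg _
      · exact zero_le_one
  have hIcc : Finset.Icc 1 q = Finset.Ico 1 (q + 1) := by
    ext j; simp only [Finset.mem_Icc, Finset.mem_Ico]; omega
  change ∏ n ∈ Finset.Icc 1 q, f n = _
  rw [hIcc, Finset.prod_Ico_succ_top (by omega), hfin, hlast]
  ring

/-! ### Abel summation and elementary estimates -/

/-- Summation by parts. -/
theorem sum_Ioc_mul_eq (b φ : ℕ → ℝ) {M N : ℕ} (h : M ≤ N) :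
    ∑ j ∈ Finset.Ioc M N, b j * φ j =
      (∑ j ∈ Finset.Ioc 0 N, b j) * φ N - (∑ j ∈ Finset.Ioc 0 M, b j) * φ M -
        ∑ i ∈ Finset.Ico M N, (∑ j ∈ Finset.Ioc 0 i, b j) * (φ (i + 1) - φ i) := by
  induction N, h using Nat.le_induction with
  | base => simp
  | succ N hMN ih =>
    rw [Finset.sum_Ioc_succ_top (by omega), ih, Finset.sum_Ioc_succ_top (by omega),
      Finset.sum_Ico_succ_top hMN]
    ring

/-- Tails of `∑ b_j / j` when the partial sums of `b` are `O(√n)`. In the proof `1/i - 1/(i+1)`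
times `√i` is dominated by a telescoping difference of `2/√i`. -/
theorem abs_sum_Ioc_div_le {b : ℕ → ℝ} {D : ℝ} {M N : ℕ} (hM : 0 < M) (hMN : M ≤ N)
    (hS : ∀ n ≤ N, |∑ j ∈ Finset.Ioc 0 n, b j| ≤ D * √(n : ℝ)) :
    |∑ j ∈ Finset.Ioc M N, b j / j| ≤ 3 * D / √(M : ℝ) := by
  have hsq : ∀ n : ℕ, √(n : ℝ) * √(n : ℝ) = n := fun n => Real.mul_self_sqrt (Nat.cast_nonneg n)
  have hspos : ∀ n : ℕ, 0 < n → 0 < √(n : ℝ) := fun n hn =>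
    Real.sqrt_pos.2 (by exact_mod_cast hn)
  have hD : 0 ≤ D := by
    have := (abs_nonneg _).trans (hS M hMN)
    exact nonneg_of_mul_nonneg_left this (hspos M hM)
  have hend : ∀ n, 0 < n → n ≤ N → |(∑ j ∈ Finset.Ioc 0 n, b j) * ((n : ℝ))⁻¹| ≤ D / √(n : ℝ) := by
    intro n hn hnN
    have h0 := hspos n hn
    rw [abs_mul, abs_inv, Nat.abs_cast]
    refine (mul_le_mul_of_nonneg_right (hS n hnN) (by positivity)).trans (le_of_eq ?_)
    rw [show ((n : ℝ))⁻¹ = (√(n : ℝ))⁻¹ * (√(n : ℝ))⁻¹ by rw [← mul_inv, hsq]]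
    field_simp
  have hmid : |∑ i ∈ Finset.Ico M N, (∑ j ∈ Finset.Ioc 0 i, b j) *
      (((i + 1 : ℕ) : ℝ)⁻¹ - ((i : ℕ) : ℝ)⁻¹)| ≤
      ∑ i ∈ Finset.Ico M N, (2 * D / √(i : ℝ) - 2 * D / √((i + 1 : ℕ) : ℝ)) := by
    refine (Finset.abs_sum_le_sum_abs _ _).trans (Finset.sum_le_sum fun i hi => ?_)
    rw [Finset.mem_Ico] at hi
    have hi0 : 0 < i := by omega
    have h0 := hspos i hi0
    have h1 := hspos (i + 1) (by omega)
    have e0 := hsq i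
    have e1 := hsq (i + 1)
    have hmono : √(i : ℝ) ≤ √((i + 1 : ℕ) : ℝ) := Real.sqrt_le_sqrt (by push_cast; linarith)
    rw [abs_mul]
    have h2 : |((i + 1 : ℕ) : ℝ)⁻¹ - ((i : ℕ) : ℝ)⁻¹| = 1 / (i * ((i + 1 : ℕ) : ℝ)) := by
      have hi' : (0 : ℝ) < i := by exact_mod_cast hi0
      rw [abs_sub_comm, abs_of_nonneg]
      · push_cast; field_simp; ring
      · rw [sub_nonneg]
        apply inv_anti₀ hi'
        push_cast; linarith
    rw [h2]
    refine (mul_le_mul_of_nonneg_right (hS i (by omega)) (by positivity)).trans ?_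
    rw [← e0, ← e1, Real.sqrt_mul_self h0.le, Real.sqrt_mul_self h1.le]
    push_cast at *
    set u := √(i : ℝ)
    set v := √((i : ℝ) + 1)
    have hv : v * v = u * u + 1 := by rw [e1, e0]
    have hge : 0 ≤ D * (2 * v * (v - u) - 1) := by
      apply mul_nonneg hD
      nlinarith
    have hkey : 2 * D / u - 2 * D / v - D * u * (1 / (u * u * (v * v))) =
        D * (2 * v * (v - u) - 1) / (u * (v * v)) := by
      field_simp
    have := div_nonneg hge (by positivity : 0 ≤ u * (v * v))
    linarith
  have htel : ∑ i ∈ Finset.Ico M N, (2 * D / √(i : ℝ) - 2 * D / √((i + 1 : ℕ) : ℝ)) =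
      2 * D / √(M : ℝ) - 2 * D / √(N : ℝ) := by
    have := Finset.sum_Ico_sub (fun i : ℕ => -(2 * D / √(i : ℝ))) hMN
    rw [show 2 * D / √(M : ℝ) - 2 * D / √(N : ℝ) = -(2 * D / √(N : ℝ)) - -(2 * D / √(M : ℝ)) by
      ring, ← this]
    refine Finset.sum_congr rfl fun i _ => by ring
  have hident := sum_Ioc_mul_eq b (fun n : ℕ => (n : ℝ)⁻¹) hMN
  simp only [div_eq_mul_inv] at hident ⊢
  rw [hident]
  have h1 := hend N (by omega) le_rfl
  have h2 := hend M hM hMN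
  rw [htel] at hmid
  have h3 : 0 ≤ D / √(N : ℝ) := by positivity
  refine (abs_sub _ _).trans ?_
  refine (add_le_add ((abs_sub _ _).trans (add_le_add h1 h2)) hmid).trans ?_
  have e : ∀ k : ℝ, ∀ n : ℕ, k * D / √(n : ℝ) = k * (D / √(n : ℝ)) := fun k n => by ring
  rw [e, e, ← div_eq_mul_inv, e]
  linarith

/-- Abel's inequality for monotone non-negative weights. -/
theorem abs_sum_Ioc_mul_le_of_monotone {b φ : ℕ → ℝ} {D Φ : ℝ} {N : ℕ} (hD : 0 ≤ D)
    (hS : ∀ n ≤ N, |∑ j ∈ Finset.Ioc 0 n, b j| ≤ D * √(n : ℝ)) (h0 : 0 ≤ φ 0)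
    (hmono : ∀ i < N, φ i ≤ φ (i + 1)) (hΦ : φ N ≤ Φ) :
    |∑ j ∈ Finset.Ioc 0 N, b j * φ j| ≤ 2 * D * √(N : ℝ) * Φ := by
  have hpos : 0 ≤ φ N := by
    have : ∀ i ≤ N, 0 ≤ φ i := by
      intro i
      induction i with
      | zero => exact fun _ => h0
      | succ i ih => exact fun hi => (ih (by omega)).trans (hmono i (by omega))
    exact this N le_rfl
  rw [sum_Ioc_mul_eq b φ (Nat.zero_le N)]
  simp only [Finset.Ioc_self, Finset.sum_empty, zero_mul, sub_zero]
  have hmid : |∑ i ∈ Finset.Ico 0 N, (∑ j ∈ Finset.Ioc 0 i, b j) * (φ (i + 1) - φ i)| ≤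
      ∑ i ∈ Finset.Ico 0 N, D * √(N : ℝ) * (φ (i + 1) - φ i) := by
    refine (Finset.abs_sum_le_sum_abs _ _).trans (Finset.sum_le_sum fun i hi => ?_)
    rw [Finset.mem_Ico] at hi
    have h1 := hmono i hi.2
    rw [abs_mul, abs_of_nonneg (sub_nonneg.2 h1)]
    refine mul_le_mul_of_nonneg_right ((hS i hi.2.le).trans ?_) (sub_nonneg.2 h1)
    have : (i : ℝ) ≤ N := by exact_mod_cast hi.2.le
    gcongr
  rw [← Finset.mul_sum, Finset.sum_Ico_sub φ (Nat.zero_le N)] at hmid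
  refine (abs_sub _ _).trans ?_
  have h1 : |(∑ j ∈ Finset.Ioc 0 N, b j) * φ N| ≤ D * √(N : ℝ) * φ N := by
    rw [abs_mul, abs_of_nonneg hpos]
    exact mul_le_mul_of_nonneg_right (hS N le_rfl) hpos
  have h2 : 0 ≤ D * √(N : ℝ) := by positivity
  nlinarith

theorem abs_log_one_sub_add_le {z : ℝ} (hz : |z| ≤ 1 / 2) : |Real.log (1 - z) + z| ≤ 2 * z ^ 2 := by
  have h := Real.abs_log_sub_add_sum_range_le (show |z| < 1 by linarith) 1
  simp only [Finset.sum_range_one, zero_add, pow_one, Nat.cast_zero, div_one, one_add_one_eq_two] at h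
  rw [add_comm]
  refine h.trans ?_
  rw [div_le_iff₀ (by linarith), ← sq_abs z]
  nlinarith [sq_nonneg |z|]

theorem abs_log_one_sub_sub_log_le {z z' : ℝ} (hz : |z| ≤ 1 / 2) (hz' : |z'| ≤ 1 / 2) :
    |Real.log (1 - z') - Real.log (1 - z) + (z' - z)| ≤ 2 * (|z| + |z'|) * |z' - z| := by
  have hder : ∀ t ∈ Set.uIcc z z', HasDerivWithinAt (fun t => Real.log (1 - t) + t)
      (-1 / (1 - t) + 1) (Set.uIcc z z') t := by
    intro t ht
    have ht1 : |t| ≤ 1 / 2 := by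
      rw [abs_le] at *
      exact ⟨(le_inf hz.1 hz'.1).trans ht.1, ht.2.trans (sup_le hz.2 hz'.2)⟩
    have h0 : 1 - t ≠ 0 := by have := (abs_le.1 ht1).2; linarith
    exact ((((hasDerivAt_id t).const_sub 1).log h0).add (hasDerivAt_id t)).hasDerivWithinAt
  have hbound : ∀ t ∈ Set.uIcc z z', ‖-1 / (1 - t) + 1‖ ≤ 2 * (|z| + |z'|) := by
    intro t ht
    have ht1 : |t| ≤ 1 / 2 := by
      rw [abs_le] at *
      exact ⟨(le_inf hz.1 hz'.1).trans ht.1, ht.2.trans (sup_le hz.2 hz'.2)⟩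
    have ht2 : |t| ≤ |z| + |z'| := by
      rw [abs_le]
      have h1 := neg_abs_le z
      have h2 := neg_abs_le z'
      have h3 := le_abs_self z
      have h4 := le_abs_self z'
      exact ⟨(le_inf (by linarith [abs_nonneg z']) (by linarith [abs_nonneg z])).trans ht.1,
        ht.2.trans (sup_le (by linarith [abs_nonneg z']) (by linarith [abs_nonneg z]))⟩
    have h0 : 1 / 2 ≤ 1 - t := by have := (abs_le.1 ht1).2; linarith
    have : -1 / (1 - t) + 1 = -t / (1 - t) := by
      have : (1 - t) ≠ 0 := by linarith
      field_simp; ring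
    rw [this, Real.norm_eq_abs, abs_div, abs_neg, abs_of_pos (by linarith : 0 < 1 - t),
      div_le_iff₀ (by linarith)]
    nlinarith [abs_nonneg z, abs_nonneg z']
  have := (convex_uIcc z z').norm_image_sub_le_of_norm_hasDerivWithin_le hder hbound
    Set.left_mem_uIcc Set.right_mem_uIcc
  rw [Real.norm_eq_abs, Real.norm_eq_abs] at this
  convert this using 2
  ring

/-- The function `1/θ - cot θ`, the derivative of `-log (sin θ / θ)`. As division by zero gives zero,
it vanishes at `0`, which is also its limit there. -/
noncomputable def invSubCot (θ : ℝ) : ℝ := 1 / θ - Real.cos θ / Real.sin θ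

theorem invSubCot_nonneg {θ : ℝ} (h0 : 0 < θ) (h1 : θ ≤ Real.pi / 2) : 0 ≤ invSubCot θ := by
  have hs : 0 < Real.sin θ := Real.sin_pos_of_pos_of_lt_pi h0 (by linarith [Real.pi_pos])
  rw [invSubCot, sub_nonneg, div_le_div_iff₀ hs h0]
  rcases h1.eq_or_lt with h | h
  · rw [h]; simp
  · have hc : 0 < Real.cos θ := Real.cos_pos_of_mem_Ioo ⟨by linarith, h⟩
    have := Real.lt_tan h0 h
    rw [Real.tan_eq_sin_div_cos, lt_div_iff₀ hc] at this
    linarith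

theorem invSubCot_le {θ : ℝ} (h0 : 0 < θ) (h1 : θ ≤ Real.pi / 2) : invSubCot θ ≤ θ / 2 := by
  have hs : 0 < Real.sin θ := Real.sin_pos_of_pos_of_lt_pi h0 (by linarith [Real.pi_pos])
  have hc : 0 ≤ Real.cos θ := Real.cos_nonneg_of_mem_Icc ⟨by linarith, h1⟩
  have h2 : 1 - θ ^ 2 / 2 ≤ Real.cos θ := Real.one_sub_sq_div_two_le_cos
  have h3 : Real.cos θ / θ ≤ Real.cos θ / Real.sin θ :=
    div_le_div_of_nonneg_left hc hs (Real.sin_lt h0).le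
  have h4 : (1 - θ ^ 2 / 2) / θ ≤ Real.cos θ / θ := div_le_div_of_nonneg_right h2 h0.le
  have h5 : (1 - θ ^ 2 / 2) / θ = 1 / θ - θ / 2 := by field_simp
  rw [invSubCot]
  linarith

theorem invSubCot_mono {x y : ℝ} (h0 : 0 < x) (hxy : x ≤ y) (h1 : y ≤ Real.pi / 2) :
    invSubCot x ≤ invSubCot y := by
  have hd : ∀ t ∈ Set.Icc x y, HasDerivAt invSubCot (1 / Real.sin t ^ 2 - 1 / t ^ 2) t := by
    intro t ht
    have ht0 : 0 < t := h0.trans_le ht.1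
    have hs : 0 < Real.sin t := Real.sin_pos_of_pos_of_lt_pi ht0 (by linarith [Real.pi_pos, ht.2])
    have e1 := (hasDerivAt_inv ht0.ne').sub
      ((Real.hasDerivAt_cos t).div (Real.hasDerivAt_sin t) hs.ne')
    have e2 : (fun t : ℝ => t⁻¹) - (Real.cos / Real.sin) = invSubCot := by
      funext t; simp [invSubCot]
    rw [e2] at e1
    have e3 : 1 / Real.sin t ^ 2 - 1 / t ^ 2 =
        -(t ^ 2)⁻¹ - (-Real.sin t * Real.sin t - Real.cos t * Real.cos t) / Real.sin t ^ 2 := by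
      have := Real.sin_sq_add_cos_sq t
      rw [show -Real.sin t * Real.sin t - Real.cos t * Real.cos t = -1 by linarith]
      ring
    rw [e3]
    exact e1
  refine monotoneOn_of_deriv_nonneg (convex_Icc x y)
    (fun t ht => (hd t ht).continuousAt.continuousWithinAt)
    (fun t ht => ((hd t (interior_subset ht)).differentiableAt).differentiableWithinAt)
    (fun t ht => ?_) (Set.left_mem_Icc.2 hxy) (Set.right_mem_Icc.2 hxy) hxy
  have ht' := interior_subset ht
  have ht0 : 0 < t := h0.trans_le ht'.1
  have hs : 0 < Real.sin t := Real.sin_pos_of_pos_of_lt_pi ht0 (by linarith [Real.pi_pos, ht'.2])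
  rw [(hd t ht').deriv, sub_nonneg]
  apply one_div_le_one_div_of_le (by positivity)
  have := (Real.sin_lt ht0).le
  gcongr

theorem abs_sin_sub_self_le {ε : ℝ} (h : |ε| ≤ 1) : |Real.sin ε - ε| ≤ |ε| ^ 3 / 4 := by
  have h1 := Real.sin_bound h
  have h2 : |Real.sin ε - ε| ≤ |Real.sin ε - (ε - ε ^ 3 / 6)| + |ε ^ 3 / 6| := by
    rw [show Real.sin ε - ε = (Real.sin ε - (ε - ε ^ 3 / 6)) - ε ^ 3 / 6 by ring]
    exact abs_sub _ _
  rw [abs_div, abs_pow, abs_of_pos (by norm_num : (0 : ℝ) < 6)] at h2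
  have h3 : |ε| ^ 5 ≤ |ε| ^ 3 := pow_le_pow_of_le_one (abs_nonneg ε) h (by norm_num)
  have h4 : 0 ≤ |ε| ^ 3 := by positivity
  linarith

/-- Passing from `θ` to `θ - ε` changes `log (sin θ)` and `log θ` by amounts whose difference is
linear in `ε` up to `O(ε²)`, uniformly in `θ`. -/
theorem abs_log_sin_ratio_sub_le {θ ε : ℝ} (h0 : 0 < θ) (h1 : θ ≤ Real.pi / 2)
    (h2 : |ε| ≤ θ / 2) (h3 : |ε| ≤ 1 / 10) :
    |Real.log (Real.sin (θ - ε) / Real.sin θ) - Real.log (1 - ε / θ) - invSubCot θ * ε| ≤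
      11 * ε ^ 2 := by
  have hpi := Real.pi_le_four
  have hs : 0 < Real.sin θ := Real.sin_pos_of_pos_of_lt_pi h0 (by linarith [Real.pi_pos])
  have hm0 := invSubCot_nonneg h0 h1
  have hm1 := invSubCot_le h0 h1
  set m := invSubCot θ with hm
  have hr : |ε / θ| ≤ 1 / 2 := by
    rw [abs_div, abs_of_pos h0, div_le_iff₀ h0]; linarith
  have hr' := abs_le.1 hr
  have hε2 : |ε| * |ε| = ε ^ 2 := by rw [← sq, sq_abs]
  have hcot : Real.cos θ / Real.sin θ = 1 / θ - m := by rw [hm, invSubCot]; ring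
  have hcot0 : 0 ≤ Real.cos θ / Real.sin θ :=
    div_nonneg (Real.cos_nonneg_of_mem_Icc ⟨by linarith, h1⟩) hs.le
  set A := Real.cos ε - 1 - Real.cos θ / Real.sin θ * (Real.sin ε - ε) with hA
  have hAb : |A| ≤ 5 / 8 * ε ^ 2 := by
    have e1 : |Real.cos ε - 1| ≤ ε ^ 2 / 2 := by
      rw [abs_sub_comm, abs_of_nonneg (by linarith [Real.cos_le_one ε])]
      linarith [Real.one_sub_sq_div_two_le_cos (x := ε)]
    have e2 : |Real.cos θ / Real.sin θ * (Real.sin ε - ε)| ≤ ε ^ 2 / 8 := by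
      rw [abs_mul, abs_of_nonneg hcot0]
      calc Real.cos θ / Real.sin θ * |Real.sin ε - ε| ≤ 1 / θ * (|ε| ^ 3 / 4) := by
            apply mul_le_mul (by linarith) (abs_sin_sub_self_le (by linarith)) (abs_nonneg _)
              (by positivity)
        _ = |ε / θ| * (|ε| * |ε|) / 4 := by rw [abs_div, abs_of_pos h0]; ring
        _ ≤ 1 / 2 * (|ε| * |ε|) / 4 := by gcongr
        _ = ε ^ 2 / 8 := by rw [hε2]; ring
    refine (abs_sub _ _).trans ?_
    linarith
  set v := Real.sin (θ - ε) / Real.sin θ / (1 - ε / θ) - 1 with hv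
  have hd : 1 / 2 ≤ 1 - ε / θ := by linarith
  have hvA : v = (A + m * ε) / (1 - ε / θ) := by
    have : Real.sin (θ - ε) / Real.sin θ = Real.cos ε - Real.cos θ / Real.sin θ * Real.sin ε := by
      rw [Real.sin_sub]; field_simp
    rw [hv, this, hA, hcot, eq_div_iff (by linarith), sub_mul, div_mul_cancel₀ _ (by linarith)]
    ring
  have hvm : |v - m * ε| ≤ 3 * ε ^ 2 := by
    have e1 : v - m * ε = (A + m * ε * (ε / θ)) / (1 - ε / θ) := by
      rw [hvA, eq_div_iff (by linarith), sub_mul, div_mul_cancel₀ _ (by linarith)]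
      ring
    have e2 : |m * ε * (ε / θ)| ≤ ε ^ 2 / 2 := by
      have : m * ε * (ε / θ) = m / θ * ε ^ 2 := by ring
      rw [this, abs_of_nonneg (by positivity)]
      have : m / θ ≤ 1 / 2 := by rw [div_le_iff₀ h0]; linarith
      nlinarith [sq_nonneg ε]
    rw [e1, abs_div, abs_of_pos (by linarith : 0 < 1 - ε / θ), div_le_iff₀ (by linarith)]
    have := abs_add_le A (m * ε * (ε / θ))
    nlinarith [sq_nonneg ε]
  have hmε : |m * ε| ≤ |ε| := by
    rw [abs_mul, abs_of_nonneg hm0]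
    exact mul_le_of_le_one_left (abs_nonneg ε) (by linarith)
  have hvb : |v| ≤ 2 * |ε| := by
    have : |v| ≤ |v - m * ε| + |m * ε| := by
      have := abs_add_le (v - m * ε) (m * ε)
      rwa [sub_add_cancel] at this
    have : 3 * ε ^ 2 ≤ |ε| := by rw [← hε2]; nlinarith [abs_nonneg ε]
    linarith
  have hlog : Real.log (Real.sin (θ - ε) / Real.sin θ) - Real.log (1 - ε / θ) =
      Real.log (1 - -v) := by
    have hsε : 0 < Real.sin (θ - ε) := by
      have := abs_le.1 h2
      exact Real.sin_pos_of_pos_of_lt_pi (by linarith) (by linarith [Real.pi_pos])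
    rw [← Real.log_div (by positivity) (by linarith), hv]
    congr 1
    ring
  have h5 := abs_log_one_sub_add_le (z := -v) (by rw [abs_neg]; linarith)
  rw [hlog]
  have h6 : |Real.log (1 - -v) - m * ε| ≤ |Real.log (1 - -v) + -v| + |v - m * ε| := by
    have := abs_add_le (Real.log (1 - -v) + -v) (v - m * ε)
    rwa [show Real.log (1 - -v) + -v + (v - m * ε) = Real.log (1 - -v) - m * ε by ring] at this
  have h7 : v ^ 2 ≤ 4 * ε ^ 2 := by
    rw [← sq_abs v, ← hε2]
    nlinarith [abs_nonneg v, abs_nonneg ε]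
  rw [neg_sq] at h5
  linarith

/-! ### The conditionally convergent product -/

theorem abs_fract_sub_half_le (x : ℝ) : |Int.fract x - 1 / 2| ≤ 1 / 2 := by
  rw [abs_le]
  constructor <;> linarith [Int.fract_nonneg x, Int.fract_lt_one x]

/-- The relative displacement `B ({jγ} - 1/2) / j` of the `j`-th node. -/
noncomputable def displacement (B γ : ℝ) (j : ℕ) : ℝ := B * ((Int.fract (j * γ) - 1 / 2) / j)

theorem abs_displacement_le {B : ℝ} (hB0 : 0 < B) (hB1 : B ≤ 1) (γ : ℝ) {j : ℕ} (hj : 0 < j) :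
    |displacement B γ j| ≤ 1 / 2 / j := by
  have hj' : (0 : ℝ) < j := by exact_mod_cast hj
  rw [displacement, abs_mul, abs_of_pos hB0, abs_div, Nat.abs_cast]
  have := div_le_div_of_nonneg_right (abs_fract_sub_half_le (j * γ)) hj'.le
  have h0 : 0 ≤ |Int.fract (j * γ) - 1 / 2| / j := by positivity
  nlinarith

theorem abs_displacement_le_half {B : ℝ} (hB0 : 0 < B) (hB1 : B ≤ 1) (γ : ℝ) {j : ℕ}
    (hj : 0 < j) : |displacement B γ j| ≤ 1 / 2 := by
  have hj' : (1 : ℝ) ≤ j := by exact_mod_cast hj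
  exact (abs_displacement_le hB0 hB1 γ hj).trans (div_le_self (by norm_num) hj')

theorem sum_Ioc_zero_eq_sum_range (f : ℕ → ℝ) (n : ℕ) :
    ∑ j ∈ Finset.Ioc 0 n, f j = ∑ j ∈ Finset.range n, f (j + 1) := by
  induction n with
  | zero => simp
  | succ n ih => rw [Finset.sum_Ioc_succ_top (Nat.zero_le n), ih, Finset.sum_range_succ]

theorem abs_sum_Ioc_fract_le {c β κ : ℝ} (hβ : IsBadlyApproximable c β) (hκ : 0 ≤ κ) {γ : ℝ}
    {Q : ℕ} (hγ : |γ - β| ≤ κ / (Q : ℝ) ^ 2) {n : ℕ} (hn : n ≤ Q) :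
    |∑ j ∈ Finset.Ioc 0 n, (Int.fract (j * γ) - 1 / 2)| ≤ 4 * (2 * κ + 3) / c * √(n : ℝ) := by
  rw [sum_Ioc_zero_eq_sum_range]
  refine le_of_eq_of_le (congrArg _ (Finset.sum_congr rfl fun j _ => ?_))
    (abs_sum_fract_le_sqrt hβ hκ hγ hn γ)
  congr 2
  push_cast
  ring

theorem abs_sum_Ioc_fract_self_le {c β κ : ℝ} (hβ : IsBadlyApproximable c β) (hκ : 0 ≤ κ)
    (n : ℕ) :
    |∑ j ∈ Finset.Ioc 0 n, (Int.fract (j * β) - 1 / 2)| ≤ 4 * (2 * κ + 3) / c * √(n : ℝ) :=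
  abs_sum_Ioc_fract_le hβ hκ (by rw [sub_self, abs_zero]; positivity) le_rfl

theorem inv_le_inv_sqrt {n : ℕ} (hn : 0 < n) : ((n : ℝ))⁻¹ ≤ 1 / √(n : ℝ) := by
  have hn' : (1 : ℝ) ≤ n := by exact_mod_cast hn
  rw [one_div]
  apply inv_anti₀ (by positivity)
  rw [Real.sqrt_le_left (by linarith)]
  nlinarith

/-- The product `∏ (1 - B ({jβ} - 1/2) / j)` converges, conditionally, with the rate `O(N^{-1/2})`,
by summation by parts. -/
theorem exists_log_displacement_limit {c β B : ℝ} (hβ : IsBadlyApproximable c β) (hB0 : 0 < B)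
    (hB1 : B ≤ 1) : ∃ Λ K : ℝ, 0 ≤ K ∧ ∀ N : ℕ, 0 < N →
      |∑ j ∈ Finset.Ioc 0 N, Real.log (1 - displacement B β j) - Λ| ≤ K / √(N : ℝ) := by
  have hc := hβ.1
  set D := 4 * (2 * 0 + 3) / c with hD
  have hD0 : 0 < D := by positivity
  let s : ℕ → ℝ := fun N => ∑ j ∈ Finset.Ioc 0 N, Real.log (1 - displacement B β j)
  have htail : ∀ M N : ℕ, 0 < M → M ≤ N → |s N - s M| ≤ (3 * D + 1) / √(M : ℝ) := by
    intro M N hM hMN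
    have hM' : (0 : ℝ) < M := by exact_mod_cast hM
    have h1 : s N - s M = ∑ j ∈ Finset.Ioc M N, Real.log (1 - displacement B β j) := by
      rw [sub_eq_iff_eq_add', Finset.sum_Ioc_consecutive _ (Nat.zero_le M) hMN]
    have h2 : |∑ j ∈ Finset.Ioc M N, displacement B β j| ≤ 3 * D / √(M : ℝ) := by
      have h3 := abs_sum_Ioc_div_le hM hMN fun n _ => abs_sum_Ioc_fract_self_le hβ le_rfl n
      simp only [displacement]
      rw [← Finset.mul_sum, abs_mul, abs_of_pos hB0]
      exact (mul_le_of_le_one_left (abs_nonneg _) hB1).trans h3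
    have h3 : |∑ j ∈ Finset.Ioc M N,
        (Real.log (1 - displacement B β j) + displacement B β j)| ≤ 1 / √(M : ℝ) := by
      refine (Finset.abs_sum_le_sum_abs _ _).trans ?_
      have h4 : ∀ j ∈ Finset.Ioc M N, |Real.log (1 - displacement B β j) + displacement B β j| ≤
          ((j : ℝ) ^ 2)⁻¹ := by
        intro j hj
        have hj0 : 0 < j := by rw [Finset.mem_Ioc] at hj; omega
        have hj' : (0 : ℝ) < j := by exact_mod_cast hj0
        refine (abs_log_one_sub_add_le (abs_displacement_le_half hB0 hB1 β hj0)).trans ?_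
        have h5 := abs_displacement_le hB0 hB1 β hj0
        rw [← sq_abs]
        calc 2 * |displacement B β j| ^ 2 ≤ 2 * (1 / 2 / (j : ℝ)) ^ 2 := by gcongr
          _ = 1 / 2 * ((j : ℝ) ^ 2)⁻¹ := by field_simp
          _ ≤ ((j : ℝ) ^ 2)⁻¹ := mul_le_of_le_one_left (by positivity) (by norm_num)
      refine (Finset.sum_le_sum h4).trans ((sum_Ioc_inv_sq_le_sub hM.ne' hMN).trans ?_)
      have h5 := inv_le_inv_sqrt hM
      have h6 : (0 : ℝ) ≤ (N : ℝ)⁻¹ := by positivity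
      linarith
    rw [Finset.sum_add_distrib, ← h1] at h3
    rw [add_div]
    have := abs_sub (s N - s M + ∑ j ∈ Finset.Ioc M N, displacement B β j)
      (∑ j ∈ Finset.Ioc M N, displacement B β j)
    rw [add_sub_cancel_right] at this
    linarith
  have hlim0 : Tendsto (fun n : ℕ => (3 * D + 1) / √((n + 1 : ℕ) : ℝ)) atTop (𝓝 0) :=
    Tendsto.div_atTop tendsto_const_nhds (Real.tendsto_sqrt_atTop.comp
      (tendsto_natCast_atTop_atTop.comp (tendsto_add_atTop_nat 1)))
  have hcau : CauchySeq fun n => s (n + 1) := by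
    refine cauchySeq_of_le_tendsto_0' _ (fun n m hnm => ?_) hlim0
    rw [dist_comm, Real.dist_eq]
    exact htail (n + 1) (m + 1) (by omega) (by omega)
  obtain ⟨Λ, hΛ⟩ := cauchySeq_tendsto_of_complete hcau
  have hΛ' : Tendsto s atTop (𝓝 Λ) := (tendsto_add_atTop_iff_nat 1).1 hΛ
  refine ⟨Λ, 3 * D + 1, by positivity, fun N hN => ?_⟩
  have h1 : Tendsto (fun n => |s N - s n|) atTop (𝓝 |s N - Λ|) :=
    (tendsto_const_nhds.sub hΛ').abs
  refine le_of_tendsto h1 (eventually_atTop.2 ⟨N, fun n hn => ?_⟩)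
  rw [abs_sub_comm]
  exact htail N n hN hn

section Comparison

variable {c β κ γ B B' : ℝ} {q : ℕ}

/-- As long as `j` is small compared with `q`, no integer separates `jγ` from `jβ`. -/
theorem abs_fract_sub_fract_le_of_lt (hβ : IsBadlyApproximable c β)
    (hγ : |γ - β| ≤ κ / (q : ℝ) ^ 2) (hq : 0 < q) {j : ℕ} (hj : 0 < j)
    (hjq : κ * (j : ℝ) ^ 2 < c * (q : ℝ) ^ 2) :
    |Int.fract (j * γ) - Int.fract (j * β)| ≤ κ * j / (q : ℝ) ^ 2 := by
  have hj' : (0 : ℝ) < j := by exact_mod_cast hj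
  have hq' : (0 : ℝ) < q := by exact_mod_cast hq
  have h1 : |j * γ - j * β| ≤ κ * j / (q : ℝ) ^ 2 := by
    rw [← mul_sub, abs_mul, Nat.abs_cast]
    calc (j : ℝ) * |γ - β| ≤ j * (κ / (q : ℝ) ^ 2) := by gcongr
      _ = _ := by ring
  have h2 : κ * j / (q : ℝ) ^ 2 < c / j := by
    rw [div_lt_div_iff₀ (by positivity) hj']
    linarith
  have h3 := abs_le.1 h1
  have hfl : ⌊j * γ⌋ = ⌊j * β⌋ := by
    by_contra hne
    rcases lt_or_gt_of_ne hne with h | h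
    · have h4 : j * γ < ⌊j * β⌋ := Int.floor_lt.1 h
      have h5 := Int.floor_le (j * β)
      have h6 := hβ.2 j ⌊j * β⌋ hj
      rw [abs_of_nonneg (by linarith)] at h6
      linarith
    · have h4 : j * β < ⌊j * γ⌋ := Int.floor_lt.1 h
      have h5 := Int.floor_le (j * γ)
      have h6 := hβ.2 j ⌊j * γ⌋ hj
      rw [abs_sub_comm, abs_of_nonneg (by linarith)] at h6
      linarith
  rw [Int.fract, Int.fract, hfl, sub_sub_sub_cancel_right]
  exact h1

/-- A bound valid for all `j`: it is trivial where `abs_fract_sub_fract_le_of_lt` does not apply. -/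
theorem abs_fract_sub_fract_le (hβ : IsBadlyApproximable c β) (hκ : 0 ≤ κ)
    (hγ : |γ - β| ≤ κ / (q : ℝ) ^ 2) (hq : 0 < q) {j : ℕ} (hj : 0 < j) :
    |Int.fract (j * γ) - Int.fract (j * β)| ≤ (κ + κ / c) * (j : ℝ) ^ 2 / (q : ℝ) ^ 2 := by
  have hc := hβ.1
  have hj' : (1 : ℝ) ≤ j := by exact_mod_cast hj
  have hq' : (0 : ℝ) < q := by exact_mod_cast hq
  by_cases h : κ * (j : ℝ) ^ 2 < c * (q : ℝ) ^ 2
  · refine (abs_fract_sub_fract_le_of_lt hβ hγ hq hj h).trans ?_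
    gcongr
    · have : 0 ≤ κ / c := by positivity
      linarith
    · nlinarith
  · have h1 : |Int.fract (j * γ) - Int.fract (j * β)| ≤ 1 := by
      rw [abs_le]
      constructor <;> linarith [Int.fract_nonneg (j * γ), Int.fract_lt_one (j * γ),
        Int.fract_nonneg (j * β), Int.fract_lt_one (j * β)]
    refine h1.trans ?_
    push Not at h
    rw [le_div_iff₀ (by positivity)]
    have h2 : (q : ℝ) ^ 2 ≤ κ / c * (j : ℝ) ^ 2 := by
      rw [div_mul_eq_mul_div, le_div_iff₀ hc]; linarith
    have h3 : 0 ≤ κ * (j : ℝ) ^ 2 := by positivity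
    linarith

theorem abs_mul_fract_sub_le (hβ : IsBadlyApproximable c β) (hκ : 0 ≤ κ) (hB0 : 0 < B)
    (hB1 : B ≤ 1) (hBB : |B' - B| ≤ κ / (q : ℝ) ^ 2)
    (hγ : |γ - β| ≤ κ / (q : ℝ) ^ 2) (hq : 0 < q) {j : ℕ} (hj : 0 < j) :
    |B' * (Int.fract (j * γ) - 1 / 2) - B * (Int.fract (j * β) - 1 / 2)| ≤
      (2 * κ + κ / c) * (j : ℝ) ^ 2 / (q : ℝ) ^ 2 := by
  have hj' : (1 : ℝ) ≤ j := by exact_mod_cast hj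
  have hq' : (0 : ℝ) < q := by exact_mod_cast hq
  have h1 := abs_fract_sub_fract_le hβ hκ hγ hq hj
  have h2 : |(B' - B) * (Int.fract (j * γ) - 1 / 2)| ≤ κ * (j : ℝ) ^ 2 / (q : ℝ) ^ 2 := by
    rw [abs_mul]
    calc |B' - B| * |Int.fract (j * γ) - 1 / 2| ≤ κ / (q : ℝ) ^ 2 * (1 / 2) :=
          mul_le_mul hBB (abs_fract_sub_half_le _) (abs_nonneg _) (by positivity)
      _ ≤ κ / (q : ℝ) ^ 2 * (j : ℝ) ^ 2 := by
          apply mul_le_mul_of_nonneg_left _ (by positivity); nlinarith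
      _ = _ := by ring
  have h3 : |B * (Int.fract (j * γ) - Int.fract (j * β))| ≤
      (κ + κ / c) * (j : ℝ) ^ 2 / (q : ℝ) ^ 2 := by
    rw [abs_mul, abs_of_pos hB0]
    exact (mul_le_of_le_one_left (abs_nonneg _) hB1).trans h1
  have h4 : B' * (Int.fract (j * γ) - 1 / 2) - B * (Int.fract (j * β) - 1 / 2) =
      (B' - B) * (Int.fract (j * γ) - 1 / 2) + B * (Int.fract (j * γ) - Int.fract (j * β)) := by
    ring
  rw [h4]
  refine (abs_add_le _ _).trans ((add_le_add h2 h3).trans (le_of_eq ?_))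
  ring

theorem sum_Ioc_const_div_sq_le {C : ℝ} (hC : 0 ≤ C) (hq : 0 < q) {M N : ℕ} (hN : N ≤ q) :
    ∑ _j ∈ Finset.Ioc M N, C / (q : ℝ) ^ 2 ≤ C / √(q : ℝ) := by
  have hq' : (0 : ℝ) < q := by exact_mod_cast hq
  rw [Finset.sum_const, Nat.card_Ioc, nsmul_eq_mul]
  have h1 : ((N - M : ℕ) : ℝ) ≤ q := by exact_mod_cast (Nat.sub_le N M).trans hN
  calc ((N - M : ℕ) : ℝ) * (C / (q : ℝ) ^ 2) ≤ q * (C / (q : ℝ) ^ 2) := by gcongr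
    _ = C * (q : ℝ)⁻¹ := by field_simp
    _ ≤ C * (1 / √(q : ℝ)) := by gcongr; exact inv_le_inv_sqrt hq
    _ = C / √(q : ℝ) := by ring

/-- Replacing the limits `B`, `β` by their approximations changes the logarithm of the conditionally
convergent product by `O(q^{-1/2})`. For `j` beyond a small multiple of `q` the fractional parts
may differ by about `1`, and the tails are estimated separately by summation by parts. -/
theorem exists_abs_sum_log_displacement_sub_le (hβ : IsBadlyApproximable c β) (hκ : 0 ≤ κ)
    (hB0 : 0 < B) (hB1 : B ≤ 1) : ∃ (K : ℝ) (q₀ : ℕ), 0 ≤ K ∧ ∀ (q : ℕ) (γ B' : ℝ), q₀ ≤ q →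
      0 < q → 0 < B' → B' ≤ 1 → |B' - B| ≤ κ / (q : ℝ) ^ 2 → |γ - β| ≤ κ / (q : ℝ) ^ 2 →
      |∑ j ∈ Finset.Ioc 0 ((q - 1) / 2), (Real.log (1 - displacement B' γ j) -
        Real.log (1 - displacement B β j))| ≤ K / √(q : ℝ) := by
  have hc := hβ.1
  set D := 4 * (2 * κ + 3) / c with hD
  have hD0 : 0 < D := by positivity
  -- for `j ≤ l q` no integer separates `jγ` from `jβ`
  obtain ⟨l, hl0, hl1, hl2⟩ : ∃ l : ℝ, 0 < l ∧ l ≤ 1 / 4 ∧ κ * l ^ 2 < c := by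
    refine ⟨min (1 / 4) (c / (κ + 1)), by positivity, min_le_left _ _, ?_⟩
    have h1 := min_le_left (1 / 4) (c / (κ + 1))
    have h2 := min_le_right (1 / 4) (c / (κ + 1))
    rw [le_div_iff₀ (by positivity)] at h2
    have h3 : 0 < min (1 / 4) (c / (κ + 1)) := by positivity
    set m := min (1 / 4) (c / (κ + 1))
    nlinarith [mul_nonneg hκ h3.le]
  set K₁ := 2 * κ + κ / c with hK₁
  have hK₁0 : 0 ≤ K₁ := by positivity
  set L := √(l / 2) with hL
  have hL0 : 0 < L := Real.sqrt_pos.2 (by positivity)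
  refine ⟨2 * K₁ + (κ + κ + 6 * D / L), ⌈2 / l⌉₊ + 4, by positivity,
    fun q γ B' hq hq0 hB'0 hB'1 hBB hγ => ?_⟩
  have hq' : (0 : ℝ) < q := by exact_mod_cast hq0
  have hql : 2 / l ≤ q := (Nat.le_ceil _).trans (by exact_mod_cast (by omega))
  rw [div_le_iff₀ hl0] at hql
  set h := (q - 1) / 2 with hh
  have hhq : h ≤ q := by omega
  have hq4 : 4 ≤ q := by omega
  set M := ⌊l * q⌋₊ with hM
  have hM1 : (M : ℝ) ≤ l * q := Nat.floor_le (by positivity)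
  have hM2 : l * q / 2 ≤ M := by
    have := Nat.lt_floor_add_one (l * q)
    rw [← hM] at this
    linarith
  have hM0 : 0 < M := by
    have : (0 : ℝ) < M := by linarith
    exact_mod_cast this
  have hMh : M ≤ h := by
    have h1 : (4 * M : ℝ) ≤ q := by nlinarith
    have h2 : 4 * M ≤ q := by exact_mod_cast h1
    omega
  have hpos : ∀ j ∈ Finset.Ioc 0 h, 0 < j := fun j hj => (Finset.mem_Ioc.1 hj).1
  -- the quadratic part
  have hquad : |∑ j ∈ Finset.Ioc 0 h, (Real.log (1 - displacement B' γ j) -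
      Real.log (1 - displacement B β j) + (displacement B' γ j - displacement B β j))| ≤
      2 * K₁ / √(q : ℝ) := by
    refine (Finset.abs_sum_le_sum_abs _ _).trans (le_trans (Finset.sum_le_sum fun j hj => ?_)
      (sum_Ioc_const_div_sq_le (by positivity) hq0 hhq))
    have hj0 := hpos j hj
    have hj' : (0 : ℝ) < j := by exact_mod_cast hj0
    refine (abs_log_one_sub_sub_log_le (abs_displacement_le_half hB0 hB1 β hj0)
      (abs_displacement_le_half hB'0 hB'1 γ hj0)).trans ?_
    have h1 := abs_displacement_le hB0 hB1 β hj0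
    have h2 := abs_displacement_le hB'0 hB'1 γ hj0
    have h3 : |displacement B' γ j - displacement B β j| ≤ K₁ * j / (q : ℝ) ^ 2 := by
      have h4 := abs_mul_fract_sub_le hβ hκ hB0 hB1 hBB hγ hq0 hj0
      rw [show displacement B' γ j - displacement B β j = (B' * (Int.fract (j * γ) - 1 / 2) -
        B * (Int.fract (j * β) - 1 / 2)) / j by rw [displacement, displacement]; ring, abs_div,
        Nat.abs_cast, div_le_iff₀ hj']
      refine h4.trans (le_of_eq ?_)
      ring
    calc 2 * (|displacement B β j| + |displacement B' γ j|) *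
          |displacement B' γ j - displacement B β j|
        ≤ 2 * (1 / 2 / j + 1 / 2 / j) * (K₁ * j / (q : ℝ) ^ 2) := by gcongr
      _ = 2 * K₁ / (q : ℝ) ^ 2 := by field_simp; ring
  -- the linear part
  have hlin1 : |∑ j ∈ Finset.Ioc 0 h, (B' - B) * ((Int.fract (j * γ) - 1 / 2) / j)| ≤
      κ / √(q : ℝ) := by
    refine (Finset.abs_sum_le_sum_abs _ _).trans (le_trans (Finset.sum_le_sum fun j hj => ?_)
      (sum_Ioc_const_div_sq_le hκ hq0 hhq))
    have hj' : (1 : ℝ) ≤ j := by exact_mod_cast hpos j hj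
    rw [abs_mul, abs_div, Nat.abs_cast]
    have h1 : |Int.fract (j * γ) - 1 / 2| / j ≤ 1 := by
      rw [div_le_one (by linarith)]
      linarith [abs_fract_sub_half_le (j * γ)]
    calc |B' - B| * (|Int.fract (j * γ) - 1 / 2| / j) ≤ κ / (q : ℝ) ^ 2 * 1 :=
          mul_le_mul hBB h1 (by positivity) (by positivity)
      _ = _ := mul_one _
  have hlin2 : |∑ j ∈ Finset.Ioc 0 M, ((Int.fract (j * γ) - 1 / 2) / j -
      (Int.fract (j * β) - 1 / 2) / j)| ≤ κ / √(q : ℝ) := by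
    refine (Finset.abs_sum_le_sum_abs _ _).trans (le_trans (Finset.sum_le_sum fun j hj => ?_)
      (sum_Ioc_const_div_sq_le hκ hq0 (hMh.trans hhq)))
    rw [Finset.mem_Ioc] at hj
    have hj' : (0 : ℝ) < j := by exact_mod_cast hj.1
    have hjM : (j : ℝ) ≤ l * q := le_trans (by exact_mod_cast hj.2) hM1
    have h1 := abs_fract_sub_fract_le_of_lt hβ hγ hq0 hj.1 (by
      calc κ * (j : ℝ) ^ 2 ≤ κ * (l * q) ^ 2 := by gcongr
        _ = κ * l ^ 2 * (q : ℝ) ^ 2 := by ring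
        _ < c * (q : ℝ) ^ 2 := by gcongr)
    rw [← sub_div, sub_sub_sub_cancel_right, abs_div, Nat.abs_cast, div_le_iff₀ hj']
    refine h1.trans (le_of_eq ?_)
    ring
  have hsqM : 3 * D / √(M : ℝ) ≤ 3 * D / L / √(q : ℝ) := by
    rw [div_div]
    apply div_le_div_of_nonneg_left (by positivity) (by positivity)
    rw [hL, ← Real.sqrt_mul (by positivity)]
    apply Real.sqrt_le_sqrt
    linarith
  have hlin3 : |∑ j ∈ Finset.Ioc M h, (Int.fract (j * γ) - 1 / 2) / j| ≤
      3 * D / L / √(q : ℝ) :=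
    (abs_sum_Ioc_div_le hM0 hMh fun n hn =>
      abs_sum_Ioc_fract_le hβ hκ hγ (hn.trans hhq)).trans hsqM
  have hlin4 : |∑ j ∈ Finset.Ioc M h, (Int.fract (j * β) - 1 / 2) / j| ≤
      3 * D / L / √(q : ℝ) :=
    (abs_sum_Ioc_div_le hM0 hMh fun n _ => abs_sum_Ioc_fract_self_le hβ hκ n).trans hsqM
  have hlin5 : |B * ∑ j ∈ Finset.Ioc 0 h, ((Int.fract (j * γ) - 1 / 2) / j -
      (Int.fract (j * β) - 1 / 2) / j)| ≤ (κ + 6 * D / L) / √(q : ℝ) := by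
    rw [abs_mul, abs_of_pos hB0]
    refine (mul_le_of_le_one_left (abs_nonneg _) hB1).trans ?_
    have htail : |∑ j ∈ Finset.Ioc M h, ((Int.fract (j * γ) - 1 / 2) / j -
        (Int.fract (j * β) - 1 / 2) / j)| ≤ 3 * D / L / √(q : ℝ) + 3 * D / L / √(q : ℝ) := by
      rw [Finset.sum_sub_distrib]
      exact (abs_sub _ _).trans (add_le_add hlin3 hlin4)
    rw [← Finset.sum_Ioc_consecutive _ (Nat.zero_le M) hMh]
    refine (abs_add_le _ _).trans ((add_le_add hlin2 htail).trans (le_of_eq ?_))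
    ring
  have hsplit : ∑ j ∈ Finset.Ioc 0 h, (Real.log (1 - displacement B' γ j) -
      Real.log (1 - displacement B β j)) =
      ∑ j ∈ Finset.Ioc 0 h, (Real.log (1 - displacement B' γ j) -
        Real.log (1 - displacement B β j) + (displacement B' γ j - displacement B β j)) -
      (∑ j ∈ Finset.Ioc 0 h, (B' - B) * ((Int.fract (j * γ) - 1 / 2) / j) +
        B * ∑ j ∈ Finset.Ioc 0 h, ((Int.fract (j * γ) - 1 / 2) / j -
          (Int.fract (j * β) - 1 / 2) / j)) := by
    rw [Finset.mul_sum, ← Finset.sum_add_distrib, ← Finset.sum_sub_distrib]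
    refine Finset.sum_congr rfl fun j _ => ?_
    rw [displacement, displacement]
    ring
  rw [hsplit]
  refine (abs_sub _ _).trans ((add_le_add hquad
    ((abs_add_le _ _).trans (add_le_add hlin1 hlin5))).trans (le_of_eq ?_))
  ring

/-- Replacing the linear functions by sines changes the logarithm of the product by
`O(q^{-1/2})`: the difference is, up to `O(1/q)`, a sum of the terms `{jγ} - 1/2` with bounded
monotone coefficients `O(1/q)`. -/
theorem exists_abs_sum_log_sin_sub_le (hβ : IsBadlyApproximable c β) (hκ : 0 ≤ κ) :
    ∃ (K : ℝ) (q₀ : ℕ), 0 ≤ K ∧ ∀ (q : ℕ) (γ B' : ℝ), q₀ ≤ q →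
      0 < q → 0 < B' → B' ≤ 1 → |γ - β| ≤ κ / (q : ℝ) ^ 2 →
      |∑ j ∈ Finset.Ioc 0 ((q - 1) / 2),
        (Real.log (Real.sin (perturbedAngle q B' γ j) / Real.sin (Real.pi * j / q)) -
          Real.log (1 - displacement B' γ j))| ≤ K / √(q : ℝ) := by
  have hc := hβ.1
  set D := 4 * (2 * κ + 3) / c with hD
  have hD0 : 0 < D := by positivity
  refine ⟨44 + 8 * D, 20, by positivity, fun q γ B' hq hq0 hB'0 hB'1 hγ => ?_⟩
  have hpi := Real.pi_pos
  have hpi4 := Real.pi_le_four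
  have hq' : (0 : ℝ) < q := by exact_mod_cast hq0
  have hq20 : (20 : ℝ) ≤ q := by exact_mod_cast hq
  set h := (q - 1) / 2 with hh
  have hhq : h ≤ q := by omega
  have hh2 : (2 * h : ℝ) ≤ q := by exact_mod_cast (by omega : 2 * h ≤ q)
  have hθ : ∀ i : ℕ, i ≤ h → Real.pi * i / q ≤ Real.pi / 2 := by
    intro i hi
    have : (i : ℝ) ≤ h := by exact_mod_cast hi
    rw [div_le_div_iff₀ hq' two_pos]
    nlinarith
  have hθ0 : ∀ i : ℕ, 0 < i → 0 < Real.pi * i / q := by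
    intro i hi
    have : (0 : ℝ) < i := by exact_mod_cast hi
    positivity
  have hterm : ∀ j ∈ Finset.Ioc 0 h,
      |Real.log (Real.sin (perturbedAngle q B' γ j) / Real.sin (Real.pi * j / q)) -
        Real.log (1 - displacement B' γ j) - (Int.fract (j * γ) - 1 / 2) *
        (Real.pi * B' / q * invSubCot (Real.pi * j / q))| ≤ 44 / (q : ℝ) ^ 2 := by
    intro j hj
    rw [Finset.mem_Ioc] at hj
    have hj' : (1 : ℝ) ≤ j := by exact_mod_cast hj.1
    set b := Int.fract (j * γ) - 1 / 2 with hb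
    have hb2 : |b| ≤ 1 / 2 := abs_fract_sub_half_le _
    have hε : |Real.pi * B' * b / q| ≤ Real.pi * (1 / 2) / q := by
      rw [abs_div, abs_mul, abs_mul, abs_of_pos hpi, abs_of_pos hB'0, abs_of_pos hq']
      apply div_le_div_of_nonneg_right _ hq'.le
      nlinarith [abs_nonneg b, mul_nonneg hpi.le (abs_nonneg b)]
    have h1 := abs_log_sin_ratio_sub_le (hθ0 j hj.1) (hθ j hj.2) (ε := Real.pi * B' * b / q)
      (hε.trans (by
        rw [div_div, div_le_div_iff₀ hq' (by positivity)]
        have : Real.pi * q ≤ Real.pi * q * j := le_mul_of_one_le_right (by positivity) hj'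
        linarith))
      (hε.trans (by rw [div_le_div_iff₀ hq' (by norm_num)]; linarith))
    have e1 : Real.pi * j / q - Real.pi * B' * b / q = perturbedAngle q B' γ j := by
      rw [perturbedAngle, hb]; ring
    have e2 : Real.pi * B' * b / q / (Real.pi * j / q) = displacement B' γ j := by
      rw [displacement, ← hb]; field_simp
    have e3 : invSubCot (Real.pi * j / q) * (Real.pi * B' * b / q) =
        b * (Real.pi * B' / q * invSubCot (Real.pi * j / q)) := by ring
    rw [e1, e2, e3] at h1
    refine h1.trans ?_
    rw [← sq_abs]
    calc 11 * |Real.pi * B' * b / q| ^ 2 ≤ 11 * (2 / q) ^ 2 := by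
          gcongr
          refine hε.trans ?_
          gcongr
          linarith
      _ = 44 / (q : ℝ) ^ 2 := by ring
  have h1 : |∑ j ∈ Finset.Ioc 0 h,
      (Real.log (Real.sin (perturbedAngle q B' γ j) / Real.sin (Real.pi * j / q)) -
        Real.log (1 - displacement B' γ j) - (Int.fract (j * γ) - 1 / 2) *
        (Real.pi * B' / q * invSubCot (Real.pi * j / q)))| ≤ 44 / √(q : ℝ) :=
    (Finset.abs_sum_le_sum_abs _ _).trans ((Finset.sum_le_sum hterm).trans
      (sum_Ioc_const_div_sq_le (by norm_num) hq0 hhq))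
  have hcoef : 0 ≤ Real.pi * B' / q := by positivity
  have h2 : |∑ j ∈ Finset.Ioc 0 h, (Int.fract (j * γ) - 1 / 2) *
      (Real.pi * B' / q * invSubCot (Real.pi * j / q))| ≤ 2 * D * √(h : ℝ) * (4 / q) := by
    refine abs_sum_Ioc_mul_le_of_monotone
      (φ := fun j : ℕ => Real.pi * B' / q * invSubCot (Real.pi * j / q)) hD0.le
      (fun n hn => abs_sum_Ioc_fract_le hβ hκ hγ (hn.trans hhq)) ?_ (fun i hi => ?_) ?_
    · simp [invSubCot]
    · refine mul_le_mul_of_nonneg_left ?_ hcoef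
      rcases Nat.eq_zero_or_pos i with h0 | h0
      · rw [h0]
        have := invSubCot_nonneg (hθ0 (0 + 1) (by omega)) (hθ (0 + 1) (by omega))
        simpa [invSubCot] using this
      · refine invSubCot_mono (hθ0 i h0) ?_ (hθ (i + 1) (by omega))
        gcongr
        omega
    · rcases Nat.eq_zero_or_pos h with h0 | h0
      · rw [h0]; simp [invSubCot]; positivity
      · have e1 := invSubCot_le (hθ0 h h0) (hθ h le_rfl)
        have e2 := hθ h le_rfl
        have e3 := invSubCot_nonneg (hθ0 h h0) (hθ h le_rfl)
        have e4 : invSubCot (Real.pi * h / q) ≤ 1 := by linarith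
        calc Real.pi * B' / q * invSubCot (Real.pi * h / q) ≤ 4 * 1 / q * 1 := by gcongr
          _ = 4 / q := by ring
  have h3 : 2 * D * √(h : ℝ) * (4 / q) ≤ 8 * D / √(q : ℝ) := by
    have e1 : √(h : ℝ) ≤ √(q : ℝ) := Real.sqrt_le_sqrt (by exact_mod_cast hhq)
    have e2 : √(q : ℝ) * √(q : ℝ) = q := Real.mul_self_sqrt hq'.le
    have e3 : 0 < √(q : ℝ) := Real.sqrt_pos.2 hq'
    calc 2 * D * √(h : ℝ) * (4 / q) ≤ 2 * D * √(q : ℝ) * (4 / q) := by gcongr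
      _ = 8 * D * (√(q : ℝ) / (√(q : ℝ) * √(q : ℝ))) := by rw [e2]; ring
      _ = 8 * D / √(q : ℝ) := by field_simp
  rw [Finset.sum_sub_distrib] at h1
  have h4 := abs_add_le (∑ j ∈ Finset.Ioc 0 h,
      (Real.log (Real.sin (perturbedAngle q B' γ j) / Real.sin (Real.pi * j / q)) -
        Real.log (1 - displacement B' γ j)) - ∑ j ∈ Finset.Ioc 0 h, (Int.fract (j * γ) - 1 / 2) *
        (Real.pi * B' / q * invSubCot (Real.pi * j / q)))
    (∑ j ∈ Finset.Ioc 0 h, (Int.fract (j * γ) - 1 / 2) *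
        (Real.pi * B' / q * invSubCot (Real.pi * j / q)))
  rw [sub_add_cancel] at h4
  rw [add_div]
  linarith

/-- The finite products of sine ratios converge to the conditionally convergent product, with the
rate `O(q^{-1/2})`. -/
theorem exists_abs_sum_log_sin_sub_limit_le (hβ : IsBadlyApproximable c β) (hκ : 0 ≤ κ)
    (hB0 : 0 < B) (hB1 : B ≤ 1) {Λ K₀ : ℝ} (hK₀ : 0 ≤ K₀) (hΛ : ∀ N : ℕ, 0 < N →
      |∑ j ∈ Finset.Ioc 0 N, Real.log (1 - displacement B β j) - Λ| ≤ K₀ / √(N : ℝ)) :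
    ∃ (K : ℝ) (q₀ : ℕ), 0 ≤ K ∧ ∀ (q : ℕ) (γ B' : ℝ), q₀ ≤ q →
      0 < B' → B' ≤ 1 → |B' - B| ≤ κ / (q : ℝ) ^ 2 → |γ - β| ≤ κ / (q : ℝ) ^ 2 →
      |∑ j ∈ Finset.Ioc 0 ((q - 1) / 2),
        Real.log (Real.sin (perturbedAngle q B' γ j) / Real.sin (Real.pi * j / q)) - Λ| ≤
        K / √(q : ℝ) := by
  obtain ⟨K₁, q₁, hK₁, h₁⟩ := exists_abs_sum_log_displacement_sub_le hβ hκ hB0 hB1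
  obtain ⟨K₂, q₂, hK₂, h₂⟩ := exists_abs_sum_log_sin_sub_le hβ hκ
  refine ⟨K₂ + (K₁ + 2 * K₀), q₁ + q₂ + 4, by positivity,
    fun q γ B' hq hB'0 hB'1 hBB hγ => ?_⟩
  have e1 := h₁ q γ B' (by omega) (by omega) hB'0 hB'1 hBB hγ
  have e2 := h₂ q γ B' (by omega) (by omega) hB'0 hB'1 hγ
  set h := (q - 1) / 2 with hh
  have hh0 : 0 < h := by omega
  have e3 := hΛ h hh0
  have e4 : K₀ / √(h : ℝ) ≤ 2 * K₀ / √(q : ℝ) := by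
    have hq0 : (0 : ℝ) < q := by exact_mod_cast (by omega : 0 < q)
    have hh0' : (0 : ℝ) < h := by exact_mod_cast hh0
    have e5 : √(q : ℝ) ≤ 2 * √(h : ℝ) := by
      have e6 : (q : ℝ) ≤ 4 * h := by exact_mod_cast (by omega : q ≤ 4 * h)
      rw [show (2 : ℝ) = √4 by rw [show (4 : ℝ) = 2 ^ 2 by norm_num]; simp,
        ← Real.sqrt_mul (by norm_num)]
      exact Real.sqrt_le_sqrt e6
    rw [div_le_div_iff₀ (Real.sqrt_pos.2 hh0') (Real.sqrt_pos.2 hq0)]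
    nlinarith
  rw [Finset.sum_sub_distrib] at e1 e2
  rw [add_div, add_div]
  rw [abs_le] at *
  constructor <;> linarith [e1.1, e1.2, e2.1, e2.2, e3.1, e3.2]

end Comparison

/-! ### The limit function -/

/-- The `j`-th node `j - B ({jγ} - 1/2)`: the `j`-th factor of the limit product vanishes where
`|x + B / 2|` equals the `j`-th node. -/
noncomputable def node (B γ : ℝ) (j : ℕ) : ℝ := j - B * (Int.fract (j * γ) - 1 / 2)

theorem abs_node_sub_le {B : ℝ} (hB0 : 0 < B) (hB1 : B ≤ 1) (γ : ℝ) (j : ℕ) :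
    |node B γ j - j| ≤ 1 / 2 := by
  rw [node, sub_sub_cancel_left, abs_neg, abs_mul, abs_of_pos hB0]
  have := abs_fract_sub_half_le (j * γ)
  nlinarith [abs_nonneg (Int.fract (j * γ) - 1 / 2)]

theorem half_le_node {B : ℝ} (hB0 : 0 < B) (hB1 : B ≤ 1) (γ : ℝ) {j : ℕ}
    (hj : 0 < j) : (j : ℝ) / 2 ≤ node B γ j := by
  have h1 := (abs_le.1 (abs_node_sub_le hB0 hB1 γ j)).1
  have h2 : (1 : ℝ) ≤ j := by exact_mod_cast hj
  linarith

theorem node_pos {B : ℝ} (hB0 : 0 < B) (hB1 : B ≤ 1) (γ : ℝ) {j : ℕ}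
    (hj : 0 < j) : 0 < node B γ j := by
  have h2 : (0 : ℝ) < j := by exact_mod_cast hj
  linarith [half_le_node hB0 hB1 γ hj]

theorem sq_div_node_le {B : ℝ} (hB0 : 0 < B) (hB1 : B ≤ 1) (γ : ℝ) {j : ℕ}
    (hj : 0 < j) (y : ℝ) :
    (y / node B γ j) ^ 2 ≤ 4 * y ^ 2 / (j : ℝ) ^ 2 := by
  have h2 : (0 : ℝ) < j := by exact_mod_cast hj
  have h3 := half_le_node hB0 hB1 γ hj
  rw [div_pow, show 4 * y ^ 2 / (j : ℝ) ^ 2 = y ^ 2 / ((j : ℝ) / 2) ^ 2 by field_simp; ring]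
  gcongr

theorem one_sub_displacement_eq (B γ : ℝ) {j : ℕ} (hj : 0 < j) :
    1 - displacement B γ j = node B γ j / j := by
  have h2 : (j : ℝ) ≠ 0 := by exact_mod_cast hj.ne'
  rw [displacement, node]
  field_simp

/-- Separation of the part independent of `x`, responsible for the conditional convergence, from an
absolutely convergent part. -/
theorem limitFactor_eq {B : ℝ} (hB0 : 0 < B) (hB1 : B ≤ 1) (γ : ℝ) {j : ℕ}
    (hj : 0 < j) (x : ℝ) : limitFactor B γ j x =
    (1 - displacement B γ j) ^ 2 * |1 - ((x + B / 2) / node B γ j) ^ 2| := by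
  have h2 : (j : ℝ) ≠ 0 := by exact_mod_cast hj.ne'
  have h3 := (node_pos hB0 hB1 γ hj).ne'
  have h4 := one_sub_displacement_eq B γ hj
  rw [← abs_of_nonneg (sq_nonneg (1 - displacement B γ j)), ← abs_mul, limitFactor]
  congr 1
  rw [← displacement, mul_sub, h4]
  field_simp

theorem prod_Ioc_limitFactor_eq {B : ℝ} (hB0 : 0 < B) (hB1 : B ≤ 1) (β x : ℝ) (M N : ℕ) :
    ∏ n ∈ Finset.Ioc M N, limitFactor B β n x =
      Real.exp (2 * ∑ n ∈ Finset.Ioc M N, Real.log (1 - displacement B β n)) *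
        |∏ n ∈ Finset.Ioc M N, (1 - ((x + B / 2) / node B β n) ^ 2)| := by
  rw [Finset.mul_sum, Real.exp_sum, Finset.abs_prod, ← Finset.prod_mul_distrib]
  refine Finset.prod_congr rfl fun n hn => ?_
  have hn0 : 0 < n := by rw [Finset.mem_Ioc] at hn; omega
  have h1 : 0 < 1 - displacement B β n := by
    have := (abs_le.1 (abs_displacement_le_half hB0 hB1 β hn0)).2
    linarith
  rw [limitFactor_eq hB0 hB1 β hn0, two_mul, Real.exp_add, Real.exp_log h1, sq]

theorem abs_prod_sub_prod_le {ι : Type*} (s : Finset ι) {a b : ι → ℝ} {R : ℝ} (hR : 1 ≤ R)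
    (ha : ∀ i ∈ s, |a i| ≤ R) (hb : ∀ i ∈ s, |b i| ≤ R) :
    |∏ i ∈ s, a i - ∏ i ∈ s, b i| ≤ R ^ s.card * ∑ i ∈ s, |a i - b i| := by
  classical
  induction s using Finset.induction_on with
  | empty => simp
  | insert i s hi ih =>
    rw [Finset.prod_insert hi, Finset.prod_insert hi, Finset.sum_insert hi,
      Finset.card_insert_of_notMem hi]
    have h1 := ih (fun j hj => ha j (Finset.mem_insert_of_mem hj))
      (fun j hj => hb j (Finset.mem_insert_of_mem hj))
    have h2 : |∏ j ∈ s, b j| ≤ R ^ s.card := by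
      rw [Finset.abs_prod, ← Finset.prod_const]
      exact Finset.prod_le_prod (fun _ _ => abs_nonneg _)
        (fun j hj => hb j (Finset.mem_insert_of_mem hj))
    have h3 := ha i (Finset.mem_insert_self i s)
    have h4 : a i * ∏ j ∈ s, a j - b i * ∏ j ∈ s, b j =
        a i * (∏ j ∈ s, a j - ∏ j ∈ s, b j) + (a i - b i) * ∏ j ∈ s, b j := by ring
    have hS : 0 ≤ ∑ j ∈ s, |a j - b j| := Finset.sum_nonneg fun _ _ => abs_nonneg _
    rw [h4]
    refine (abs_add_le _ _).trans ?_
    rw [abs_mul, abs_mul]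
    calc |a i| * |∏ j ∈ s, a j - ∏ j ∈ s, b j| + |a i - b i| * |∏ j ∈ s, b j|
        ≤ R * (R ^ s.card * ∑ j ∈ s, |a j - b j|) + |a i - b i| * R ^ s.card := by gcongr
      _ ≤ R * (R ^ s.card * ∑ j ∈ s, |a j - b j|) + |a i - b i| * (R ^ s.card * R) := by
        gcongr
        exact le_mul_of_one_le_right (by positivity) hR
      _ = _ := by ring

theorem abs_prod_sub_prod_le_sum {ι : Type*} (s : Finset ι) {a b : ι → ℝ}
    (ha : ∀ i ∈ s, |a i| ≤ 1) (hb : ∀ i ∈ s, |b i| ≤ 1) :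
    |∏ i ∈ s, a i - ∏ i ∈ s, b i| ≤ ∑ i ∈ s, |a i - b i| := by
  simpa using abs_prod_sub_prod_le s le_rfl ha hb

/-- Tails of a product `∏ (1 - t_j)` with `t_j = O(j⁻²)`. -/
theorem exists_tail_product {t : ℕ → ℝ} {τ : ℝ} {J : ℕ} (hJ : 0 < J) (hτ : 2 * τ ≤ J)
    (ht0 : ∀ j, J < j → 0 ≤ t j) (ht1 : ∀ j, J < j → t j ≤ τ / (j : ℝ) ^ 2) :
    ∃ L : ℝ, 1 / 2 ≤ L ∧ L ≤ 1 ∧ ∀ N, J ≤ N → |∏ j ∈ Finset.Ioc J N, (1 - t j) - L| ≤ τ / N := by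
  have hJ' : (1 : ℝ) ≤ J := by exact_mod_cast hJ
  have hτ0 : 0 ≤ τ := by
    have h1 := (ht0 (J + 1) (by omega)).trans (ht1 (J + 1) (by omega))
    by_contra hneg
    push Not at hneg
    exact absurd h1 (not_le.2 (div_neg_of_neg_of_pos hneg (by positivity)))
  have hfac : ∀ j, J < j → 0 ≤ 1 - t j ∧ 1 - t j ≤ 1 := by
    intro j hj
    have hj' : (J : ℝ) < j := by exact_mod_cast hj
    refine ⟨?_, by linarith [ht0 j hj]⟩
    have : τ / (j : ℝ) ^ 2 ≤ 1 := by rw [div_le_one (by nlinarith)]; nlinarith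
    linarith [ht1 j hj]
  have habs : ∀ j, J < j → |1 - t j| ≤ 1 := fun j hj => by
    rw [abs_of_nonneg (hfac j hj).1]; exact (hfac j hj).2
  let E : ℕ → ℝ := fun N => ∏ j ∈ Finset.Ioc J N, (1 - t j)
  have hE : ∀ N, |E N| ≤ 1 := by
    intro N
    simp only [E]
    rw [Finset.abs_prod]
    exact Finset.prod_le_one (fun _ _ => abs_nonneg _)
      fun j hj => habs j (Finset.mem_Ioc.1 hj).1
  have hdiff : ∀ M N, J ≤ M → M ≤ N → |E M - E N| ≤ τ / M := by
    intro M N hJM hMN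
    have hM : M ≠ 0 := by omega
    have h1 : E N = E M * ∏ j ∈ Finset.Ioc M N, (1 - t j) :=
      (Finset.prod_Ioc_consecutive _ hJM hMN).symm
    have h2 : |1 - ∏ j ∈ Finset.Ioc M N, (1 - t j)| ≤ τ / M := by
      have h3 := abs_prod_sub_prod_le_sum (Finset.Ioc M N) (a := fun _ => 1)
        (b := fun j => 1 - t j) (fun _ _ => by simp)
        (fun j hj => habs j (by rw [Finset.mem_Ioc] at hj; omega))
      rw [Finset.prod_const_one] at h3
      refine h3.trans ?_
      calc ∑ j ∈ Finset.Ioc M N, |1 - (1 - t j)| ≤ ∑ j ∈ Finset.Ioc M N, τ * ((j : ℝ) ^ 2)⁻¹ := by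
            refine Finset.sum_le_sum fun j hj => ?_
            have hj' : J < j := by rw [Finset.mem_Ioc] at hj; omega
            rw [sub_sub_cancel, abs_of_nonneg (ht0 j hj')]
            exact ht1 j hj'
        _ ≤ τ * ((M : ℝ)⁻¹ - (N : ℝ)⁻¹) := by
            rw [← Finset.mul_sum]
            exact mul_le_mul_of_nonneg_left (sum_Ioc_inv_sq_le_sub hM hMN) hτ0
        _ ≤ τ * (M : ℝ)⁻¹ := by
            apply mul_le_mul_of_nonneg_left _ hτ0
            have : (0 : ℝ) ≤ (N : ℝ)⁻¹ := by positivity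
            linarith
    rw [h1, show E M - E M * ∏ j ∈ Finset.Ioc M N, (1 - t j) =
      E M * (1 - ∏ j ∈ Finset.Ioc M N, (1 - t j)) by ring, abs_mul]
    exact (mul_le_of_le_one_left (abs_nonneg _) (hE M)).trans h2
  have hlim0 : Tendsto (fun n : ℕ => τ / ((n + J : ℕ) : ℝ)) atTop (𝓝 0) :=
    Tendsto.div_atTop tendsto_const_nhds
      (tendsto_natCast_atTop_atTop.comp (tendsto_add_atTop_nat J))
  have hcau : CauchySeq fun n => E (n + J) :=
    cauchySeq_of_le_tendsto_0' _ (fun n m hnm => hdiff (n + J) (m + J) (by omega) (by omega)) hlim0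
  obtain ⟨L, hL⟩ := cauchySeq_tendsto_of_complete hcau
  have hL' : Tendsto E atTop (𝓝 L) := (tendsto_add_atTop_iff_nat J).1 hL
  have hb : ∀ N, J ≤ N → |E N - L| ≤ τ / N := by
    intro N hN
    have h1 : Tendsto (fun n => |E N - E n|) atTop (𝓝 |E N - L|) :=
      (tendsto_const_nhds.sub hL').abs
    exact le_of_tendsto h1 (eventually_atTop.2 ⟨N, fun n hn => hdiff N n hN hn⟩)
  refine ⟨L, ?_, le_of_tendsto hL' (Eventually.of_forall fun n => (abs_le.1 (hE n)).2), hb⟩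
  have h1 := hb J le_rfl
  have h2 : E J = 1 := by simp [E]
  have h3 : τ / J ≤ 1 / 2 := by rw [div_le_div_iff₀ (by linarith) (by norm_num)]; linarith
  rw [h2] at h1
  linarith [(abs_le.1 h1).2]

/-- The unconditionally convergent part of the limit product is the restriction to `ℝ` of an entire
function, and hence continuously differentiable. -/
theorem exists_contDiff_product {B : ℝ} (hB0 : 0 < B) (hB1 : B ≤ 1) (β : ℝ) :
    ∃ F : ℝ → ℝ, ContDiff ℝ 1 F ∧ ∀ x, Tendsto (fun N : ℕ =>
      ∏ j ∈ Finset.Ioc 0 N, (1 - ((x + B / 2) / node B β j) ^ 2)) atTop (𝓝 (F x)) := by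
  let f : ℕ → ℂ → ℂ := fun n z => -((z + (B / 2 : ℝ)) / (node B β (n + 1) : ℝ)) ^ 2
  have hprod : ∀ R : ℝ, HasProdLocallyUniformlyOn (fun n z => 1 + f n z)
      (fun z => ∏' n, (1 + f n z)) (Metric.ball 0 R) := by
    intro R
    have hu : Summable fun n : ℕ => 4 * (R + 1) ^ 2 * (((n + 1 : ℕ) : ℝ) ^ 2)⁻¹ :=
      (((summable_nat_add_iff 1).2 (Real.summable_nat_pow_inv.2 one_lt_two))).mul_left _
    refine Summable.hasProdLocallyUniformlyOn_nat_one_add Metric.isOpen_ball hu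
      (Eventually.of_forall fun n z hz => ?_) fun n => ?_
    · rw [mem_ball_zero_iff] at hz
      have h1 : ‖z + ((B / 2 : ℝ) : ℂ)‖ ≤ R + 1 := by
        refine (norm_add_le _ _).trans ?_
        rw [Complex.norm_real, Real.norm_eq_abs, abs_of_pos (by linarith)]
        linarith
      have h2 : ((n + 1 : ℕ) : ℝ) / 2 ≤ node B β (n + 1) := half_le_node hB0 hB1 β (Nat.succ_pos n)
      have h4 : 0 < node B β (n + 1) := node_pos hB0 hB1 β (Nat.succ_pos n)
      have h3 : (0 : ℝ) < ((n + 1 : ℕ) : ℝ) := by positivity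
      simp only [f]
      rw [norm_neg, norm_pow, norm_div, Complex.norm_real, Real.norm_eq_abs,
        abs_of_pos h4,
        show 4 * (R + 1) ^ 2 * (((n + 1 : ℕ) : ℝ) ^ 2)⁻¹ =
          ((R + 1) / (((n + 1 : ℕ) : ℝ) / 2)) ^ 2 by field_simp; ring]
      gcongr
      exact (norm_nonneg _).trans h1
    · simp only [f]
      fun_prop
  let Fc : ℂ → ℂ := fun z => ∏' n, (1 + f n z)
  have hdiff : Differentiable ℂ Fc := by
    intro z
    have h1 : DifferentiableOn ℂ Fc (Metric.ball 0 (‖z‖ + 1)) := by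
      refine (hprod (‖z‖ + 1)).tendstoLocallyUniformlyOn_finsetRange.differentiableOn
        (Eventually.of_forall fun N => ?_) Metric.isOpen_ball
      simp only [f]
      fun_prop
    exact h1.differentiableAt (Metric.isOpen_ball.mem_nhds (by simp))
  refine ⟨fun x => (Fc x).re, hdiff.contDiff.real_of_complex, fun x => ?_⟩
  have h1 : Tendsto (fun N => ∏ n ∈ Finset.range N, (1 + f n x)) atTop (𝓝 (Fc x)) :=
    ((hprod (‖(x : ℂ)‖ + 1)).hasProd (by simp)).tendsto_prod_nat
  have h2 := (Complex.continuous_re.tendsto _).comp h1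
  refine h2.congr fun N => ?_
  have h3 : ∏ n ∈ Finset.range N, (1 + f n x) =
      ((∏ j ∈ Finset.Ioc 0 N, (1 - ((x + B / 2) / node B β j) ^ 2) : ℝ) : ℂ) := by
    induction N with
    | zero => simp
    | succ N ih =>
      rw [Finset.prod_range_succ, ih, Finset.prod_Ioc_succ_top (Nat.zero_le N)]
      simp only [f]
      push_cast
      ring
  simp only [Function.comp]
  rw [h3, Complex.ofReal_re]

theorem tendstoUniformlyOn_of_abs_sub_le {f : ℕ → ℝ → ℝ} {F : ℝ → ℝ} {K : Set ℝ} {e : ℕ → ℝ}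
    (he : Tendsto e atTop (𝓝 0)) (h : ∀ᶠ N in atTop, ∀ x ∈ K, |f N x - F x| ≤ e N) :
    TendstoUniformlyOn f F atTop K := by
  rw [Metric.tendstoUniformlyOn_iff]
  intro ε hε
  filter_upwards [h, he.eventually_lt_const hε] with N h1 h2 x hx
  rw [dist_comm, Real.dist_eq]
  exact (h1 x hx).trans_lt h2

theorem Icc_one_eq_Ioc_zero (N : ℕ) : Finset.Icc 1 N = Finset.Ioc 0 N := by
  ext j; simp only [Finset.mem_Icc, Finset.mem_Ioc]; omega

theorem exists_subset_Icc_neg {K : Set ℝ} (hK : IsCompact K) :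
    ∃ X : ℝ, 0 ≤ X ∧ K ⊆ Set.Icc (-X) X := by
  obtain ⟨X, hX⟩ := hK.isBounded.subset_closedBall 0
  refine ⟨max X 0, le_max_right _ _, fun x hx => ?_⟩
  have h1 := hX hx
  rw [mem_closedBall_zero_iff, Real.norm_eq_abs] at h1
  exact abs_le.1 (h1.trans (le_max_left _ _))

/-- The displaced squares satisfy the hypotheses of `exists_tail_product` uniformly on bounded
sets. -/
theorem exists_tail_function {B : ℝ} (hB0 : 0 < B) (hB1 : B ≤ 1) (β : ℝ) {X : ℝ} {J : ℕ}
    (hJ0 : 0 < J) (hJ : 8 * (X + 1) ^ 2 ≤ J) :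
    ∃ T : ℝ → ℝ, ∀ x ∈ Set.Icc (-X) X, 1 / 2 ≤ T x ∧ T x ≤ 1 ∧ ∀ N, J ≤ N →
      |∏ j ∈ Finset.Ioc J N, (1 - ((x + B / 2) / node B β j) ^ 2) - T x| ≤
        4 * (X + 1) ^ 2 / N := by
  have h : ∀ x ∈ Set.Icc (-X) X, ∃ L : ℝ, 1 / 2 ≤ L ∧ L ≤ 1 ∧ ∀ N, J ≤ N →
      |∏ j ∈ Finset.Ioc J N, (1 - ((x + B / 2) / node B β j) ^ 2) - L| ≤
        4 * (X + 1) ^ 2 / N := by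
    intro x hx
    refine exists_tail_product hJ0 (by linarith) (fun j _ => sq_nonneg _) fun j hj => ?_
    refine (sq_div_node_le hB0 hB1 β (by omega : 0 < j) _).trans ?_
    have h1 : (x + B / 2) ^ 2 ≤ (X + 1) ^ 2 := by
      apply sq_le_sq'
      · linarith [hx.1]
      · linarith [hx.2]
    gcongr
  choose! T hT using h
  exact ⟨T, hT⟩

section LimitFunction

variable {B β Λ K₀ : ℝ} {F : ℝ → ℝ}

theorem tendsto_of_abs_sub_le_div_sqrt {u : ℕ → ℝ}
    (hu : ∀ N : ℕ, 0 < N → |u N - Λ| ≤ K₀ / √(N : ℝ)) : Tendsto u atTop (𝓝 Λ) := by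
  rw [tendsto_iff_dist_tendsto_zero]
  have h0 : Tendsto (fun N : ℕ => K₀ / √(N : ℝ)) atTop (𝓝 0) :=
    Tendsto.div_atTop tendsto_const_nhds
      (Real.tendsto_sqrt_atTop.comp tendsto_natCast_atTop_atTop)
  refine squeeze_zero' (Eventually.of_forall fun _ => dist_nonneg)
    (eventually_atTop.2 ⟨1, fun N hN => ?_⟩) h0
  rw [Real.dist_eq]
  exact hu N hN

/-- The value of the infinite product, with `exp Λ` the conditionally convergent product and `F` the
absolutely convergent one. -/
theorem limitProd_eq (hB0 : 0 < B) (hB1 : B ≤ 1)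
    (hΛ : Tendsto (fun N : ℕ => ∑ j ∈ Finset.Ioc 0 N, Real.log (1 - displacement B β j)) atTop (𝓝 Λ))
    (hF : ∀ x, Tendsto (fun N : ℕ =>
      ∏ j ∈ Finset.Ioc 0 N, (1 - ((x + B / 2) / node B β j) ^ 2)) atTop (𝓝 (F x))) (x : ℝ) :
    limitProd B β x = Real.exp (2 * Λ) * |F x| := by
  refine Tendsto.limUnder_eq ?_
  have h1 : Tendsto (fun N : ℕ => Real.exp (2 * ∑ j ∈ Finset.Ioc 0 N,
      Real.log (1 - displacement B β j)) *
      |∏ j ∈ Finset.Ioc 0 N, (1 - ((x + B / 2) / node B β j) ^ 2)|) atTop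
      (𝓝 (Real.exp (2 * Λ) * |F x|)) :=
    ((Real.continuous_exp.tendsto _).comp (hΛ.const_mul 2)).mul (hF x).abs
  refine h1.congr fun N => ?_
  rw [Icc_one_eq_Ioc_zero, prod_Ioc_limitFactor_eq hB0 hB1]

/-- The finite product over `j ≤ J` carries all the zeros of `F` in `[-X, X]`. -/
theorem eq_head_mul_tail {X : ℝ} {J : ℕ} {T : ℝ → ℝ}
    (hF : ∀ x, Tendsto (fun N : ℕ =>
      ∏ j ∈ Finset.Ioc 0 N, (1 - ((x + B / 2) / node B β j) ^ 2)) atTop (𝓝 (F x)))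
    (hT : ∀ x ∈ Set.Icc (-X) X, 1 / 2 ≤ T x ∧ T x ≤ 1 ∧ ∀ N, J ≤ N →
      |∏ j ∈ Finset.Ioc J N, (1 - ((x + B / 2) / node B β j) ^ 2) - T x| ≤
        4 * (X + 1) ^ 2 / N) {x : ℝ} (hx : x ∈ Set.Icc (-X) X) :
    F x = (∏ j ∈ Finset.Ioc 0 J, (1 - ((x + B / 2) / node B β j) ^ 2)) * T x := by
  have h1 : Tendsto (fun N : ℕ => ∏ j ∈ Finset.Ioc J N, (1 - ((x + B / 2) / node B β j) ^ 2))
      atTop (𝓝 (T x)) := by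
    rw [tendsto_iff_dist_tendsto_zero]
    have h0 : Tendsto (fun N : ℕ => 4 * (X + 1) ^ 2 / (N : ℝ)) atTop (𝓝 0) :=
      Tendsto.div_atTop tendsto_const_nhds tendsto_natCast_atTop_atTop
    refine squeeze_zero' (Eventually.of_forall fun _ => dist_nonneg)
      (eventually_atTop.2 ⟨J, fun N hN => ?_⟩) h0
    rw [Real.dist_eq]
    exact (hT x hx).2.2 N hN
  refine tendsto_nhds_unique (hF x) ((h1.const_mul _).congr' (eventually_atTop.2 ⟨J, ?_⟩))
  intro N hN
  exact Finset.prod_Ioc_consecutive _ (Nat.zero_le J) hN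

theorem prodConvergesLocallyUniformly (hB0 : 0 < B) (hB1 : B ≤ 1)
    (hΛ : Tendsto (fun N : ℕ => ∑ j ∈ Finset.Ioc 0 N, Real.log (1 - displacement B β j)) atTop (𝓝 Λ))
    (hF : ∀ x, Tendsto (fun N : ℕ =>
      ∏ j ∈ Finset.Ioc 0 N, (1 - ((x + B / 2) / node B β j) ^ 2)) atTop (𝓝 (F x))) :
    ProdConvergesLocallyUniformly (limitFactor B β) (limitProd B β) := by
  -- uniform convergence of a tail product on `[-X, X]`
  have key : ∀ X : ℝ, 0 ≤ X → ∃ (J : ℕ) (g : ℝ → ℝ) (e : ℕ → ℝ), Tendsto e atTop (𝓝 0) ∧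
      (∀ x ∈ Set.Icc (-X) X, g x ≠ 0) ∧
      (∀ x ∈ Set.Icc (-X) X, limitProd B β x =
        (∏ n ∈ Finset.Ioc 0 J, limitFactor B β n x) * g x) ∧
      ∀ N, J ≤ N → ∀ x ∈ Set.Icc (-X) X,
        |∏ n ∈ Finset.Ioc J N, limitFactor B β n x - g x| ≤ e N := by
    intro X hX
    set J := ⌈8 * (X + 1) ^ 2⌉₊ with hJ
    have hJ1 : 8 * (X + 1) ^ 2 ≤ J := Nat.le_ceil _
    have hJ0 : 0 < J := by rw [hJ, Nat.ceil_pos]; positivity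
    obtain ⟨T, hT⟩ := exists_tail_function hB0 hB1 β hJ0 hJ1
    set S : ℕ → ℝ := fun N => ∑ j ∈ Finset.Ioc 0 N, Real.log (1 - displacement B β j) with hS
    set C := Real.exp (2 * (Λ - S J)) with hC
    let CN : ℕ → ℝ := fun N => Real.exp (2 * (S N - S J))
    have hCN : Tendsto CN atTop (𝓝 C) :=
      (Real.continuous_exp.tendsto _).comp ((hΛ.sub_const (S J)).const_mul 2)
    have hC0 : 0 < C := Real.exp_pos _
    refine ⟨J, fun x => C * T x, fun N => |CN N - C| + CN N * (4 * (X + 1) ^ 2 / N), ?_, ?_, ?_, ?_⟩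
    · have h1 : Tendsto (fun N => |CN N - C|) atTop (𝓝 0) := by
        have := (hCN.sub_const C).abs
        rwa [sub_self, abs_zero] at this
      have h2 : Tendsto (fun N : ℕ => 4 * (X + 1) ^ 2 / (N : ℝ)) atTop (𝓝 0) :=
        Tendsto.div_atTop tendsto_const_nhds tendsto_natCast_atTop_atTop
      simpa using h1.add (hCN.mul h2)
    · intro x hx
      exact mul_ne_zero hC0.ne' (by linarith [(hT x hx).1])
    · intro x hx
      rw [limitProd_eq hB0 hB1 hΛ hF, eq_head_mul_tail hF hT hx, prod_Ioc_limitFactor_eq hB0 hB1,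
        abs_mul, abs_of_pos (by linarith [(hT x hx).1] : 0 < T x), hC,
        show 2 * Λ = 2 * S J + 2 * (Λ - S J) by ring, Real.exp_add]
      ring
    · intro N hN x hx
      obtain ⟨hT1, hT2, hT3⟩ := hT x hx
      have h1 : ∑ j ∈ Finset.Ioc J N, Real.log (1 - displacement B β j) = S N - S J := by
        rw [hS, eq_sub_iff_add_eq', Finset.sum_Ioc_consecutive _ (Nat.zero_le J) hN]
      rw [prod_Ioc_limitFactor_eq hB0 hB1, h1]
      set E := ∏ j ∈ Finset.Ioc J N, (1 - ((x + B / 2) / node B β j) ^ 2)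
      have h2 : |(|E| - T x)| ≤ 4 * (X + 1) ^ 2 / N := by
        have h3 := abs_abs_sub_abs_le E (T x)
        rw [abs_of_pos (by linarith : 0 < T x)] at h3
        exact h3.trans (hT3 N hN)
      have h3 : Real.exp (2 * (S N - S J)) * |E| - C * T x =
          (CN N - C) * T x + CN N * (|E| - T x) := by simp only [CN]; ring
      rw [h3]
      refine (abs_add_le _ _).trans ?_
      rw [abs_mul, abs_mul, abs_of_pos (Real.exp_pos _ : 0 < CN N),
        abs_of_pos (by linarith : 0 < T x)]
      exact add_le_add (mul_le_of_le_one_right (abs_nonneg _) hT2)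
        (mul_le_mul_of_nonneg_left h2 (Real.exp_pos _).le)
  constructor
  · rw [tendstoLocallyUniformly_iff_forall_isCompact]
    intro K hK
    obtain ⟨X, hX, hKX⟩ := exists_subset_Icc_neg hK
    obtain ⟨J, g, e, he, -, hg, hconv⟩ := key X hX
    have hcont : Continuous fun x => ∏ n ∈ Finset.Ioc 0 J, limitFactor B β n x := by
      refine continuous_finsetProd _ fun n _ => ?_
      unfold limitFactor
      fun_prop
    obtain ⟨H, hH⟩ := (isCompact_Icc (a := -X) (b := X)).exists_bound_of_continuousOn
      hcont.continuousOn
    have he' : Tendsto (fun N => H * e N) atTop (𝓝 0) := by simpa using he.const_mul H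
    refine (tendstoUniformlyOn_of_abs_sub_le he' ?_).mono hKX
    refine eventually_atTop.2 ⟨J, fun N hN x hx => ?_⟩
    rw [hg x hx, Icc_one_eq_Ioc_zero, ← Finset.prod_Ioc_consecutive _ (Nat.zero_le J) hN, ← mul_sub,
      abs_mul]
    have h1 := hH x hx
    rw [Real.norm_eq_abs] at h1
    exact mul_le_mul h1 (hconv N hN x hx) (abs_nonneg _) ((abs_nonneg _).trans h1)
  · intro K hK
    obtain ⟨X, hX, hKX⟩ := exists_subset_Icc_neg hK
    obtain ⟨J, g, e, he, hg0, -, hconv⟩ := key X hX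
    exact ⟨J, g, fun x hx => hg0 x (hKX hx),
      (tendstoUniformlyOn_of_abs_sub_le he (eventually_atTop.2 ⟨J, hconv⟩)).mono hKX⟩

theorem limitFun_eq (hprod : ∀ x, limitProd B β x = Real.exp (2 * Λ) * |F x|) :
    limitFun B β = fun x => 2 * Real.pi * Real.exp (2 * Λ) * |(x + B) * F x| := by
  funext x
  rw [limitFun, hprod, abs_mul]
  ring

theorem continuous_limitFun (hF : ContDiff ℝ 1 F)
    (hprod : ∀ x, limitProd B β x = Real.exp (2 * Λ) * |F x|) : Continuous (limitFun B β) := by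
  have := hF.continuous
  rw [limitFun_eq hprod]
  fun_prop

theorem contDiffOn_limitFun (hF : ContDiff ℝ 1 F)
    (hprod : ∀ x, limitProd B β x = Real.exp (2 * Λ) * |F x|) :
    ContDiffOn ℝ 1 (limitFun B β) {x | limitFun B β x ≠ 0} := by
  intro x hx
  rw [limitFun_eq hprod] at hx ⊢
  have h0 : (x + B) * F x ≠ 0 := by
    intro h
    apply hx
    simp [h]
  have h1 : ContDiffAt ℝ 1 (fun x => (x + B) * F x) x :=
    (contDiffAt_id.add contDiffAt_const).mul hF.contDiffAt
  exact (contDiffAt_const.mul (h1.abs h0)).contDiffWithinAt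

end LimitFunction

/-! ### Comparison of a Sudler product with the limit function -/

theorem abs_sq_sub_sin_sq_le (Y : ℝ) : |Y ^ 2 - Real.sin Y ^ 2| ≤ Y ^ 4 := by
  have h1 : Real.sin Y ^ 2 ≤ Y ^ 2 := by
    rw [← sq_abs (Real.sin Y), ← sq_abs Y]
    exact pow_le_pow_left₀ (abs_nonneg _) Real.abs_sin_le_abs 2
  rw [abs_of_nonneg (by linarith)]
  have hY4 : Y ^ 4 = (Y ^ 2) ^ 2 := by ring
  rcases le_or_gt |Y| 1 with h | h
  · have h2 := abs_sin_sub_self_le h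
    have h3 : |Y| - |Y| ^ 3 / 4 ≤ |Real.sin Y| := by
      have := abs_sub_abs_le_abs_sub Y (Real.sin Y)
      rw [abs_sub_comm] at this
      linarith
    have h4 : |Y| ^ 3 ≤ |Y| := by
      have := pow_le_pow_of_le_one (abs_nonneg Y) h (show 1 ≤ 3 by norm_num)
      rwa [pow_one] at this
    have h5 : (|Y| - |Y| ^ 3 / 4) ^ 2 ≤ |Real.sin Y| ^ 2 :=
      pow_le_pow_left₀ (by linarith [abs_nonneg Y]) h3 2
    rw [sq_abs] at h5
    have h6 : (|Y| - |Y| ^ 3 / 4) ^ 2 = Y ^ 2 - (Y ^ 2) ^ 2 / 2 + (|Y| ^ 3 / 4) ^ 2 := by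
      rw [← sq_abs Y]; ring
    nlinarith [sq_nonneg (|Y| ^ 3 / 4), sq_nonneg (Y ^ 2)]
  · have h2 : 1 ≤ Y ^ 2 := by rw [← sq_abs]; nlinarith
    nlinarith [sq_nonneg (Real.sin Y)]

/-- A ratio of sines is close to the ratio of the arguments, with an error `O(Y²)` as long as `Y / a` is
bounded. -/
theorem abs_sin_div_sin_sq_sub_le {a : ℝ} (Y : ℝ) (ha0 : 0 < a) (ha1 : a ≤ Real.pi / 2) :
    |(Real.sin Y / Real.sin a) ^ 2 - (Y / a) ^ 2| ≤ 4 * Y ^ 2 * ((Y / a) ^ 2 + 1) := by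
  have hs : a / 2 ≤ Real.sin a := by
    refine le_trans ?_ (Real.mul_le_sin ha0.le ha1)
    rw [div_mul_eq_mul_div, div_le_div_iff₀ two_pos Real.pi_pos]
    nlinarith [Real.pi_le_four]
  have hs0 : 0 < Real.sin a := by linarith
  have hs2 : (a / 2) ^ 2 ≤ Real.sin a ^ 2 := pow_le_pow_left₀ (by linarith) hs 2
  have h1 := abs_sq_sub_sin_sq_le Y
  have h2 := abs_sq_sub_sin_sq_le a
  have e : (Real.sin Y / Real.sin a) ^ 2 - (Y / a) ^ 2 =
      (Y ^ 2 * (a ^ 2 - Real.sin a ^ 2) - a ^ 2 * (Y ^ 2 - Real.sin Y ^ 2)) /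
        (a ^ 2 * Real.sin a ^ 2) := by
    field_simp
    ring
  rw [e, abs_div, abs_of_pos (by positivity : 0 < a ^ 2 * Real.sin a ^ 2),
    div_le_iff₀ (by positivity)]
  have h3 : |Y ^ 2 * (a ^ 2 - Real.sin a ^ 2) - a ^ 2 * (Y ^ 2 - Real.sin Y ^ 2)| ≤
      Y ^ 2 * a ^ 4 + a ^ 2 * Y ^ 4 := by
    refine (abs_sub _ _).trans ?_
    rw [abs_mul, abs_mul, abs_of_nonneg (sq_nonneg Y), abs_of_nonneg (sq_nonneg a)]
    gcongr
  refine h3.trans ?_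
  calc Y ^ 2 * a ^ 4 + a ^ 2 * Y ^ 4 = 4 * Y ^ 2 * ((Y / a) ^ 2 + 1) * (a ^ 2 * (a / 2) ^ 2) := by
        field_simp
        ring
    _ ≤ _ := by gcongr

theorem perturbedAngle_eq (q : ℕ) (B γ : ℝ) (j : ℕ) :
    perturbedAngle q B γ j = Real.pi * node B γ j / q := rfl

theorem perturbedAngle_mem {B : ℝ} (hB0 : 0 < B) (hB1 : B ≤ 1) (γ : ℝ) {q j : ℕ} (hq : 0 < q)
    (hj : 0 < j) (hjq : j ≤ (q - 1) / 2) :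
    0 < perturbedAngle q B γ j ∧ perturbedAngle q B γ j ≤ Real.pi / 2 := by
  have hpi := Real.pi_pos
  have hq' : (0 : ℝ) < q := by exact_mod_cast hq
  have h0 := node_pos hB0 hB1 γ hj
  have h1 := (abs_le.1 (abs_node_sub_le hB0 hB1 γ j)).2
  have h2 : (2 * j + 1 : ℝ) ≤ q := by exact_mod_cast (by omega : 2 * j + 1 ≤ q)
  rw [perturbedAngle_eq]
  refine ⟨by positivity, ?_⟩
  rw [div_le_div_iff₀ hq' two_pos]
  nlinarith

/-- The finite counterpart of `prod_Ioc_limitFactor_eq`. -/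
theorem prod_Ioc_sineFactor_eq {B : ℝ} (hB0 : 0 < B) (hB1 : B ≤ 1) (γ x : ℝ) {q : ℕ}
    (hq : 0 < q) {M N : ℕ} (hN : N ≤ (q - 1) / 2) :
    ∏ n ∈ Finset.Ioc M N, sineFactor q B γ x n =
      Real.exp (2 * ∑ n ∈ Finset.Ioc M N,
        Real.log (Real.sin (perturbedAngle q B γ n) / Real.sin (Real.pi * n / q))) *
        |∏ n ∈ Finset.Ioc M N, (1 - (Real.sin (Real.pi * (x + B / 2) / q) /
          Real.sin (perturbedAngle q B γ n)) ^ 2)| := by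
  rw [Finset.mul_sum, Real.exp_sum, Finset.abs_prod, ← Finset.prod_mul_distrib]
  refine Finset.prod_congr rfl fun n hn => ?_
  rw [Finset.mem_Ioc] at hn
  have hn0 : 0 < n := by omega
  have hn' : (0 : ℝ) < n := by exact_mod_cast hn0
  have hq' : (0 : ℝ) < q := by exact_mod_cast hq
  have hpi := Real.pi_pos
  obtain ⟨ha0, ha1⟩ := perturbedAngle_mem hB0 hB1 γ hq hn0 (hn.2.trans hN)
  have hs : 0 < Real.sin (perturbedAngle q B γ n) :=
    Real.sin_pos_of_pos_of_lt_pi ha0 (by linarith)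
  have hs' : 0 < Real.sin (Real.pi * n / q) := by
    refine Real.sin_pos_of_pos_of_lt_pi (by positivity) ?_
    rw [div_lt_iff₀ hq']
    have : (n : ℝ) < q := by exact_mod_cast (by omega : n < q)
    gcongr
  set r := Real.sin (perturbedAngle q B γ n) / Real.sin (Real.pi * n / q) with hr
  have hr0 : 0 < r := by positivity
  rw [two_mul, Real.exp_add, Real.exp_log hr0, ← abs_of_pos (mul_pos hr0 hr0), ← abs_mul,
    sineFactor, hr]
  congr 1
  field_simp

section Comparison

variable {c β κ γ B B' X x : ℝ} {q : ℕ}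

/-- Each of the factors responsible for the zeros is approximated to order `q⁻²`. -/
theorem abs_sin_div_sq_sub_le (hβ : IsBadlyApproximable c β) (hκ : 0 ≤ κ)
    (hB0 : 0 < B) (hB1 : B ≤ 1) (hB'0 : 0 < B') (hB'1 : B' ≤ 1)
    (hBB : |B' - B| ≤ κ / (q : ℝ) ^ 2) (hγ : |γ - β| ≤ κ / (q : ℝ) ^ 2) (hq : 0 < q)
    (hx : x ∈ Set.Icc (-X) X) {j : ℕ} (hj : 0 < j) (hjq : j ≤ (q - 1) / 2) :
    |(Real.sin (Real.pi * (x + B' / 2) / q) / Real.sin (perturbedAngle q B' γ j)) ^ 2 -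
      ((x + B / 2) / node B β j) ^ 2| ≤
      (64 * (X + 1) ^ 2 * (4 * (X + 1) ^ 2 + 1) +
        4 * (X + 1) * (κ + 4 * (X + 1) * (2 * κ + κ / c))) / (q : ℝ) ^ 2 := by
  have hc := hβ.1
  have hpi := Real.pi_pos
  have hpi4 := Real.pi_le_four
  have hq' : (0 : ℝ) < q := by exact_mod_cast hq
  have hj' : (1 : ℝ) ≤ j := by exact_mod_cast hj
  set Z := X + 1 with hZ
  have hZ1 : 1 ≤ Z := by linarith [hx.1, hx.2]
  set y := x + B / 2 with hy
  set y' := x + B' / 2 with hy'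
  have hyZ : |y| ≤ Z := abs_le.2 ⟨by linarith [hx.1], by linarith [hx.2]⟩
  have hyZ' : |y'| ≤ Z := abs_le.2 ⟨by linarith [hx.1], by linarith [hx.2]⟩
  set n := node B β j with hn
  set n' := node B' γ j with hn'
  have hn0 : 0 < n := node_pos hB0 hB1 β hj
  have hn0' : 0 < n' := node_pos hB'0 hB'1 γ hj
  have hnj : (j : ℝ) / 2 ≤ n := half_le_node hB0 hB1 β hj
  have hnj' : (j : ℝ) / 2 ≤ n' := half_le_node hB'0 hB'1 γ hj
  have hquot : |y / n| ≤ 2 * Z := by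
    rw [abs_div, abs_of_pos hn0, div_le_iff₀ hn0]
    nlinarith
  have hquot' : |y' / n'| ≤ 2 * Z := by
    rw [abs_div, abs_of_pos hn0', div_le_iff₀ hn0']
    nlinarith
  obtain ⟨ha0, ha1⟩ := perturbedAngle_mem hB'0 hB'1 γ hq hj hjq
  have h1 : |(Real.sin (Real.pi * y' / q) / Real.sin (perturbedAngle q B' γ j)) ^ 2 -
      (y' / n') ^ 2| ≤ 64 * Z ^ 2 * (4 * Z ^ 2 + 1) / (q : ℝ) ^ 2 := by
    have h2 := abs_sin_div_sin_sq_sub_le (Real.pi * y' / q) ha0 ha1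
    have e : Real.pi * y' / q / perturbedAngle q B' γ j = y' / n' := by
      rw [perturbedAngle_eq, ← hn']; field_simp
    rw [e] at h2
    refine h2.trans ?_
    have h3 : (Real.pi * y' / q) ^ 2 ≤ 16 * Z ^ 2 / (q : ℝ) ^ 2 := by
      rw [div_pow, mul_pow, ← sq_abs y']
      have : Real.pi ^ 2 ≤ 16 := by nlinarith
      gcongr
    have h4 : (y' / n') ^ 2 ≤ 4 * Z ^ 2 := by
      rw [← sq_abs]; nlinarith [abs_nonneg (y' / n')]
    calc 4 * (Real.pi * y' / q) ^ 2 * ((y' / n') ^ 2 + 1)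
        ≤ 4 * (16 * Z ^ 2 / (q : ℝ) ^ 2) * (4 * Z ^ 2 + 1) := by gcongr
      _ = _ := by ring
  have h2 : |y' / n' - y / n| ≤ (κ + 4 * Z * (2 * κ + κ / c)) / (q : ℝ) ^ 2 := by
    have e : y' / n' - y / n = (y' - y) / n' + y * (n - n') / (n * n') := by
      field_simp; ring
    have h3 : |(y' - y) / n'| ≤ κ / (q : ℝ) ^ 2 := by
      rw [abs_div, abs_of_pos hn0', div_le_iff₀ hn0',
        show y' - y = (B' - B) / 2 by rw [hy, hy']; ring, abs_div, abs_two]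
      have : 0 ≤ κ / (q : ℝ) ^ 2 := by positivity
      nlinarith
    have h4 : |n - n'| ≤ (2 * κ + κ / c) * (j : ℝ) ^ 2 / (q : ℝ) ^ 2 := by
      have := abs_mul_fract_sub_le hβ hκ hB0 hB1 hBB hγ hq hj
      rwa [show n - n' = B' * (Int.fract (j * γ) - 1 / 2) - B * (Int.fract (j * β) - 1 / 2) by
        rw [hn, hn', node, node]; ring]
    have h5 : |y * (n - n') / (n * n')| ≤ 4 * Z * (2 * κ + κ / c) / (q : ℝ) ^ 2 := by
      rw [abs_div, abs_mul, abs_of_pos (mul_pos hn0 hn0'), div_le_iff₀ (mul_pos hn0 hn0')]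
      calc |y| * |n - n'| ≤ Z * ((2 * κ + κ / c) * (j : ℝ) ^ 2 / (q : ℝ) ^ 2) := by gcongr
        _ = 4 * Z * (2 * κ + κ / c) / (q : ℝ) ^ 2 * ((j : ℝ) / 2 * ((j : ℝ) / 2)) := by ring
        _ ≤ _ := by gcongr
    rw [e]
    refine (abs_add_le _ _).trans ((add_le_add h3 h5).trans (le_of_eq ?_))
    ring
  have h3 : |(y' / n') ^ 2 - (y / n) ^ 2| ≤
      4 * Z * (κ + 4 * Z * (2 * κ + κ / c)) / (q : ℝ) ^ 2 := by
    rw [sq_sub_sq, abs_mul]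
    have h4 : |y' / n' + y / n| ≤ 4 * Z := (abs_add_le _ _).trans (by linarith)
    calc |y' / n' + y / n| * |y' / n' - y / n|
        ≤ 4 * Z * ((κ + 4 * Z * (2 * κ + κ / c)) / (q : ℝ) ^ 2) := by gcongr
      _ = _ := by ring
  have h4 := abs_add_le ((Real.sin (Real.pi * y' / q) /
    Real.sin (perturbedAngle q B' γ j)) ^ 2 - (y' / n') ^ 2) ((y' / n') ^ 2 - (y / n) ^ 2)
  rw [sub_add_sub_cancel] at h4
  refine h4.trans ((add_le_add h1 h3).trans (le_of_eq ?_))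
  ring

/-- The factor coming from `n = q`. -/
theorem abs_two_mul_sin_sub_le (hκ : 0 ≤ κ) (hB'0 : 0 < B')
    (hB'1 : B' ≤ 1) (hBB : |B' - B| ≤ κ / (q : ℝ) ^ 2) (hq : 0 < q)
    (hx : x ∈ Set.Icc (-X) X) (hqX : 4 * (X + 1) ≤ q) :
    |(2 * |Real.sin (Real.pi * (x + B') / q)| * q - 2 * Real.pi * |x + B|)| ≤
      (32 * (X + 1) ^ 3 + 8 * κ) / (q : ℝ) ^ 2 := by
  have hpi := Real.pi_pos
  have hpi4 := Real.pi_le_four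
  have hq' : (0 : ℝ) < q := by exact_mod_cast hq
  set Z := X + 1 with hZ
  have hZ1 : 1 ≤ Z := by linarith [hx.1, hx.2]
  have hs : |x + B'| ≤ Z := abs_le.2 ⟨by linarith [hx.1], by linarith [hx.2]⟩
  set w := Real.pi * (x + B') / q with hw
  have hwb : |w| ≤ 4 * Z / q := by
    rw [hw, abs_div, abs_mul, abs_of_pos hpi, abs_of_pos hq']
    gcongr
  have hw1 : |w| ≤ 1 := hwb.trans (by rw [div_le_one hq']; exact hqX)
  have h1 := abs_sin_sub_self_le hw1
  have h2 : |Real.sin w - w| ≤ 16 * Z ^ 3 / (q : ℝ) ^ 3 := by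
    refine h1.trans ?_
    calc |w| ^ 3 / 4 ≤ (4 * Z / q) ^ 3 / 4 := by gcongr
      _ = _ := by ring
  have h3 : |Real.sin w * q - Real.pi * (x + B)| ≤ (16 * Z ^ 3 + 4 * κ) / (q : ℝ) ^ 2 := by
    have e : Real.sin w * q - Real.pi * (x + B) =
        (Real.sin w - w) * q + Real.pi * (B' - B) := by
      rw [sub_mul, show w * q = Real.pi * (x + B') by rw [hw]; field_simp]
      ring
    rw [e]
    refine (abs_add_le _ _).trans ?_
    rw [abs_mul, abs_mul, abs_of_pos hpi, abs_of_pos hq']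
    calc |Real.sin w - w| * q + Real.pi * |B' - B|
        ≤ 16 * Z ^ 3 / (q : ℝ) ^ 3 * q + 4 * (κ / (q : ℝ) ^ 2) := by gcongr
      _ = _ := by field_simp
  have h4 := (abs_abs_sub_abs_le (Real.sin w * q) (Real.pi * (x + B))).trans h3
  rw [abs_mul, abs_mul, abs_of_pos hpi, abs_of_pos hq'] at h4
  rw [show 2 * |Real.sin w| * q - 2 * Real.pi * |x + B| =
    2 * (|Real.sin w| * q - Real.pi * |x + B|) by ring, abs_mul, abs_two]
  refine (mul_le_mul_of_nonneg_left h4 zero_le_two).trans (le_of_eq ?_)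
  ring

/-- The middle factor `n = q / 2`, present for even `q` only. -/
theorem abs_ite_cos_sub_one_le (hB'0 : 0 < B') (hB'1 : B' ≤ 1) (hq : 0 < q)
    (hx : x ∈ Set.Icc (-X) X) :
    |(if Even q then |Real.cos (Real.pi * (x + B' / 2) / q)| else 1) - 1| ≤
      8 * (X + 1) ^ 2 / √(q : ℝ) := by
  have hpi := Real.pi_pos
  have hpi4 := Real.pi_le_four
  have hq' : (1 : ℝ) ≤ q := by exact_mod_cast hq
  split_ifs
  · set Y := Real.pi * (x + B' / 2) / q with hY
    have h1 : |x + B' / 2| ≤ X + 1 := abs_le.2 ⟨by linarith [hx.1], by linarith [hx.2]⟩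
    have h2 : Y ^ 2 ≤ 16 * (X + 1) ^ 2 * (q : ℝ)⁻¹ := by
      rw [hY, div_pow, mul_pow, ← sq_abs (x + B' / 2), ← div_eq_mul_inv]
      have h3 : Real.pi ^ 2 ≤ 16 := by nlinarith
      have h4 : (q : ℝ) ≤ (q : ℝ) ^ 2 := by nlinarith
      gcongr
    have h3 : 1 - Y ^ 2 / 2 ≤ |Real.cos Y| :=
      Real.one_sub_sq_div_two_le_cos.trans (le_abs_self _)
    have h4 := Real.abs_cos_le_one Y
    rw [abs_sub_comm, abs_of_nonneg (by linarith)]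
    have h5 : 16 * (X + 1) ^ 2 * (q : ℝ)⁻¹ ≤ 16 * (X + 1) ^ 2 * (1 / √(q : ℝ)) := by
      gcongr
      exact inv_le_inv_sqrt hq
    have h6 : 8 * (X + 1) ^ 2 / √(q : ℝ) = 16 * (X + 1) ^ 2 * (1 / √(q : ℝ)) / 2 := by ring
    linarith
  · rw [sub_self, abs_zero]
    positivity

/-- Comparison of the products over the factors which stay away from zero. -/
theorem abs_tail_prod_sub_le {t t' : ℕ → ℝ} {C Z T : ℝ} {J h : ℕ} (hC : 0 ≤ C)
    (hJ0 : 0 < J) (hJ1 : 8 * Z ^ 2 ≤ J) (hq0 : 0 < q) (hhq : h ≤ q) (hqh : q ≤ 4 * h)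
    (hCq : 2 * C ≤ q) (ht0 : ∀ j, 0 ≤ t j) (ht0' : ∀ j, 0 ≤ t' j)
    (ht : ∀ j, 0 < j → t j ≤ 4 * Z ^ 2 / (j : ℝ) ^ 2)
    (htt : ∀ j, 0 < j → j ≤ h → |t' j - t j| ≤ C / (q : ℝ) ^ 2)
    (hT : |∏ j ∈ Finset.Ioc J h, (1 - t j) - T| ≤ 4 * Z ^ 2 / h) :
    |∏ j ∈ Finset.Ioc J h, (1 - t' j) - T| ≤ (C + 16 * Z ^ 2) / √(q : ℝ) := by
  have hq' : (1 : ℝ) ≤ q := by exact_mod_cast hq0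
  have hCq' : C / (q : ℝ) ^ 2 ≤ 1 / 2 := by
    rw [div_le_div_iff₀ (by positivity) two_pos]; nlinarith
  have h1 : ∀ j ∈ Finset.Ioc J h, t j ≤ 1 / 2 := by
    intro j hj
    rw [Finset.mem_Ioc] at hj
    have hj' : (J : ℝ) ≤ j := by exact_mod_cast hj.1.le
    have hj1 : (1 : ℝ) ≤ j := by exact_mod_cast (by omega : 1 ≤ j)
    refine (ht j (by omega)).trans ?_
    rw [div_le_div_iff₀ (by positivity) two_pos]
    nlinarith
  have h2 : |∏ j ∈ Finset.Ioc J h, (1 - t' j) - ∏ j ∈ Finset.Ioc J h, (1 - t j)| ≤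
      C / √(q : ℝ) := by
    refine (abs_prod_sub_prod_le_sum _ (fun j hj => ?_) (fun j hj => ?_)).trans
      ((Finset.sum_le_sum fun j hj => ?_).trans (sum_Ioc_const_div_sq_le hC hq0 hhq (M := J)))
    · have h3 := h1 j hj
      rw [Finset.mem_Ioc] at hj
      have h4 := (abs_le.1 (htt j (by omega) hj.2)).2
      rw [abs_le]
      constructor <;> linarith [ht0' j]
    · have h3 := h1 j hj
      rw [abs_le]
      constructor <;> linarith [ht0 j]
    · rw [Finset.mem_Ioc] at hj
      rw [sub_sub_sub_cancel_left, abs_sub_comm]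
      exact htt j (by omega) hj.2
  have h3 : 4 * Z ^ 2 / (h : ℝ) ≤ 16 * Z ^ 2 / √(q : ℝ) := by
    have h4 : (q : ℝ) ≤ 4 * h := by exact_mod_cast hqh
    calc 4 * Z ^ 2 / (h : ℝ) ≤ 4 * Z ^ 2 / ((q : ℝ) / 4) := by
          apply div_le_div_of_nonneg_left (by positivity) (by linarith) (by linarith)
      _ = 16 * Z ^ 2 * (q : ℝ)⁻¹ := by field_simp; ring
      _ ≤ 16 * Z ^ 2 * (1 / √(q : ℝ)) := by gcongr; exact inv_le_inv_sqrt hq0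
      _ = _ := by ring
  have h4 := abs_add_le (∏ j ∈ Finset.Ioc J h, (1 - t' j) - ∏ j ∈ Finset.Ioc J h, (1 - t j))
    (∏ j ∈ Finset.Ioc J h, (1 - t j) - T)
  rw [sub_add_sub_cancel] at h4
  refine h4.trans ((add_le_add h2 (hT.trans h3)).trans (le_of_eq ?_))
  ring

/-- Comparison of the products over the finitely many factors which may vanish. -/
theorem abs_head_prod_sub_le {t t' : ℕ → ℝ} {C Z : ℝ} {J : ℕ} (hC : 0 ≤ C) (hq : 0 < q)
    (ht0 : ∀ j, 0 ≤ t j) (ht0' : ∀ j, 0 ≤ t' j)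
    (ht : ∀ j, 0 < j → t j ≤ 4 * Z ^ 2 / (j : ℝ) ^ 2)
    (htt : ∀ j, 0 < j → j ≤ J → |t' j - t j| ≤ C / (q : ℝ) ^ 2) :
    |(|∏ j ∈ Finset.Ioc 0 J, (1 - t' j)| - |∏ j ∈ Finset.Ioc 0 J, (1 - t j)|)| ≤
        (1 + 4 * Z ^ 2 + C) ^ J * (J * C) / (q : ℝ) ^ 2 ∧
      |∏ j ∈ Finset.Ioc 0 J, (1 - t' j)| ≤ (1 + 4 * Z ^ 2 + C) ^ J := by
  have hq' : (1 : ℝ) ≤ q := by exact_mod_cast hq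
  obtain ⟨R, hR⟩ : ∃ R, R = 1 + 4 * Z ^ 2 + C := ⟨_, rfl⟩
  rw [← hR]
  have hZ2 := sq_nonneg Z
  have hR1 : 1 ≤ R := by linarith
  have htR : ∀ j ∈ Finset.Ioc 0 J, |1 - t j| ≤ R ∧ |1 - t' j| ≤ R := by
    intro j hj
    rw [Finset.mem_Ioc] at hj
    have hj1 : (1 : ℝ) ≤ j := by exact_mod_cast hj.1
    have h1 : t j ≤ 4 * Z ^ 2 := (ht j hj.1).trans
      (div_le_self (by positivity) (one_le_pow₀ hj1))
    have h2 := (abs_le.1 (htt j hj.1 hj.2)).2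
    have h3 : C / (q : ℝ) ^ 2 ≤ C := div_le_self hC (one_le_pow₀ hq')
    have h4 := ht0 j
    have h5 := ht0' j
    rw [abs_le, abs_le]
    refine ⟨⟨?_, ?_⟩, ?_, ?_⟩ <;> linarith
  constructor
  · refine (abs_abs_sub_abs_le _ _).trans ?_
    have h1 := abs_prod_sub_prod_le (Finset.Ioc 0 J) hR1 (fun j hj => (htR j hj).2)
      (fun j hj => (htR j hj).1)
    rw [Nat.card_Ioc, Nat.sub_zero] at h1
    refine h1.trans ?_
    have h2 : ∑ j ∈ Finset.Ioc 0 J, |1 - t' j - (1 - t j)| ≤ J * (C / (q : ℝ) ^ 2) := by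
      calc ∑ j ∈ Finset.Ioc 0 J, |1 - t' j - (1 - t j)|
          ≤ ∑ _j ∈ Finset.Ioc 0 J, C / (q : ℝ) ^ 2 := by
            refine Finset.sum_le_sum fun j hj => ?_
            rw [Finset.mem_Ioc] at hj
            rw [sub_sub_sub_cancel_left, abs_sub_comm]
            exact htt j hj.1 hj.2
        _ = J * (C / (q : ℝ) ^ 2) := by
            rw [Finset.sum_const, Nat.card_Ioc, Nat.sub_zero, nsmul_eq_mul]
    calc R ^ J * ∑ j ∈ Finset.Ioc 0 J, |1 - t' j - (1 - t j)|
        ≤ R ^ J * (J * (C / (q : ℝ) ^ 2)) := by gcongr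
      _ = _ := by ring
  · rw [Finset.abs_prod]
    calc ∏ j ∈ Finset.Ioc 0 J, |1 - t' j| ≤ ∏ _j ∈ Finset.Ioc 0 J, R :=
          Finset.prod_le_prod (fun _ _ => abs_nonneg _) fun j hj => (htR j hj).2
      _ = R ^ J := by rw [Finset.prod_const, Nat.card_Ioc, Nat.sub_zero]

/-- Relative errors of order `ε` in the factors `W`, `exp (2 * S)` and `w`, which stay away from
zero, and absolute errors of order `δ` in the factors `a` and `b`, which may vanish, combine to a
relative error of order `ε` and an absolute error of order `δ` of the product. -/
theorem exists_relative_absolute_error {ε δ A₁ A₂ A₃ M₁ M₂ M₃ M₄ W T S Λ w a a₀ b b₀ : ℝ}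
    (hT1 : 1 / 2 ≤ T) (hT2 : T ≤ 1) (hW : |W - T| ≤ A₁ * ε / 2) (hS : |S - Λ| ≤ A₂ * ε / 4)
    (hw : |w - 1| ≤ A₃ * ε) (h₁ : A₁ * ε ≤ 1) (h₂ : A₂ * ε ≤ 1) (h₃ : A₃ * ε ≤ 1)
    (hδ : 0 ≤ δ) (hM₁ : 0 ≤ M₁) (hM₄ : 0 ≤ M₄) (ha : |a - a₀| ≤ M₁ * δ)
    (hb : |b - b₀| ≤ M₂ * δ) (hb' : |b| ≤ M₃) (ha₀ : |a₀| ≤ M₄) :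
    ∃ u v : ℝ, |u| ≤ (4 * A₁ + 2 * A₂ + A₃) * ε ∧
      |v| ≤ 8 * Real.exp (2 * Λ) * (M₁ * M₃ + M₄ * M₂) * δ ∧
      a * (Real.exp (2 * S) * (b * W)) * w =
        (1 + u) * (Real.exp (2 * Λ) * (a₀ * b₀) * T) + v := by
  have hT0 : 0 < T := by linarith
  obtain ⟨u₁, hu₁⟩ : ∃ u₁, u₁ = W / T - 1 := ⟨_, rfl⟩
  have hu₁b : |u₁| ≤ A₁ * ε := by
    have e : u₁ = (W - T) / T := by
      rw [hu₁]; field_simp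
    rw [e, abs_div, abs_of_pos hT0, div_le_iff₀ hT0]
    refine hW.trans ?_
    have h1 : 0 ≤ A₁ * ε := by linarith [abs_nonneg (W - T)]
    rw [div_eq_mul_one_div]
    exact mul_le_mul_of_nonneg_left hT1 h1
  have hu₁e : W = T * (1 + u₁) := by
    rw [hu₁]; field_simp; ring
  obtain ⟨u₂, hu₂⟩ : ∃ u₂, u₂ = Real.exp (2 * (S - Λ)) - 1 := ⟨_, rfl⟩
  have hu₂b : |u₂| ≤ A₂ * ε := by
    have h1 : |2 * (S - Λ)| ≤ A₂ * ε / 2 := by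
      rw [abs_mul, abs_two]
      linarith
    rw [hu₂]
    refine (Real.abs_exp_sub_one_le (by linarith)).trans ?_
    linarith
  have hu₂e : Real.exp (2 * S) = Real.exp (2 * Λ) * (1 + u₂) := by
    rw [hu₂, add_sub_cancel, ← Real.exp_add]; congr 1; ring
  obtain ⟨u₃, hu₃⟩ : ∃ u₃, u₃ = w - 1 := ⟨_, rfl⟩
  rw [← hu₃] at hw
  have hu₃e : w = 1 + u₃ := by rw [hu₃]; ring
  obtain ⟨e, he⟩ : ∃ e, e = a * b - a₀ * b₀ := ⟨_, rfl⟩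
  have heb : |e| ≤ (M₁ * M₃ + M₄ * M₂) * δ := by
    have h1 : e = (a - a₀) * b + a₀ * (b - b₀) := by rw [he]; ring
    rw [h1]
    refine (abs_add_le _ _).trans ?_
    rw [abs_mul, abs_mul]
    calc |a - a₀| * |b| + |a₀| * |b - b₀| ≤ M₁ * δ * M₃ + M₄ * (M₂ * δ) := by gcongr
      _ = _ := by ring
  obtain ⟨u, hu⟩ : ∃ u, u = (1 + u₁) * (1 + u₂) * (1 + u₃) - 1 := ⟨_, rfl⟩
  have hub : |u| ≤ (4 * A₁ + 2 * A₂ + A₃) * ε := by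
    have h1 : u = u₁ * (1 + u₂) * (1 + u₃) + u₂ * (1 + u₃) + u₃ := by rw [hu]; ring
    have h2 : |1 + u₂| ≤ 2 := by
      refine (abs_add_le _ _).trans ?_
      rw [abs_one]; linarith
    have h3 : |1 + u₃| ≤ 2 := by
      refine (abs_add_le _ _).trans ?_
      rw [abs_one]; linarith
    have h4 : 0 ≤ A₁ * ε := (abs_nonneg _).trans hu₁b
    have h5 : 0 ≤ A₂ * ε := (abs_nonneg _).trans hu₂b
    rw [h1]
    refine (abs_add_le _ _).trans ((add_le_add_left (abs_add_le _ _) _).trans ?_)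
    rw [abs_mul, abs_mul, abs_mul]
    calc |u₁| * |1 + u₂| * |1 + u₃| + |u₂| * |1 + u₃| + |u₃|
        ≤ A₁ * ε * 2 * 2 + A₂ * ε * 2 + A₃ * ε := by gcongr
      _ = _ := by ring
  have hu8 : |1 + u| ≤ 8 := by
    refine (abs_add_le _ _).trans ?_
    rw [abs_one]
    linarith
  refine ⟨u, e * Real.exp (2 * Λ) * T * (1 + u), hub, ?_, ?_⟩
  · rw [abs_mul, abs_mul, abs_mul, abs_of_pos (Real.exp_pos _), abs_of_pos hT0]
    have h1 := (abs_nonneg e).trans heb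
    calc |e| * Real.exp (2 * Λ) * T * |1 + u|
        ≤ (M₁ * M₃ + M₄ * M₂) * δ * Real.exp (2 * Λ) * 1 * 8 := by gcongr
      _ = _ := by ring
  · rw [hu₁e, hu₂e, hu₃e, he, hu]
    ring

set_option maxHeartbeats 1000000 in
/-- The main estimate: a perturbed Sudler product is the limit function up to a relative error
`O(q^{-1/2})` and an additive error `O(q⁻²)`. The additive error comes from the finitely many
factors which may vanish, the relative error from all the others. -/
theorem exists_sudler_estimate (hβ : IsBadlyApproximable c β) (hκ : 0 ≤ κ)
    (hB0 : 0 < B) (hB1 : B ≤ 1) {Λ K₀ : ℝ} {F : ℝ → ℝ} (hK₀ : 0 ≤ K₀) (hΛ : ∀ N : ℕ, 0 < N →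
      |∑ j ∈ Finset.Ioc 0 N, Real.log (1 - displacement B β j) - Λ| ≤ K₀ / √(N : ℝ))
    (hF : ∀ x, Tendsto (fun N : ℕ =>
      ∏ j ∈ Finset.Ioc 0 N, (1 - ((x + B / 2) / node B β j) ^ 2)) atTop (𝓝 (F x)))
    {X : ℝ} (hX : 0 ≤ X) :
    ∃ (K : ℝ) (q₀ : ℕ), 0 ≤ K ∧ ∀ (q : ℕ) (p q' σ z : ℤ) (α B' : ℝ), q₀ ≤ q → 0 < q →
      (σ = 1 ∨ σ = -1) → p * q' = -σ + q * z → q * α = p + σ * (B' / q) →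
      0 < B' → B' ≤ 1 → |B' - B| ≤ κ / (q : ℝ) ^ 2 → |(q' : ℝ) / q - β| ≤ κ / (q : ℝ) ^ 2 →
      ∀ x ∈ Set.Icc (-X) X, ∃ u v : ℝ, |u| ≤ K / √(q : ℝ) ∧ |v| ≤ K / (q : ℝ) ^ 2 ∧
        ∏ n ∈ Finset.Icc 1 q, |2 * Real.sin (Real.pi * (n * α + σ * x / q))| =
          (1 + u) * limitFun B β x + v := by
  have hc := hβ.1
  have hpi := Real.pi_pos
  have hpi4 := Real.pi_le_four
  obtain ⟨Z, hZ⟩ : ∃ Z, Z = X + 1 := ⟨_, rfl⟩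
  have hZ1 : 1 ≤ Z := by linarith
  -- the cut-off between the factors which may vanish and the others
  obtain ⟨J, hJdef⟩ : ∃ J, J = ⌈8 * Z ^ 2⌉₊ := ⟨_, rfl⟩
  have hJ1 : 8 * Z ^ 2 ≤ J := by rw [hJdef]; exact Nat.le_ceil _
  have hJ0 : 0 < J := by rw [hJdef, Nat.ceil_pos]; positivity
  obtain ⟨T, hT⟩ := exists_tail_function (X := X) hB0 hB1 β hJ0 (by rw [← hZ]; exact hJ1)
  obtain ⟨K₁, q₁, hK₁, hlog⟩ := exists_abs_sum_log_sin_sub_limit_le hβ hκ hB0 hB1 hK₀ hΛ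
  have hprod := limitProd_eq hB0 hB1 (tendsto_of_abs_sub_le_div_sqrt hΛ) hF
  obtain ⟨C, hC⟩ : ∃ C, C = 64 * Z ^ 2 * (4 * Z ^ 2 + 1) +
    4 * Z * (κ + 4 * Z * (2 * κ + κ / c)) := ⟨_, rfl⟩
  have hC0 : 0 ≤ C := by rw [hC]; positivity
  obtain ⟨R, hR⟩ : ∃ R, R = 1 + 4 * Z ^ 2 + C := ⟨_, rfl⟩
  have hR0 : 0 ≤ R := by rw [hR]; positivity
  obtain ⟨A₁, hA₁⟩ : ∃ A, A = 2 * (C + 16 * Z ^ 2) := ⟨_, rfl⟩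
  obtain ⟨A₂, hA₂⟩ : ∃ A, A = 4 * K₁ := ⟨_, rfl⟩
  obtain ⟨A₃, hA₃⟩ : ∃ A, A = 8 * Z ^ 2 := ⟨_, rfl⟩
  have hA₁0 : 0 ≤ A₁ := by rw [hA₁]; positivity
  have hA₂0 : 0 ≤ A₂ := by rw [hA₂]; positivity
  have hA₃0 : 0 ≤ A₃ := by rw [hA₃]; positivity
  obtain ⟨L, hL⟩ : ∃ L, L = 8 * Real.exp (2 * Λ) *
    ((32 * Z ^ 3 + 8 * κ) * R ^ J + 8 * Z * (R ^ J * (J * C))) := ⟨_, rfl⟩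
  have hL0 : 0 ≤ L := by rw [hL]; positivity
  -- once `q` exceeds `Q`, each of the three relative errors is at most `1`
  obtain ⟨Q, hQ⟩ : ∃ Q, Q = 4 * Z + 2 * C + A₁ ^ 2 + A₂ ^ 2 + A₃ ^ 2 := ⟨_, rfl⟩
  refine ⟨4 * A₁ + 2 * A₂ + A₃ + L, q₁ + 4 + 4 * J + ⌈Q⌉₊, by positivity, ?_⟩
  intro q p q' σ z α B' hq hq0 hσ hpq hα hB'0 hB'1 hBB hγ x hx
  have hqQ : Q ≤ q := (Nat.le_ceil Q).trans (by exact_mod_cast (by omega : ⌈Q⌉₊ ≤ q))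
  have hq' : (1 : ℝ) ≤ q := by exact_mod_cast hq0
  have hsq1 : 0 < √(q : ℝ) := Real.sqrt_pos.2 (by linarith)
  have hsmall : ∀ A : ℝ, A ^ 2 ≤ Q → A * (1 / √(q : ℝ)) ≤ 1 := by
    intro A hA
    rw [mul_one_div, div_le_one hsq1]
    exact Real.le_sqrt_of_sq_le (hA.trans hqQ)
  have e1 := sq_nonneg A₁
  have e2 := sq_nonneg A₂
  have e3 := sq_nonneg A₃
  have hJh : J ≤ (q - 1) / 2 := by omega
  obtain ⟨hT1, hT2, hT3⟩ := hT x hx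
  obtain ⟨t, hteq⟩ : ∃ t : ℕ → ℝ, t = fun j => ((x + B / 2) / node B β j) ^ 2 := ⟨_, rfl⟩
  obtain ⟨t', hteq'⟩ : ∃ t' : ℕ → ℝ, t' = fun j => (Real.sin (Real.pi * (x + B' / 2) / q) /
    Real.sin (perturbedAngle q B' ((q' : ℝ) / q) j)) ^ 2 := ⟨_, rfl⟩
  have htt : ∀ j, 0 < j → j ≤ (q - 1) / 2 → |t' j - t j| ≤ C / (q : ℝ) ^ 2 := by
    intro j hj hjh
    rw [hteq, hteq', hC, hZ]
    exact abs_sin_div_sq_sub_le hβ hκ hB0 hB1 hB'0 hB'1 hBB hγ hq0 hx hj hjh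
  have ht : ∀ j, 0 < j → t j ≤ 4 * Z ^ 2 / (j : ℝ) ^ 2 := by
    intro j hj
    rw [hteq]
    refine (sq_div_node_le hB0 hB1 β hj _).trans ?_
    have h1 : (x + B / 2) ^ 2 ≤ Z ^ 2 := by
      apply sq_le_sq'
      · linarith [hx.1]
      · linarith [hx.2]
    gcongr
  have ht0 : ∀ j, 0 ≤ t j := fun j => by rw [hteq]; exact sq_nonneg _
  have ht0' : ∀ j, 0 ≤ t' j := fun j => by rw [hteq']; exact sq_nonneg _
  have htail := abs_tail_prod_sub_le (T := T x) hC0 hJ0 hJ1 hq0 (by omega)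
    (by omega : q ≤ 4 * ((q - 1) / 2)) (by linarith)
    ht0 ht0' ht htt (by rw [hteq, hZ]; exact hT3 _ hJh)
  have hhead := abs_head_prod_sub_le (J := J) hC0 hq0 ht0 ht0' ht
    fun j hj hjJ => htt j hj (hjJ.trans hJh)
  rw [← hR] at hhead
  have hlog' := hlog q ((q' : ℝ) / q) B' (by omega) hB'0 hB'1 hBB hγ
  have hcos := abs_ite_cos_sub_one_le hB'0 hB'1 hq0 hx
  have hsin := abs_two_mul_sin_sub_le hκ hB'0 hB'1 hBB hq0 hx (by linarith)
  rw [← hZ] at hcos hsin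
  have hxB : |(2 * Real.pi * |x + B|)| ≤ 8 * Z := by
    have h1 : |x + B| ≤ Z := abs_le.2 ⟨by linarith [hx.1], by linarith [hx.2]⟩
    rw [abs_mul, abs_mul, abs_two, abs_of_pos hpi, abs_abs]
    nlinarith [abs_nonneg (x + B)]
  obtain ⟨u, v, hu, hv, huv⟩ := exists_relative_absolute_error (ε := 1 / √(q : ℝ))
    (δ := 1 / (q : ℝ) ^ 2) (A₁ := A₁) (A₂ := A₂) (A₃ := A₃) (M₁ := 32 * Z ^ 3 + 8 * κ)
    (M₂ := R ^ J * (J * C)) (M₃ := R ^ J) (M₄ := 8 * Z) hT1 hT2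
    (htail.trans (le_of_eq (by rw [hA₁]; ring)))
    (hlog'.trans (le_of_eq (by rw [hA₂]; ring)))
    (hcos.trans (le_of_eq (by rw [hA₃]; ring)))
    (hsmall _ (by linarith)) (hsmall _ (by linarith)) (hsmall _ (by linarith))
    (by positivity) (by positivity) (by positivity)
    (hsin.trans (le_of_eq (by ring))) (hhead.1.trans (le_of_eq (by ring)))
    (by rw [abs_abs]; exact hhead.2) hxB
  rw [mul_one_div] at hu
  rw [← hL, mul_one_div] at hv
  refine ⟨u, v, hu.trans ?_, hv.trans ?_, ?_⟩
  · exact div_le_div_of_nonneg_right (by linarith) hsq1.le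
  · exact div_le_div_of_nonneg_right (by linarith) (by positivity)
  have hG : limitFun B β x = Real.exp (2 * Λ) *
      (2 * Real.pi * |x + B| * |∏ j ∈ Finset.Ioc 0 J, (1 - t j)|) * T x := by
    rw [limitFun, hprod, eq_head_mul_tail hF hT hx, abs_mul,
      abs_of_pos (by linarith : 0 < T x), hteq]
    ring
  -- the tail product is close to `T x ≥ 1 / 2`, so that its absolute value may be dropped
  have htpos : 0 ≤ ∏ j ∈ Finset.Ioc J ((q - 1) / 2), (1 - t' j) := by
    have h1 := (abs_le.1 htail).1
    have h2 := hsmall A₁ (by linarith)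
    have h3 : A₁ * (1 / √(q : ℝ)) = 2 * ((C + 16 * Z ^ 2) / √(q : ℝ)) := by rw [hA₁]; ring
    linarith
  rw [hG, ← huv, prod_abs_two_sin_eq hq0 hσ hpq hα, Icc_one_eq_Ioc_zero,
    prod_Ioc_sineFactor_eq hB'0 hB'1 _ _ hq0 le_rfl,
    ← Finset.prod_Ioc_consecutive _ (Nat.zero_le J) hJh, abs_mul, hteq']
  rw [hteq'] at htpos
  rw [abs_of_nonneg htpos]

end Comparison

/-! ### The limit along residue classes -/

theorem periodIndex_mem {p : ℕ} (hp : 0 < p) (s k : ℕ) :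
    1 ≤ periodIndex s p k ∧ periodIndex s p k ≤ p := by
  have hp' : (0 : ℤ) < p := by exact_mod_cast hp
  have h1 := Int.emod_nonneg ((k : ℤ) - s - 1) hp'.ne'
  have h2 := Int.emod_lt_of_pos ((k : ℤ) - s - 1) hp'
  rw [periodIndex]
  constructor <;> omega

theorem exists_eq_add_mul_add_periodIndex {s k : ℕ} (p : ℕ) (hk : s < k) :
    ∃ m, k = s + m * p + periodIndex s p k := by
  obtain ⟨i, rfl⟩ : ∃ i, k = s + 1 + i := ⟨k - (s + 1), by omega⟩
  refine ⟨i / p, ?_⟩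
  have h1 : periodIndex s p (s + 1 + i) = i % p + 1 := by
    rw [periodIndex, show ((s + 1 + i : ℕ) : ℤ) - s - 1 = (i : ℤ) by push_cast; ring,
      ← Int.natCast_mod]
    omega
  have h2 := Nat.mod_add_div i p
  rw [h1, mul_comm]
  omega

theorem continuous_perturbedSudler (α : ℝ) (k : ℕ) : Continuous (perturbedSudler α k) := by
  unfold perturbedSudler
  fun_prop

section Period

variable {α η c : ℝ} {s p : ℕ}

theorem convErr_add_mul (hη : 1 < η) (herr : ∀ k, s ≤ k → convErr α k = η * convErr α (k + p))
    {k : ℕ} (hk : s ≤ k) (m : ℕ) : convErr α (k + m * p) = convErr α k * (η ^ m)⁻¹ := by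
  have hη0 : η ≠ 0 := by positivity
  rw [iterate_period (f := convErr α) (η := η⁻¹)
      (fun k hk => by rw [herr k hk, inv_mul_cancel_left₀ hη0]) k m hk,
    inv_pow, mul_comm]

theorem dominantPart_mul_convErr_add_mul (hη : 1 < η)
    (herr : ∀ k, s ≤ k → convErr α k = η * convErr α (k + p))
    (hdom : ∀ k, s ≤ k → dominantPart α c (k + p) = η * dominantPart α c k)
    {k : ℕ} (hk : s ≤ k) (m : ℕ) :
    dominantPart α c (k + m * p) * convErr α (k + m * p) =
      dominantPart α c k * convErr α k := by
  have hη0 : η ^ m ≠ 0 := by positivity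
  rw [convErr_add_mul hη herr hk, iterate_period hdom k m hk]
  field_simp

theorem abs_convDen_mul_convErr_sub_le (h : Irrational α) (hη : 1 < η)
    (herr : ∀ k, s ≤ k → convErr α k = η * convErr α (k + p))
    (hdom : ∀ k, s ≤ k → dominantPart α c (k + p) = η * dominantPart α c k)
    {k : ℕ} (hk : s ≤ k) (m : ℕ) :
    |convDen α (k + m * p) * convErr α (k + m * p) - dominantPart α c k * convErr α k| ≤
      |c| / (convDen α (k + m * p) : ℝ) ^ 2 := by
  rw [← dominantPart_mul_convErr_add_mul hη herr hdom hk m, ← sub_mul, abs_mul]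
  have h0 := convErr_pos h (k + m * p)
  have h1 := (convErr_lt_inv h (k + m * p)).le
  have h2 := abs_convDen_sub_dominantPart_le h c (k + m * p)
  rw [abs_of_pos h0]
  calc _ ≤ |c| * convErr α (k + m * p) * convErr α (k + m * p) := by gcongr
    _ ≤ |c| * (1 / (convDen α (k + m * p) : ℝ)) * (1 / (convDen α (k + m * p) : ℝ)) := by gcongr
    _ = _ := by ring

theorem tendsto_convDen_add_mul (h : Irrational α) (hp : 0 < p) (k : ℕ) :
    Tendsto (fun m => (convDen α (k + m * p) : ℝ)) atTop atTop := by
  refine tendsto_natCast_atTop_atTop.comp ((tendsto_convDen h).comp ?_)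
  refine tendsto_atTop_mono (fun m => ?_) tendsto_id
  have := Nat.le_mul_of_pos_right m hp
  simp only [id]
  omega

/-- The constant `C_r E_r` is the limit of `q_k δ_k < 1` along the residue class of `r`. -/
theorem dominantPart_mul_convErr_le_one (h : Irrational α) (hp : 0 < p) (hη : 1 < η)
    (herr : ∀ k, s ≤ k → convErr α k = η * convErr α (k + p))
    (hdom : ∀ k, s ≤ k → dominantPart α c (k + p) = η * dominantPart α c k)
    {k : ℕ} (hk : s ≤ k) : dominantPart α c k * convErr α k ≤ 1 := by
  have h1 : Tendsto (fun m => 1 + |c| / (convDen α (k + m * p) : ℝ) ^ 2) atTop (𝓝 (1 + 0)) :=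
    tendsto_const_nhds.add (tendsto_const_nhds.div_atTop
      ((tendsto_pow_atTop two_ne_zero).comp (tendsto_convDen_add_mul h hp k)))
  rw [add_zero] at h1
  refine ge_of_tendsto' h1 fun m => ?_
  have h2 := (abs_le.1 (abs_convDen_mul_convErr_sub_le h hη herr hdom hk m)).1
  have h3 := convDen_mul_convErr_lt h (k + m * p)
  linarith

/-- The quantitative limit theorem along one residue class, and the regularity of the limit. -/
theorem limit_along_residue_class (h : Irrational α) (hp : 0 < p) (hη : 1 < η)
    (herr : ∀ k, s ≤ k → convErr α k = η * convErr α (k + p))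
    (hdom : ∀ k, s ≤ k → dominantPart α c (k + p) = η * dominantPart α c k)
    {k : ℕ} (hk : s ≤ k) {B β : ℝ} (hB : B = dominantPart α c (k + 1) * convErr α (k + 1))
    (hβ : β = dominantRatio α c k) :
    ProdConvergesLocallyUniformly (limitFactor B β) (limitProd B β) ∧
    Continuous (limitFun B β) ∧ ContDiffOn ℝ 1 (limitFun B β) {x | limitFun B β x ≠ 0} ∧
    ∀ X, 0 ≤ X → ∃ (K : ℝ) (q₀ : ℕ), 0 ≤ K ∧ ∀ m, q₀ ≤ convDen α (k + 1 + m * p) →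
      ∀ x ∈ Set.Icc (-X) X, ∃ u v : ℝ, |u| ≤ K / √(convDen α (k + 1 + m * p) : ℝ) ∧
        |v| ≤ K / (convDen α (k + 1 + m * p) : ℝ) ^ 2 ∧
        perturbedSudler α (k + 1 + m * p) x = (1 + u) * limitFun B β x + v := by
  have hk' : s ≤ k + 1 := by omega
  have hB0 : 0 < B := by
    rw [hB]
    exact mul_pos (dominantPart_pos h hp hη hdom hk') (convErr_pos h _)
  have hB1 : B ≤ 1 := by
    rw [hB]
    exact dominantPart_mul_convErr_le_one h hp hη herr hdom hk'
  obtain ⟨c', hc'⟩ := exists_isBadlyApproximable_dominantRatio h hp hη hdom hk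
  obtain ⟨κ, hκ, hκ'⟩ := exists_abs_div_sub_dominantRatio_le h hp hη hdom hk
  rw [← hβ] at hc' hκ'
  obtain ⟨Λ, K₀, hK₀, hΛ⟩ := exists_log_displacement_limit hc' hB0 hB1
  obtain ⟨F, hF, hF'⟩ := exists_contDiff_product hB0 hB1 β
  have hlim := tendsto_of_abs_sub_le_div_sqrt hΛ
  have hprod := limitProd_eq hB0 hB1 hlim hF'
  refine ⟨prodConvergesLocallyUniformly hB0 hB1 hlim hF', continuous_limitFun hF hprod,
    contDiffOn_limitFun hF hprod, fun X hX => ?_⟩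
  obtain ⟨K, q₀, hK, hest⟩ := exists_sudler_estimate hc' (add_nonneg (abs_nonneg c) hκ)
    hB0 hB1 hK₀ hΛ hF' hX
  refine ⟨K, q₀, hK, fun m hm x hx => ?_⟩
  -- the convergents of index `i` and `i + 1`, whose determinant is `(-1) ^ i`
  obtain ⟨i, hi⟩ : ∃ i, i = k + m * p := ⟨_, rfl⟩
  have hi1 : k + 1 + m * p = i + 1 := by omega
  have hBB := abs_convDen_mul_convErr_sub_le h hη herr hdom hk' m
  have hγ := hκ' m
  rw [← hB, hi1] at hBB
  rw [hi1, ← hi] at hγ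
  rw [hi1] at hm ⊢
  have hq0 : (0 : ℝ) < convDen α (i + 1) := by exact_mod_cast convDen_pos α (i + 1)
  have hdet := convNum_mul_convDen_sub h i
  have herr' := signed_err_eq (ξ := α) (i + 1)
  obtain ⟨u, v, hu, hv, huv⟩ := hest (convDen α (i + 1)) (convNum α (i + 1)) (convDen α i)
    ((-1) ^ (i + 1)) (convNum α i) α (convDen α (i + 1) * convErr α (i + 1)) hm
    (convDen_pos α _) (neg_one_pow_eq_or ℤ (i + 1)) (by rw [pow_succ]; linarith)
    (by
      rw [mul_div_cancel_left₀ _ hq0.ne']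
      push_cast
      linarith)
    (mul_pos hq0 (convErr_pos h _)) (convDen_mul_convErr_lt h _).le
    (hBB.trans (div_le_div_of_nonneg_right (by linarith) (by positivity)))
    (by
      rw [Int.cast_natCast]
      exact hγ.trans (div_le_div_of_nonneg_right (by linarith [abs_nonneg c]) (by positivity)))
    x hx
  refine ⟨u, v, hu, hv, ?_⟩
  rw [← huv, perturbedSudler]
  push_cast
  rfl

end Period

/-- Relative and absolute errors tending to zero locally uniformly give locally uniform
convergence to a continuous limit. -/
theorem tendstoLocallyUniformly_of_errors {f : ℕ → ℝ → ℝ} {G : ℝ → ℝ} {q : ℕ → ℕ}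
    (hG : Continuous G) (hq : Tendsto (fun m => (q m : ℝ)) atTop atTop)
    (h : ∀ X, 0 ≤ X → ∃ (K : ℝ) (q₀ : ℕ), 0 ≤ K ∧ ∀ m, q₀ ≤ q m → ∀ x ∈ Set.Icc (-X) X,
      ∃ u v : ℝ, |u| ≤ K / √(q m : ℝ) ∧ |v| ≤ K / (q m : ℝ) ^ 2 ∧ f m x = (1 + u) * G x + v) :
    TendstoLocallyUniformly f G atTop := by
  rw [tendstoLocallyUniformly_iff_forall_isCompact]
  intro S hS
  obtain ⟨X, hX, hSX⟩ := exists_subset_Icc_neg hS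
  obtain ⟨K, q₀, hK, hest⟩ := h X hX
  obtain ⟨M, hM⟩ := (isCompact_Icc (a := -X) (b := X)).exists_bound_of_continuousOn hG.continuousOn
  have h1 : Tendsto (fun m => K / √(q m : ℝ) * M + K / (q m : ℝ) ^ 2) atTop (𝓝 (0 * M + 0)) :=
    ((tendsto_const_nhds.div_atTop (Real.tendsto_sqrt_atTop.comp hq)).mul_const M).add
      (tendsto_const_nhds.div_atTop ((tendsto_pow_atTop two_ne_zero).comp hq))
  rw [zero_mul, add_zero] at h1
  refine tendstoUniformlyOn_of_abs_sub_le h1 ?_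
  filter_upwards [hq.eventually_ge_atTop (q₀ : ℝ)] with m hm x hx
  obtain ⟨u, v, hu, hv, e⟩ := hest m (by exact_mod_cast hm) x (hSX hx)
  rw [e, show (1 + u) * G x + v - G x = u * G x + v by ring]
  refine (abs_add_le _ _).trans ?_
  rw [abs_mul]
  have h2 : |G x| ≤ M := hM x (hSX hx)
  gcongr

/-- The exceptional indices below `N` are absorbed into the additive error. Elsewhere the rate
`q^{-1/2}` is stronger than the one claimed, `log q` being bounded below for `q ≥ 2`; for `q = 1`
the claimed relative error is zero. -/
theorem exists_uniform_rate {f G : ℕ → ℝ → ℝ} {q : ℕ → ℕ} {a b K : ℝ} {N : ℕ}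
    (hq : ∀ k, 0 < q k) (hf : ∀ k, Continuous (f k)) (hG : ∀ k, Continuous (G k)) (hK : 0 ≤ K)
    (h : ∀ k, N ≤ k → 2 ≤ q k ∧ ∀ x ∈ Set.Icc a b, ∃ u v : ℝ, |u| ≤ K / √(q k : ℝ) ∧
      |v| ≤ K / (q k : ℝ) ^ 2 ∧ f k x = (1 + u) * G k x + v) :
    ∃ K' : ℝ, ∀ k, ∀ x ∈ Set.Icc a b, ∃ u v : ℝ,
      |u| ≤ K' * ((q k : ℝ) ^ (-(1 / 2) : ℝ) * Real.log (q k) ^ (3 / 4 : ℝ)) ∧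
      |v| ≤ K' * ((q k : ℝ) ^ 2)⁻¹ ∧ f k x = (1 + u) * G k x + v := by
  have hM : ∀ k, ∃ M : ℝ, 0 ≤ M ∧ ∀ x ∈ Set.Icc a b, |f k x - G k x| ≤ M := by
    intro k
    obtain ⟨M, hM⟩ := (isCompact_Icc (a := a) (b := b)).exists_bound_of_continuousOn
      ((hf k).sub (hG k)).continuousOn
    exact ⟨max M 0, le_max_right _ _, fun x hx => (hM x hx).trans (le_max_left _ _)⟩
  choose M hM0 hM using hM
  obtain ⟨l, hl⟩ : ∃ l, l = Real.log 2 ^ (3 / 4 : ℝ) := ⟨_, rfl⟩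
  have hl0 : 0 < l := by rw [hl]; exact Real.rpow_pos_of_pos (Real.log_pos one_lt_two) _
  obtain ⟨S, hS⟩ : ∃ S, S = ∑ k ∈ Finset.range N, M k * (q k : ℝ) ^ 2 := ⟨_, rfl⟩
  have hS0 : 0 ≤ S := by
    rw [hS]
    exact Finset.sum_nonneg fun k _ => mul_nonneg (hM0 k) (by positivity)
  have hKl : 0 ≤ K / l := by positivity
  refine ⟨K / l + K + S, fun k x hx => ?_⟩
  have hq1 : (1 : ℝ) ≤ q k := by exact_mod_cast hq k
  rcases lt_or_ge k N with hk | hk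
  · refine ⟨0, f k x - G k x, ?_, ?_, by ring⟩
    · rw [abs_zero]
      have := Real.log_nonneg hq1
      positivity
    · refine (hM k x hx).trans ?_
      rw [← div_eq_mul_inv, le_div_iff₀ (by positivity)]
      have h1 : M k * (q k : ℝ) ^ 2 ≤ S := by
        rw [hS]
        exact Finset.single_le_sum (f := fun k => M k * (q k : ℝ) ^ 2)
          (fun k _ => mul_nonneg (hM0 k) (by positivity)) (Finset.mem_range.2 hk)
      linarith
  · obtain ⟨hq2, h⟩ := h k hk
    obtain ⟨u, v, hu, hv, e⟩ := h x hx
    refine ⟨u, v, hu.trans ?_, hv.trans ?_, e⟩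
    · have hq2' : (2 : ℝ) ≤ q k := by exact_mod_cast hq2
      have h1 : l ≤ Real.log (q k) ^ (3 / 4 : ℝ) := by
        rw [hl]
        exact Real.rpow_le_rpow (Real.log_nonneg one_le_two)
          (Real.log_le_log two_pos hq2') (by norm_num)
      have h2 : (q k : ℝ) ^ (-(1 / 2) : ℝ) = (√(q k : ℝ))⁻¹ := by
        rw [Real.rpow_neg (by linarith), Real.sqrt_eq_rpow]
      rw [h2]
      calc K / √(q k : ℝ) = K / l * ((√(q k : ℝ))⁻¹ * l) := by field_simp
        _ ≤ (K / l + K + S) * ((√(q k : ℝ))⁻¹ * Real.log (q k) ^ (3 / 4 : ℝ)) := by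
          gcongr
          linarith
    · rw [div_eq_mul_inv]
      gcongr
      linarith

end SudlerLimit

theorem theorem2 (α : ℝ) (hα : SudlerLimit.IsQuadraticIrrational α) :
    -- the continued fraction of `α` is eventually periodic
    (∃ s p : ℕ, SudlerLimit.HasPeriod α s p) ∧
    ∀ s p : ℕ, SudlerLimit.HasPeriod α s p →
      -- the constants; they are uniquely determined by the relations below
      ∃ (η : ℝ) (C D E A : ℕ → ℝ), 1 < η ∧
        (∀ r : ℕ, 1 ≤ r → r ≤ p →
          0 < C r ∧ 0 < E r ∧
          (∀ m : ℕ, (SudlerLimit.convDen α (s + m * p + r) : ℝ)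
              = C r * η ^ m + D r * (-1) ^ (m * p) * (η ^ m)⁻¹) ∧
          (∀ m : ℕ, SudlerLimit.convErr α (s + m * p + r) = E r * (η ^ m)⁻¹) ∧
          SudlerLimit.IsReversedPeriod α s p r (A r)) ∧
        -- convergence of the product, and regularity of the limit function
        (∀ r : ℕ, 1 ≤ r → r ≤ p →
          SudlerLimit.ProdConvergesLocallyUniformly
            (SudlerLimit.limitFactor (C r * E r) (A r))
            (SudlerLimit.limitProd (C r * E r) (A r)) ∧
          Continuous (SudlerLimit.limitFun (C r * E r) (A r)) ∧
          IsOpen {x : ℝ | SudlerLimit.limitFun (C r * E r) (A r) x ≠ 0} ∧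
          ContDiffOn ℝ 1 (SudlerLimit.limitFun (C r * E r) (A r))
            {x : ℝ | SudlerLimit.limitFun (C r * E r) (A r) x ≠ 0}) ∧
        -- the asymptotics with an explicit rate
        (∀ a b : ℝ, ∃ K : ℝ, ∀ k : ℕ, 1 ≤ k → ∀ x ∈ Set.Icc a b, ∃ u v : ℝ,
          |u| ≤ K * ((SudlerLimit.convDen α k : ℝ) ^ (-(1 / 2) : ℝ) *
            Real.log (SudlerLimit.convDen α k) ^ (3 / 4 : ℝ)) ∧
          |v| ≤ K * ((SudlerLimit.convDen α k : ℝ) ^ 2)⁻¹ ∧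
          SudlerLimit.perturbedSudler α k x =
            (1 + u) * SudlerLimit.limitFun
              (C (SudlerLimit.periodIndex s p k) * E (SudlerLimit.periodIndex s p k))
              (A (SudlerLimit.periodIndex s p k)) x + v) ∧
        -- locally uniform convergence along residue classes
        (∀ r : ℕ, 1 ≤ r → r ≤ p →
          TendstoLocallyUniformly
            (fun (m : ℕ) (x : ℝ) => SudlerLimit.perturbedSudler α (s + m * p + r) x)
            (SudlerLimit.limitFun (C r * E r) (A r)) atTop) := by
  refine ⟨SudlerLimit.exists_hasPeriod hα, fun s p hper => ?_⟩
  have h := hα.1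
  have hp := hper.1
  obtain ⟨η, c, hη, herr, hdom⟩ := SudlerLimit.exists_period_constants h hper
  have hmain := fun r => SudlerLimit.limit_along_residue_class h hp hη herr hdom
    (Nat.le_add_right s r) rfl rfl
  have hidx : ∀ r m, 1 ≤ r → s + m * p + r = s + (r - 1) + 1 + m * p := fun r m hr => by omega
  have hidx' : ∀ r, 1 ≤ r → s + r = s + (r - 1) + 1 := fun r hr => by omega
  -- `A r` is the limit of `q_{k-1} / q_k` for `k` in the residue class of `r`
  refine ⟨η, fun r => SudlerLimit.dominantPart α c (s + r),
    fun r => c * ((-1) ^ (s + r) * SudlerLimit.convErr α (s + r)),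
    fun r => SudlerLimit.convErr α (s + r),
    fun r => SudlerLimit.dominantRatio α c (s + (r - 1)), hη, ?_, ?_, ?_, ?_⟩
  · intro r hr _
    have hE : ∀ m, SudlerLimit.convErr α (s + m * p + r) =
        SudlerLimit.convErr α (s + r) * (η ^ m)⁻¹ := by
      intro m
      rw [← SudlerLimit.convErr_add_mul hη herr (Nat.le_add_right s r), add_right_comm]
    refine ⟨SudlerLimit.dominantPart_pos h hp hη hdom (Nat.le_add_right s r),
      SudlerLimit.convErr_pos h _, fun m => ?_, hE, ?_⟩
    · have h1 := SudlerLimit.iterate_period hdom (s + r) m (Nat.le_add_right s r)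
      rw [SudlerLimit.dominantPart, add_right_comm, hE] at h1
      rw [mul_comm (SudlerLimit.dominantPart α c (s + r)), ← h1,
        show s + m * p + r = s + r + m * p by ring, pow_add]
      ring
    · have h1 := SudlerLimit.isReversedPeriod_dominantRatio h hper hη hdom (r - 1)
      rwa [Nat.sub_add_cancel hr] at h1
  · intro r hr _
    obtain ⟨h1, h2, h3, -⟩ := hmain (r - 1)
    simp only [hidx' r hr]
    exact ⟨h1, h2, isOpen_ne_fun h2 continuous_const, h3⟩
  · intro a b
    -- the constants of the residue classes are added up to obtain uniform ones
    have hX : 0 ≤ max |a| |b| := (abs_nonneg a).trans (le_max_left _ _)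
    have hsub : Set.Icc a b ⊆ Set.Icc (-max |a| |b|) (max |a| |b|) := fun x hx =>
      ⟨(neg_le_neg (le_max_left _ _)).trans ((neg_abs_le a).trans hx.1),
        hx.2.trans ((le_abs_self b).trans (le_max_right _ _))⟩
    choose K q₀ hK hest using fun r => (hmain r).2.2.2 _ hX
    obtain ⟨K', hK'⟩ := SudlerLimit.exists_uniform_rate
      (f := SudlerLimit.perturbedSudler α)
      (G := fun k => SudlerLimit.limitFun
        (SudlerLimit.dominantPart α c (s + SudlerLimit.periodIndex s p k) *
          SudlerLimit.convErr α (s + SudlerLimit.periodIndex s p k))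
        (SudlerLimit.dominantRatio α c (s + (SudlerLimit.periodIndex s p k - 1))))
      (q := SudlerLimit.convDen α) (a := a) (b := b) (K := ∑ r ∈ Finset.range p, K r)
      (N := s + 2 + ∑ r ∈ Finset.range p, q₀ r) (SudlerLimit.convDen_pos α)
      (SudlerLimit.continuous_perturbedSudler α)
      (fun k => by
        simp only [hidx' _ (SudlerLimit.periodIndex_mem hp s k).1]
        exact (hmain _).2.1)
      (Finset.sum_nonneg fun r _ => hK r)
      (fun k hk => by
        have hkq := SudlerLimit.le_convDen h k
        refine ⟨by omega, fun x hx => ?_⟩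
        obtain ⟨hr1, hrp⟩ := SudlerLimit.periodIndex_mem hp s k
        obtain ⟨m, hm⟩ := SudlerLimit.exists_eq_add_mul_add_periodIndex p (by omega : s < k)
        obtain ⟨r, hr⟩ : ∃ r, r = SudlerLimit.periodIndex s p k := ⟨_, rfl⟩
        rw [← hr] at hr1 hrp hm ⊢
        rw [hidx r m hr1] at hm
        have hmem : r - 1 ∈ Finset.range p := Finset.mem_range.2 (by omega)
        have hq₀ : q₀ (r - 1) ≤ ∑ r ∈ Finset.range p, q₀ r :=
          Finset.single_le_sum (fun _ _ => Nat.zero_le _) hmem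
        have hKr : K (r - 1) ≤ ∑ r ∈ Finset.range p, K r :=
          Finset.single_le_sum (fun i _ => hK i) hmem
        obtain ⟨u, v, hu, hv, e⟩ := hest (r - 1) m (by rw [← hm]; omega) x (hsub hx)
        rw [← hm] at hu hv e
        rw [hidx' r hr1]
        exact ⟨u, v, hu.trans (by gcongr), hv.trans (by gcongr), e⟩)
    exact ⟨K', fun k _ => hK' k⟩
  · intro r hr _
    obtain ⟨-, h2, -, h4⟩ := hmain (r - 1)
    simp only [hidx r _ hr, hidx' r hr]
    exact SudlerLimit.tendstoLocallyUniformly_of_errors h2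
      (SudlerLimit.tendsto_convDen_add_mul h hp _) h4
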